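/- Let $1\to G\to D=(\mathbb{C}^\times)^E\to T\to 1$ be a short exact sequence of complex tori, $E$ a finite set, with cocharacter sequence $0\to\mathfrak g_{\mathbb Z}\xrightarrow{\partial}\mathbb{Z}^E\to\mathfrak t_{\mathbb Z}\to 0$, and assume that $\mathbb{Z}^E\to\mathfrak t_{\mathbb Z}$ is totally unimodular (for some choice of integer basis of $\mathfrak t_{\mathbb Z}$). For $e\in E$ let $a_e$ be the character of $G$ on the $e$-th coordinate of $\mathbb{C}^E$. Let $\mu_G(x,y)(\xi)=\sum_e(\partial\xi)_e x_ey_e$ ($\xi\in\mathfrak g_{\mathbb Z}$) be the moment map of $G$ on $T^\vee\mathbb{C}^E$. A character $\eta$ of $G$ is called generic if $\langle\eta,\beta\rangle\neq 0$ for every circuit $\beta$, i.e. for every nonzero primitive $\beta\in\mathfrak g_{\mathbb Z}$ such that $\partial\beta$ has minimal support; set $X_\eta=\mu_G^{-1}(0)/\!\!/_\eta G$. Fix $\mathbf m\in\mathbb{Z}^E$, $\gamma\in\mathfrak g_{\mathbb Z}$, and put $\mathscr M_x^e=\mathcal O((\mathbf m_e+1)\infty)$ and $\mathscr M_y^e=\mathcal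 O((-\mathbf m_e+1)\infty)$ on $\mathbb{P}^1$, so that $\mathscr M^e_x\otimes\mathscr M^e_y\cong\omega_{\mathbb P^1}^{-1}$. A twisted quasimap of degree $\gamma$ is a principal $G$-bundle $\mathscr P$ on $\mathbb{P}^1$ such that for each character $\chi$ of $G$ the associated line bundle $\mathscr{P}_\chi$ has degree $\langle\chi,\gamma\rangle$, together with sections $x_e$ of $(\mathscr M_x^e)^{-1}\otimes\mathscr P_{a_e}$ and $y_e$ of $(\mathscr M_y^e)^{-1}\otimes\mathscr P_{a_e}^{-1}$ for $e\in E$, satisfying $\sum_e(\partial\xi)_e\,x_ey_e=0$ for all $\xi\in\mathfrak g_{\mathbb Z}$. (If $\partial$ is given by the incidence matrix of a graph with edge set $E$ and one framing vertex $v_f$ removed, this is a line bundle $\mathscr F_v$ for each vertex $v$, with $\mathscr F_{v_f}$ trivial, and maps $x_e:\mathscr M_x^e\otimes\mathscr F_{t(e)}\to\mathscr F_{h(e)}$ and $y_e:\mathscr M_y^e\otimes\mathscr F_{h(e)}\to\mathscr F_{t(e)}$ subject to the moment map relations at the vertices $v\ne v_f$.) It is stable if over some dense open $U\subset\mathbb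 P^1$ the induced map $U\to[\mu_G^{-1}(0)/G]$ has image in the $\eta$-stable locus (which for generic $\eta$ is the $\eta$-semistable locus). Let $\mathfrak Q_{\mathbf m}(\mathbb P^1,X_\eta,\gamma)$ be the moduli stack over $\mathbb{C}$ of stable twisted quasimaps of degree $\gamma$; its objects over $S$ are families of such data on $\mathbb P^1\times S$ with degree and stability imposed on the fibres. Theorem. For every generic $\eta$, and all $\mathbf m$ and $\gamma$, the stack $\mathfrak Q_{\mathbf m}(\mathbb P^1,X_\eta,\gamma)$ is (represented by) a smooth complex variety: a scheme smooth, separated and of finite type over $\mathbb{C}$, which is integral unless it is empty. -/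

import Mathlib

open AlgebraicGeometry CategoryTheory Polynomial LaurentPolynomial

/-!
Hypertoric data, torus torsors on the projective line, twisted quasimaps, and their moduli problem.
-/

/-- A short exact sequence of complex tori `1 → G → D → T → 1` with `G = (ℂˣ)^I`, `D = (ℂˣ)^E`,
`T = (ℂˣ)^J`, given by its (exact) sequence of cocharacter lattices
`0 → ℤ^I → ℤ^E → ℤ^J → 0` (the first map is `∂`), where the matrix of the second map is totally
unimodular.  The `e`-th row `incl e` of `∂` is the character by which `G` acts on the `e`-th
coordinate of `ℂ^E`. -/
structure HypertoricDatum (E I J : Type) [Fintype E] [Fintype I] [Fintype J] where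
  incl : Matrix E I ℤ
  proj : Matrix J E ℤ
  incl_injective : Function.Injective incl.mulVec
  exact : Function.Exact incl.mulVec proj.mulVec
  proj_surjective : Function.Surjective proj.mulVec
  unimodular : proj.IsTotallyUnimodular

namespace HypertoricDatum

variable {E I J : Type} [Fintype E] [Fintype I] [Fintype J] (D : HypertoricDatum E I J)

/-- A circuit: a nonzero primitive cocharacter of `G` whose image in `ℤ^E` has minimal support
among the images of nonzero cocharacters. -/
def IsCircuit (γ : I → ℤ) : Prop :=
  γ ≠ 0 ∧ (∀ (n : ℤ) (γ' : I → ℤ), γ = n • γ' → IsUnit n) ∧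
    ∀ γ' : I → ℤ, γ' ≠ 0 →
      Function.support (D.incl.mulVec γ') ⊆ Function.support (D.incl.mulVec γ) →
        Function.support (D.incl.mulVec γ') = Function.support (D.incl.mulVec γ)

/-- The character `η` of `G` is generic: it lies on none of the (finitely many) root hyperplanes
`γ^⊥`, `γ` a circuit. -/
def IsGeneric (η : I → ℤ) : Prop :=
  ∀ γ : I → ℤ, D.IsCircuit γ → η ⬝ᵥ γ ≠ 0

/-- The weights of the `G`-action on the coordinates of `T^∨ ℂ^E`:
`Sum.inl e` is the coordinate `x_e`, `Sum.inr e` is the coordinate `y_e`. -/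
def weight : E ⊕ E → (I → ℤ)
  | Sum.inl e => D.incl e
  | Sum.inr e => -D.incl e

/-- The point of `T^∨ ℂ^E` with coordinates `(x, y)` in a field `κ` over `ℂ` lies in the
`η`-semistable locus: for some `n > 0`, some polynomial function `f` with `g^* f = η(g)^n f`
(that is, weight-homogeneous of weight `n • η`) does not vanish there.  For generic `η`, the
semistable locus is the stable locus. -/
def IsSemistable (η : I → ℤ) {κ : Type} [Field κ] [Algebra ℂ κ] (x y : E → κ) : Prop :=
  ∃ (n : ℕ) (f : MvPolynomial (E ⊕ E) ℂ), 0 < n ∧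
    MvPolynomial.IsWeightedHomogeneous D.weight f (n • η) ∧
    MvPolynomial.aeval (Sum.elim x y) f ≠ 0

end HypertoricDatum

/-! ### Torsors under the split torus with character lattice `ℤ^I` -/

/-- A torsor under the torus `G = (𝔾_m)^I` over the affine scheme `Spec B`.  Its total space is
`Spec` of `carrier`; the `G`-action is the grading by characters; and it is a torsor exactly when
the degree zero part is `B` and the product of the pieces of degrees `χ` and `ψ` is the piece of
degree `χ + ψ`.  The piece of degree `χ` is an invertible `B`-module, the line bundle associated
to the torsor and the character `χ`.  (In terms of line bundles: the piece of degree the `i`-th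
unit vector is a line bundle `F_i`, and the torsor is the frame bundle of the tuple
`(F_i)_{i ∈ I}`.) -/
structure TorusTorsor (I : Type) [Fintype I] (B : Type) [CommRing B] where
  carrier : Type
  [commRing : CommRing carrier]
  [algebra : Algebra B carrier]
  gr : (I → ℤ) → Submodule B carrier
  isInternal : DirectSum.IsInternal gr
  algebraMap_injective : Function.Injective (algebraMap B carrier)
  gr_zero : gr 0 = 1
  gr_mul : ∀ χ ψ : I → ℤ, gr χ * gr ψ = gr (χ + ψ)

attribute [instance] TorusTorsor.commRing TorusTorsor.algebra

namespace TorusTorsor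

/-- A `G`-equivariant morphism of total spaces over `Spec φ : Spec B' → Spec B`.  As every
equivariant map of torsors over one base is an isomorphism, it identifies `P'` with the pullback of
`P` along `Spec φ`. -/
@[ext]
structure Hom {I : Type} [Fintype I] {B B' : Type} [CommRing B] [CommRing B'] (φ : B →+* B')
    (P : TorusTorsor I B) (P' : TorusTorsor I B') where
  map : P.carrier →+* P'.carrier
  map_base : ∀ b : B, map (algebraMap B P.carrier b) = algebraMap B' P'.carrier (φ b)
  map_gr : ∀ (χ : I → ℤ) (a : P.carrier), a ∈ P.gr χ → map a ∈ P'.gr χ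

/-- The trivial torsor `G × Spec B`. -/
noncomputable def trivial (I : Type) [Fintype I] (B : Type) [CommRing B] : TorusTorsor I B where
  carrier := AddMonoidAlgebra B (I → ℤ)
  gr := AddMonoidAlgebra.grade B
  isInternal := AddMonoidAlgebra.grade.isInternal
  algebraMap_injective := by
    intro a b h
    exact AddMonoidAlgebra.single_right_inj.mp h
  gr_zero := by
    ext a
    rw [AddMonoidAlgebra.grade_eq_lsingle_range, Submodule.mem_one]
    rfl
  gr_mul := by
    intro χ ψ
    apply le_antisymm
    · rw [Submodule.mul_le]
      intro a ha b hb
      exact SetLike.mul_mem_graded ha hb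
    · intro a ha
      rw [AddMonoidAlgebra.grade_eq_lsingle_range] at ha
      obtain ⟨b, rfl⟩ := ha
      have h : AddMonoidAlgebra.lsingle (R := B) (χ + ψ) b =
          (AddMonoidAlgebra.single χ b : AddMonoidAlgebra B (I → ℤ)) *
            AddMonoidAlgebra.single ψ 1 := by
        rw [AddMonoidAlgebra.single_mul_single, mul_one]; rfl
      rw [h]
      exact Submodule.mul_mem_mul (AddMonoidAlgebra.single_mem_grade _ _)
        (AddMonoidAlgebra.single_mem_grade _ _)

/-- The ring homomorphism over `φ` which sends the standard generator of degree `χ` to `u χ` times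
the standard generator of degree `χ`. -/
noncomputable def trivialMap {I : Type} {B B' : Type} [CommRing B] [CommRing B']
    (φ : B →+* B') (u : Multiplicative (I → ℤ) →* B') :
    AddMonoidAlgebra B (I → ℤ) →+* AddMonoidAlgebra B' (I → ℤ) :=
  AddMonoidAlgebra.liftNCRingHom (AddMonoidAlgebra.singleZeroRingHom.comp φ)
    (AddMonoidAlgebra.singleHom.comp
      (u.prod (MonoidHom.id (Multiplicative (I → ℤ))))) (fun _ _ => Commute.all _ _)

theorem trivialMap_single {I : Type} {B B' : Type} [CommRing B] [CommRing B']
    (φ : B →+* B') (u : Multiplicative (I → ℤ) →* B') (χ : I → ℤ) (b : B) :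
    trivialMap φ u (AddMonoidAlgebra.single χ b) =
      AddMonoidAlgebra.single χ (φ b * u (Multiplicative.ofAdd χ)) := by
  refine (AddMonoidAlgebra.liftNC_single _ _ _ _).trans ?_
  simp [AddMonoidAlgebra.singleHom, AddMonoidAlgebra.single_mul_single]

/-- The morphism of trivial torsors over `φ` which multiplies the standard generator of degree `χ`
by `u χ`. -/
noncomputable def trivialHom {I : Type} [Fintype I] {B B' : Type} [CommRing B] [CommRing B']
    (φ : B →+* B') (u : Multiplicative (I → ℤ) →* B') :
    Hom φ (trivial I B) (trivial I B') where
  map := trivialMap φ u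
  map_base := by
    intro b
    refine (trivialMap_single φ u 0 b).trans ?_
    rw [ofAdd_zero, map_one, mul_one]
    rfl
  map_gr := by
    intro χ a ha
    change a ∈ AddMonoidAlgebra.grade B χ at ha
    rw [AddMonoidAlgebra.grade_eq_lsingle_range] at ha
    obtain ⟨b, rfl⟩ := ha
    change trivialMap φ u (AddMonoidAlgebra.single χ b) ∈ AddMonoidAlgebra.grade B' χ
    rw [trivialMap_single]
    exact AddMonoidAlgebra.single_mem_grade _ _

end TorusTorsor

/-! ### Torsors on the projective line -/

/-- The inclusion of the overlap `Spec R[T, T⁻¹]` in the chart of `ℙ¹_R` around `0`,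
with coordinate `T`. -/
noncomputable def overlapZero (R : Type) [CommRing R] : R[X] →+* R[T;T⁻¹] :=
  Polynomial.toLaurent

/-- The inclusion of the overlap `Spec R[T, T⁻¹]` in the chart of `ℙ¹_R` around `∞`,
with coordinate `T⁻¹`. -/
noncomputable def overlapInfty (R : Type) [CommRing R] : R[X] →+* R[T;T⁻¹] :=
  (LaurentPolynomial.invert (R := R) : R[T;T⁻¹] →+* R[T;T⁻¹]).comp Polynomial.toLaurent

/-- A torsor under `G = (𝔾_m)^I` on `ℙ¹_R`, as its restrictions to the two standard charts (the
lines around `0` and `∞`) and to their overlap, with the restriction maps. -/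
structure P1Torsor (I : Type) [Fintype I] (R : Type) [CommRing R] where
  zero : TorusTorsor I R[X]
  infty : TorusTorsor I R[X]
  overlap : TorusTorsor I R[T;T⁻¹]
  resZero : TorusTorsor.Hom (overlapZero R) zero overlap
  resInfty : TorusTorsor.Hom (overlapInfty R) infty overlap

namespace P1Torsor

/-- A morphism over `φ : R → R'`, which identifies `P'` with the pullback of `P` to `ℙ¹_{R'}`. -/
@[ext]
structure Hom {I : Type} [Fintype I] {R R' : Type} [CommRing R] [CommRing R'] (φ : R →+* R')
    (P : P1Torsor I R) (P' : P1Torsor I R') where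
  zero : TorusTorsor.Hom (Polynomial.mapRingHom φ) P.zero P'.zero
  infty : TorusTorsor.Hom (Polynomial.mapRingHom φ) P.infty P'.infty
  overlap : TorusTorsor.Hom (AddMonoidAlgebra.mapRingHom ℤ φ) P.overlap P'.overlap
  comm_zero : ∀ a, overlap.map (P.resZero.map a) = P'.resZero.map (zero.map a)
  comm_infty : ∀ a, overlap.map (P.resInfty.map a) = P'.resInfty.map (infty.map a)

/-- The character-indexed transition functions `χ ↦ T ^ ⟨χ, γ⟩`. -/
noncomputable def transition {I : Type} [Fintype I] (R : Type) [CommRing R] (γ : I → ℤ) :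
    Multiplicative (I → ℤ) →* R[T;T⁻¹] where
  toFun χ := LaurentPolynomial.T (χ.toAdd ⬝ᵥ γ)
  map_one' := by simp
  map_mul' χ ψ := by rw [toAdd_mul, add_dotProduct, LaurentPolynomial.T_add]

/-- The standard torsor `𝒪(γ)` on `ℙ¹_R`, for a cocharacter `γ` of `G`: the line bundle associated
to a character `χ` is `𝒪(⟨χ, γ⟩ · ∞)`, whose generator around `∞` is `T ^ ⟨χ, γ⟩` times the
generator around `0`. -/
noncomputable def standard {I : Type} [Fintype I] (R : Type) [CommRing R] (γ : I → ℤ) :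
    P1Torsor I R where
  zero := TorusTorsor.trivial I R[X]
  infty := TorusTorsor.trivial I R[X]
  overlap := TorusTorsor.trivial I R[T;T⁻¹]
  resZero := TorusTorsor.trivialHom (overlapZero R) 1
  resInfty := TorusTorsor.trivialHom (overlapInfty R) (transition R γ)

/-- A family of torsors over `Spec R` has degree `γ` if its fibre over every field-valued point
`Spec K → Spec R` is isomorphic to `𝒪(γ)`, i.e. if the associated line bundles have degree
`⟨χ, γ⟩` on every fibre. -/
def HasDegree {I : Type} [Fintype I] {R : Type} [CommRing R] (P : P1Torsor I R) (γ : I → ℤ) :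
    Prop :=
  ∀ (K : Type) [Field K] (φ : R →+* K), Nonempty (Hom φ P (standard K γ))

end P1Torsor

/-! ### Twisted quasimaps -/

section Quasimaps

variable {E I J : Type} [Fintype E] [Fintype I] [Fintype J]

/-- A family over `Spec R` of twisted quasimaps from `ℙ¹`, with twist `m : ℤ^E`, given by the line
bundles `M_x^e = 𝒪((m_e + 1) · ∞)` and `M_y^e = 𝒪((-m_e + 1) · ∞)`, so that
`M_x^e ⊗ M_y^e = ω⁻¹ = 𝒪(2)`.
With `L_e` the line bundle associated to the torsor and the character `incl e`, the datum consists
of sections `x_e` of `(M_x^e)⁻¹ ⊗ L_e` and `y_e` of `(M_y^e)⁻¹ ⊗ L_e⁻¹`, each given on both charts,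
which satisfy the moment map equations.  (If `incl` is the incidence matrix of a graph, with rows
the edges and columns the vertices other than the framing vertex, then `L_e` is
`F_{t(e)}⁻¹ ⊗ F_{h(e)}`, so `x_e : M_x^e ⊗ F_{t(e)} → F_{h(e)}` and
`y_e : M_y^e ⊗ F_{h(e)} → F_{t(e)}`, where `F` is trivial at the framing vertex.) -/
structure TwistedQuasimap (D : HypertoricDatum E I J) (m : E → ℤ) (R : Type) [CommRing R] where
  torsor : P1Torsor I R
  xZero : E → torsor.zero.carrier
  yZero : E → torsor.zero.carrier
  xInfty : E → torsor.infty.carrier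
  yInfty : E → torsor.infty.carrier
  xZero_mem : ∀ e, xZero e ∈ torsor.zero.gr (D.incl e)
  yZero_mem : ∀ e, yZero e ∈ torsor.zero.gr (-D.incl e)
  xInfty_mem : ∀ e, xInfty e ∈ torsor.infty.gr (D.incl e)
  yInfty_mem : ∀ e, yInfty e ∈ torsor.infty.gr (-D.incl e)
  glue_x : ∀ e, torsor.resZero.map (xZero e) =
    (LaurentPolynomial.T (-(m e + 1)) : R[T;T⁻¹]) • torsor.resInfty.map (xInfty e)
  glue_y : ∀ e, torsor.resZero.map (yZero e) =
    (LaurentPolynomial.T (-(-m e + 1)) : R[T;T⁻¹]) • torsor.resInfty.map (yInfty e)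
  moment_zero : ∀ ξ : I → ℤ, ∑ e, D.incl.mulVec ξ e • (xZero e * yZero e) = 0
  moment_infty : ∀ ξ : I → ℤ, ∑ e, D.incl.mulVec ξ e • (xInfty e * yInfty e) = 0

namespace TwistedQuasimap

variable {D : HypertoricDatum E I J} {m : E → ℤ}

/-- A morphism of families of twisted quasimaps over `φ : R → R'`, which identifies `ℱ'` with the
pullback of `ℱ` along `Spec φ`.  For `φ` the identity these are the isomorphisms of families. -/
@[ext]
structure Hom {R R' : Type} [CommRing R] [CommRing R'] (φ : R →+* R')
    (ℱ : TwistedQuasimap D m R) (ℱ' : TwistedQuasimap D m R') where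
  torsor : P1Torsor.Hom φ ℱ.torsor ℱ'.torsor
  map_xZero : ∀ e, torsor.zero.map (ℱ.xZero e) = ℱ'.xZero e
  map_yZero : ∀ e, torsor.zero.map (ℱ.yZero e) = ℱ'.yZero e
  map_xInfty : ∀ e, torsor.infty.map (ℱ.xInfty e) = ℱ'.xInfty e
  map_yInfty : ∀ e, torsor.infty.map (ℱ.yInfty e) = ℱ'.yInfty e

/-- Stability of a family: for every field-valued point `φ : R → K`, over some open dense
`U = {h ≠ 0}` of the line `Spec K[X] ⊆ ℙ¹_K` the map `U → [μ⁻¹(0) / G]` defined by the fibre has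
image in the stable locus.  This map is the equivariant map `(x, y)` on the total space of the
torsor; so the condition is that `(x, y)` is stable at every point `τ` of the total space (with
values in a field `κ`) that lies over a point `ψ` of `U`.
(On the line around `0`, the bundles `M_x^e` and `M_y^e` are trivial.) -/
def IsStable (η : I → ℤ) {R : Type} [CommRing R] [Algebra ℂ R] (ℱ : TwistedQuasimap D m R) :
    Prop :=
  ∀ (K : Type) [Field K] [Algebra ℂ K] (φ : R →ₐ[ℂ] K), ∃ h : K[X], h ≠ 0 ∧
    ∀ (κ : Type) [Field κ] [Algebra ℂ κ] (ψ : K[X] →ₐ[ℂ] κ) (τ : ℱ.torsor.zero.carrier →+* κ),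
      (∀ f : R[X], τ (algebraMap R[X] ℱ.torsor.zero.carrier f) =
        ψ (Polynomial.mapRingHom (φ : R →+* K) f)) →
      ψ h ≠ 0 →
        D.IsSemistable η (fun e => τ (ℱ.xZero e)) (fun e => τ (ℱ.yZero e))

end TwistedQuasimap

/-- The objects over `Spec R` of the moduli stack `𝔔_m(ℙ¹, X_η, γ)`: families of stable twisted
quasimaps of degree `γ`. -/
structure StableQuasimap (D : HypertoricDatum E I J) (m : E → ℤ) (η γ : I → ℤ) (R : Type)
    [CommRing R] [Algebra ℂ R] where
  quasimap : TwistedQuasimap D m R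
  hasDegree : quasimap.torsor.HasDegree γ
  isStable : quasimap.IsStable η

/-- The structure morphism `Spec R → Spec ℂ` of a `ℂ`-algebra. -/
noncomputable def specStr (R : Type) [CommRing R] [Algebra ℂ R] :
    Spec (CommRingCat.of R) ⟶ Spec (CommRingCat.of ℂ) :=
  Spec.map (CommRingCat.ofHom (algebraMap ℂ R))

/-- An equivalence between the moduli stack `𝔔_m(ℙ¹, X_η, γ)` and the scheme `Q` over `ℂ` (both
regarded as categories fibred in groupoids over affine schemes over `ℂ`): each family over
`Spec R` has a classifying morphism `Spec R → Q`; every morphism arises in this way; and there is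
a morphism of families over `φ` exactly when the classifying morphisms are compatible with
`Spec φ`, and then just one.  In particular families have no nontrivial automorphisms. -/
structure ModuliEquiv (D : HypertoricDatum E I J) (m : E → ℤ) (η γ : I → ℤ)
    (Q : Scheme.{0}) (π : Q ⟶ Spec (CommRingCat.of ℂ)) where
  classify : ∀ (R : Type) [CommRing R] [Algebra ℂ R],
    StableQuasimap D m η γ R → (Spec (CommRingCat.of R) ⟶ Q)
  classify_comp : ∀ (R : Type) [CommRing R] [Algebra ℂ R] (ℱ : StableQuasimap D m η γ R),
    classify R ℱ ≫ π = specStr R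
  exists_classify_eq : ∀ (R : Type) [CommRing R] [Algebra ℂ R]
    (f : Spec (CommRingCat.of R) ⟶ Q), f ≫ π = specStr R →
      ∃ ℱ : StableQuasimap D m η γ R, classify R ℱ = f
  classify_of_hom : ∀ (R R' : Type) [CommRing R] [Algebra ℂ R] [CommRing R'] [Algebra ℂ R']
    (φ : R →ₐ[ℂ] R') (ℱ : StableQuasimap D m η γ R) (ℱ' : StableQuasimap D m η γ R'),
    Nonempty (TwistedQuasimap.Hom (φ : R →+* R') ℱ.quasimap ℱ'.quasimap) →
      classify R' ℱ' = Spec.map (CommRingCat.ofHom (φ : R →+* R')) ≫ classify R ℱ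
  existsUnique_hom : ∀ (R R' : Type) [CommRing R] [Algebra ℂ R] [CommRing R'] [Algebra ℂ R']
    (φ : R →ₐ[ℂ] R') (ℱ : StableQuasimap D m η γ R) (ℱ' : StableQuasimap D m η γ R'),
    classify R' ℱ' = Spec.map (CommRingCat.ofHom (φ : R →+* R')) ≫ classify R ℱ →
      Nonempty (Unique (TwistedQuasimap.Hom (φ : R →+* R') ℱ.quasimap ℱ'.quasimap))

end Quasimaps

/-- `Q` is a smooth variety over `ℂ`: smooth, separated, of finite type, and integral unless it is
empty. -/
structure IsSmoothVariety {Q : Scheme.{0}} (π : Q ⟶ Spec (CommRingCat.of ℂ)) : Prop where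
  smooth : Smooth π
  separated : IsSeparated π
  quasiCompact : QuasiCompact π
  locallyOfFiniteType : LocallyOfFiniteType π
  integral : Nonempty Q → IsIntegral Q

/-! Put `k_e = ⟨a_e, γ⟩ - m_e`. On a fibre, `x_e` is a section of a line bundle of degree `k_e - 1`
and `y_e` of one of degree `-k_e - 1`, because the twisting bundles have degrees adding up to 2. So
at most one of the two can be nonzero, every product `x_e y_e` vanishes, and the moment map
equations hold automatically (`sectionCount_inl_add_inr`). A quasimap is then a vector of
coefficients, `|k_e|` of them for each `e`, of weight `a_e` or `-a_e`, taken modulo `G`. A monomial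
in the sections is nonzero at the generic point of the line exactly when some monomial of the same
weight in their coefficients is nonzero, so stability of the quasimap is `η`-stability of its
coefficient vector. The stack is thus the quotient of the stable part of a vector space by `G`,
namely `Proj` of the ring of semi-invariants.

Genericity says that the weights occurring in a semi-invariant monomial span the characters
rationally, and total unimodularity upgrades a rational basis of weights to an integral one
(`HypertoricDatum.isCharted`). Setting the coordinates of such a basis to 1 gives a slice, so the
quotient is covered by affine spaces that all contain the image of the point with all coordinates 1.
Hence it is smooth and irreducible (`ToricQuotient.isSmoothVariety`).

In families, a torsor of degree `γ` is the twist by `𝒪(γ)` of a torsor `N` on the base: this follows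
from Nakayama and the vanishing of `H¹` for degree zero (`P1Torsor.exists_frame`). The coefficients
become homogeneous elements of `N` (`Frame.exists_sections`). They are functions on the total space,
so they define a morphism from it to `Proj`, which descends along the faithfully flat projection to
the base. Two stable points with the same ratios of semi-invariants are matched by exactly one
morphism of torsors (`TorusTorsor.existsUnique_hom`), which gives full faithfulness. It also
supplies the cocycle that descends the local slices over an arbitrary morphism to `Proj` to a torsor
with a point (`ToricQuotient.exists_descended_point`). -/

namespace TorusTorsor

/-! ### Torsors as strongly graded algebras, and their morphisms. -/

section Basic

variable {I : Type} [Fintype I] {B : Type} [CommRing B] (P : TorusTorsor I B)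

noncomputable instance gradedAlgebra : GradedAlgebra P.gr where
  one_mem := by rw [P.gr_zero]; exact Submodule.one_le.mp le_rfl
  mul_mem χ ψ a b ha hb := by rw [← P.gr_mul]; exact Submodule.mul_mem_mul ha hb
  __ := P.isInternal.chooseDecomposition

variable {P}

theorem mul_mem {χ ψ : I → ℤ} {a b : P.carrier} (ha : a ∈ P.gr χ) (hb : b ∈ P.gr ψ) :
    a * b ∈ P.gr (χ + ψ) :=
  SetLike.mul_mem_graded ha hb

theorem pow_mem {χ : I → ℤ} {a : P.carrier} (ha : a ∈ P.gr χ) (n : ℕ) : a ^ n ∈ P.gr (n • χ) :=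
  SetLike.pow_mem_graded n ha

variable (P) in
theorem one_mem : (1 : P.carrier) ∈ P.gr 0 := SetLike.one_mem_graded P.gr

theorem prod_mem {P : TorusTorsor I B} {σ : Type} (s : Finset σ) {w : σ → I → ℤ} {v : σ → P.carrier}
    (hv : ∀ i ∈ s, v i ∈ P.gr (w i)) : ∏ i ∈ s, v i ∈ P.gr (∑ i ∈ s, w i) := by
  classical
  induction s using Finset.induction_on with
  | empty => simpa using P.one_mem
  | insert i s hi ih =>
    rw [Finset.prod_insert hi, Finset.sum_insert hi]
    exact mul_mem (hv i (by simp)) (ih fun j hj => hv j (by simp [hj]))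

variable (P) in
theorem algebraMap_mem (b : B) : algebraMap B P.carrier b ∈ P.gr 0 := by
  rw [P.gr_zero]; exact Submodule.mem_one.mpr ⟨b, rfl⟩

theorem algebraMap_mul_mem {χ : I → ℤ} (b : B) {a : P.carrier} (ha : a ∈ P.gr χ) :
    algebraMap B P.carrier b * a ∈ P.gr χ := by
  rw [← Algebra.smul_def]; exact (P.gr χ).smul_mem _ ha

variable (P) in
/-- The element of the base ring underlying an element of degree zero. -/
noncomputable def base : P.carrier → B := Function.invFun (algebraMap B P.carrier)

@[simp]
theorem base_algebraMap (b : B) : P.base (algebraMap B P.carrier b) = b :=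
  Function.leftInverse_invFun P.algebraMap_injective b

theorem algebraMap_base {a : P.carrier} (ha : a ∈ P.gr 0) :
    algebraMap B P.carrier (P.base a) = a := by
  rw [P.gr_zero] at ha
  obtain ⟨b, rfl⟩ := Submodule.mem_one.mp ha
  exact congrArg _ (base_algebraMap b)

theorem base_eq_iff {a : P.carrier} (ha : a ∈ P.gr 0) (b : B) :
    P.base a = b ↔ a = algebraMap B P.carrier b := by
  constructor
  · rintro rfl; exact (algebraMap_base ha).symm
  · rintro rfl; simp

theorem base_mul {a b : P.carrier} (ha : a ∈ P.gr 0) (hb : b ∈ P.gr 0) :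
    P.base (a * b) = P.base a * P.base b := by
  rw [base_eq_iff (by simpa using mul_mem ha hb), map_mul, algebraMap_base ha, algebraMap_base hb]

theorem base_add {a b : P.carrier} (ha : a ∈ P.gr 0) (hb : b ∈ P.gr 0) :
    P.base (a + b) = P.base a + P.base b := by
  rw [base_eq_iff (add_mem ha hb), map_add, algebraMap_base ha, algebraMap_base hb]

theorem base_one : P.base 1 = 1 := by
  rw [base_eq_iff P.one_mem, map_one]

theorem base_pow {a : P.carrier} (ha : a ∈ P.gr 0) (n : ℕ) : P.base (a ^ n) = P.base a ^ n := by
  rw [base_eq_iff (by simpa using pow_mem ha n), map_pow, algebraMap_base ha]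

theorem mul_mem_zero {χ : I → ℤ} {a b : P.carrier} (ha : a ∈ P.gr χ) (hb : b ∈ P.gr (-χ)) :
    a * b ∈ P.gr 0 := by simpa using mul_mem ha hb

-- This partition of unity replaces local trivializations throughout: an element `a` of degree `χ`
-- equals `∑ (a * u' k) * u k`, where the coefficients `a * u' k` have degree zero and so come from
-- the base.
variable (P) in
theorem exists_sum_eq_one (χ : I → ℤ) : ∃ (n : ℕ) (u u' : Fin n → P.carrier),
    (∀ k, u k ∈ P.gr χ) ∧ (∀ k, u' k ∈ P.gr (-χ)) ∧ ∑ k, u k * u' k = 1 := by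
  have h : (1 : P.carrier) ∈ P.gr χ * P.gr (-χ) := by
    rw [P.gr_mul, add_neg_cancel]; exact P.one_mem
  generalize (1 : P.carrier) = c at h
  induction h using Submodule.mul_induction_on' with
  | mem_mul_mem a ha b hb =>
    exact ⟨1, fun _ => a, fun _ => b, fun _ => ha, fun _ => hb, by simp⟩
  | add c hc d hd h₁ h₂ =>
    obtain ⟨n₁, u₁, u₁', hu₁, hu₁', h₁⟩ := h₁
    obtain ⟨n₂, u₂, u₂', hu₂, hu₂', h₂⟩ := h₂
    refine ⟨n₁ + n₂, Fin.append u₁ u₂, Fin.append u₁' u₂', fun k => ?_, fun k => ?_, ?_⟩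
    · refine Fin.addCases (fun i => ?_) (fun i => ?_) k <;> simp [hu₁, hu₂]
    · refine Fin.addCases (fun i => ?_) (fun i => ?_) k <;> simp [hu₁', hu₂']
    · rw [Fin.sum_univ_add]; simp [h₁, h₂]

theorem induction_on {C : P.carrier → Prop} (a : P.carrier)
    (hom : ∀ χ, ∀ a ∈ P.gr χ, C a) (add : ∀ a b, C a → C b → C (a + b)) : C a := by
  classical
  exact DirectSum.Decomposition.inductionOn P.gr (hom 0 0 (zero_mem _)) (fun m => hom _ _ m.2)
    (fun a b => add a b) a

theorem ringHom_ext {S : Type} [Semiring S] {f g : P.carrier →+* S}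
    (h : ∀ χ, ∀ a ∈ P.gr χ, f a = g a) : f = g :=
  RingHom.ext fun a => induction_on (C := fun a => f a = g a) a h
    fun a b ha hb => by rw [map_add, map_add, ha, hb]

/-- A ring homomorphism out of the total space, defined on homogeneous elements. -/
theorem exists_ringHom {S : Type} [CommRing S] (F : (I → ℤ) → P.carrier → S)
    (add : ∀ χ, ∀ a ∈ P.gr χ, ∀ b ∈ P.gr χ, F χ (a + b) = F χ a + F χ b)
    (one : F 0 1 = 1)
    (mul : ∀ χ ψ, ∀ a ∈ P.gr χ, ∀ b ∈ P.gr ψ, F (χ + ψ) (a * b) = F χ a * F ψ b) :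
    ∃ f : P.carrier →+* S, ∀ χ, ∀ a ∈ P.gr χ, f a = F χ a := by
  classical
  let T := DirectSum.toSemiring (A := fun χ => P.gr χ) (fun χ => AddMonoidHom.mk' (fun a : P.gr χ => F χ a)
    fun a b => add χ a a.2 b b.2) one fun a b => mul _ _ a a.2 b b.2
  refine ⟨T.comp (DirectSum.decomposeRingEquiv P.gr).toRingHom, fun χ a ha => ?_⟩
  have h : DirectSum.decompose P.gr a = DirectSum.of (fun χ => P.gr χ) χ ⟨a, ha⟩ :=
    DirectSum.decompose_of_mem P.gr ha
  change T (DirectSum.decompose P.gr a) = _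
  rw [h]
  exact DirectSum.toSemiring_of _ _ _ _ _

end Basic

namespace Hom

variable {I : Type} [Fintype I] {B B' B'' : Type} [CommRing B] [CommRing B'] [CommRing B'']
  {φ : B →+* B'} {P : TorusTorsor I B} {P' : TorusTorsor I B'}

theorem ext_of_gr {f g : Hom φ P P'} (h : ∀ χ, ∀ a ∈ P.gr χ, f.map a = g.map a) : f = g :=
  Hom.ext (ringHom_ext h)

variable (P) in
/-- The identity morphism. -/
def id : Hom (RingHom.id B) P P := ⟨RingHom.id _, fun _ => rfl, fun _ _ h => h⟩

/-- Composition of morphisms. -/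
def comp {ψ : B' →+* B''} {P'' : TorusTorsor I B''} {ρ : B →+* B''} (g : Hom ψ P' P'')
    (f : Hom φ P P') (hρ : ρ = ψ.comp φ) : Hom ρ P P'' where
  map := g.map.comp f.map
  map_base b := by simp [f.map_base, g.map_base, hρ]
  map_gr χ a ha := g.map_gr χ _ (f.map_gr χ a ha)

theorem base_map (f : Hom φ P P') {a : P.carrier} (ha : a ∈ P.gr 0) :
    P'.base (f.map a) = φ (P.base a) := by
  rw [base_eq_iff (f.map_gr _ _ ha), ← f.map_base, algebraMap_base ha]

/-- The pieces of the target are generated by the images of those of the source. -/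
theorem exists_sum_map_eq (f : Hom φ P P') {χ : I → ℤ} {c : P'.carrier} (hc : c ∈ P'.gr χ) :
    ∃ (n : ℕ) (u : Fin n → P.carrier) (b : Fin n → B'), (∀ k, u k ∈ P.gr χ) ∧
      c = ∑ k, algebraMap B' P'.carrier (b k) * f.map (u k) := by
  obtain ⟨n, u, u', hu, hu', h⟩ := P.exists_sum_eq_one χ
  refine ⟨n, u, fun k => P'.base (c * f.map (u' k)), hu, ?_⟩
  have h₁ := congrArg (fun z => c * f.map z) h
  simp only [map_sum, map_mul, map_one, mul_one, Finset.mul_sum] at h₁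
  refine h₁.symm.trans (Finset.sum_congr rfl fun k _ => ?_)
  rw [algebraMap_base (mul_mem_zero hc (f.map_gr _ _ (hu' k)))]
  ring

theorem exists_map_eq_of_surjective (hφ : Function.Surjective φ) (f : Hom φ P P') {χ : I → ℤ}
    {c : P'.carrier} (hc : c ∈ P'.gr χ) : ∃ a ∈ P.gr χ, f.map a = c := by
  obtain ⟨n, u, b, hu, rfl⟩ := f.exists_sum_map_eq hc
  choose b' hb' using hφ
  refine ⟨∑ k, algebraMap B P.carrier (b' (b k)) * u k,
    sum_mem fun k _ => algebraMap_mul_mem _ (hu k), ?_⟩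
  simp [f.map_base, hb']

/-- An element of degree `χ` in the kernel of a morphism is a combination of elements of degree `χ`
with coefficients in the kernel of the map of base rings. -/
theorem exists_sum_of_map_eq_zero (f : Hom φ P P') {χ : I → ℤ} {a : P.carrier} (ha : a ∈ P.gr χ)
    (h0 : f.map a = 0) : ∃ (n : ℕ) (u : Fin n → P.carrier) (b : Fin n → B),
      (∀ k, u k ∈ P.gr χ) ∧ (∀ k, φ (b k) = 0) ∧ a = ∑ k, algebraMap B P.carrier (b k) * u k := by
  obtain ⟨n, u, u', hu, hu', h⟩ := P.exists_sum_eq_one χ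
  refine ⟨n, u, fun k => P.base (a * u' k), hu, fun k => ?_, ?_⟩
  · rw [← f.base_map (mul_mem_zero ha (hu' k)), map_mul, h0, zero_mul, ← map_zero (algebraMap B' P'.carrier),
      base_algebraMap]
  · have h₁ := congrArg (fun z => a * z) h
    simp only [mul_one, Finset.mul_sum] at h₁
    refine h₁.symm.trans (Finset.sum_congr rfl fun k _ => ?_)
    rw [algebraMap_base (mul_mem_zero ha (hu' k))]
    ring

variable {ψ : B' →+* B''} {Z' : TorusTorsor I B''} {ρ : B →+* B''}

/-- The uniqueness half of the universal property of base change: the image of `j` generates `P'`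
over the new base. -/
theorem eq_of_comp_eq (j : Hom φ P P') {k k' : Hom ψ P' Z'}
    (h : ∀ χ, ∀ a ∈ P.gr χ, k.map (j.map a) = k'.map (j.map a)) : k = k' := by
  refine ext_of_gr fun χ c hc => ?_
  obtain ⟨n, u, b, hu, rfl⟩ := j.exists_sum_map_eq hc
  simp only [map_sum, map_mul, k.map_base, k'.map_base]
  exact Finset.sum_congr rfl fun i _ => by rw [h χ _ (hu i)]

/-- A morphism of torsors identifies the target with the base change of the source. -/
theorem exists_extension (j : Hom φ P P') (h : Hom ρ P Z') (hρ : ρ = ψ.comp φ) :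
    ∃ k : Hom ψ P' Z', ∀ χ, ∀ a ∈ P.gr χ, k.map (j.map a) = h.map a := by
  choose n u u' hu hu' hone using P.exists_sum_eq_one
  -- The value is forced by `c = ∑ (c * j (u' k)) * j (u k)`. `Fcomb` shows that any other
  -- expression of `c` through the image of `j` gives the same value, and multiplicativity is read
  -- off from there.
  let F : (I → ℤ) → P'.carrier → Z'.carrier := fun χ c =>
    ∑ k, algebraMap B'' Z'.carrier (ψ (P'.base (c * j.map (u' χ k)))) * h.map (u χ k)
  have Fmem (χ c) (hc : c ∈ P'.gr χ) (k) : c * j.map (u' χ k) ∈ P'.gr 0 :=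
    mul_mem_zero hc (j.map_gr _ _ (hu' χ k))
  have Fadd (χ) (a) (ha : a ∈ P'.gr χ) (b) (hb : b ∈ P'.gr χ) : F χ (a + b) = F χ a + F χ b := by
    simp only [F, ← Finset.sum_add_distrib]
    refine Finset.sum_congr rfl fun k _ => ?_
    rw [add_mul a, base_add (Fmem χ a ha k) (Fmem χ b hb k), map_add, map_add, add_mul]
  have Fgr (χ c) : F χ c ∈ Z'.gr χ :=
    sum_mem fun k _ => algebraMap_mul_mem _ (h.map_gr _ _ (hu χ k))
  have Fsmul (χ) (a) (ha : a ∈ P'.gr χ) (b) :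
      F χ (algebraMap B' P'.carrier b * a) = algebraMap B'' Z'.carrier (ψ b) * F χ a := by
    simp only [F, Finset.mul_sum]
    refine Finset.sum_congr rfl fun k _ => ?_
    rw [mul_assoc (algebraMap B' P'.carrier b) a, base_mul (P'.algebraMap_mem b) (Fmem χ a ha k),
      base_algebraMap, map_mul, map_mul, mul_assoc]
  have Fj (χ) (a) (ha : a ∈ P.gr χ) : F χ (j.map a) = h.map a := by
    have h₁ := congrArg (fun z => h.map (a * z)) (hone χ)
    simp only [mul_one, Finset.mul_sum, map_sum] at h₁
    rw [← h₁]
    refine Finset.sum_congr rfl fun k _ => ?_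
    have h₂ := mul_mem_zero ha (hu' χ k)
    rw [← map_mul, j.base_map h₂, show ψ (φ (P.base (a * u' χ k))) = ρ (P.base (a * u' χ k)) by rw [hρ]; rfl,
      ← h.map_base, algebraMap_base h₂, ← map_mul]
    congr 1; ring
  have Fsum (χ) {m : ℕ} (c : Fin m → P'.carrier) (hc : ∀ k, c k ∈ P'.gr χ) :
      F χ (∑ k, c k) = ∑ k, F χ (c k) := by
    induction m with
    | zero =>
      have := Fadd χ 0 (zero_mem _) 0 (zero_mem _)
      simpa using this
    | succ m ih =>
      rw [Fin.sum_univ_succ, Fin.sum_univ_succ, Fadd _ _ (hc 0) _ (sum_mem fun k _ => hc _),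
        ih _ fun k => hc _]
  have Fcomb (χ) {m : ℕ} (v : Fin m → P.carrier) (hv : ∀ k, v k ∈ P.gr χ) (b : Fin m → B') :
      F χ (∑ k, algebraMap B' P'.carrier (b k) * j.map (v k)) =
        ∑ k, algebraMap B'' Z'.carrier (ψ (b k)) * h.map (v k) := by
    rw [Fsum χ _ fun k => algebraMap_mul_mem _ (j.map_gr _ _ (hv k))]
    refine Finset.sum_congr rfl fun k _ => ?_
    rw [Fsmul χ _ (j.map_gr _ _ (hv k)), Fj χ _ (hv k)]
  obtain ⟨f, hf⟩ := exists_ringHom (P := P') F Fadd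
    (by rw [← map_one j.map, Fj 0 1 P.one_mem, map_one]) (by
      intro χ ξ a ha b hb
      obtain ⟨m, v, r, hv, rfl⟩ := j.exists_sum_map_eq ha
      obtain ⟨m', v', r', hv', rfl⟩ := j.exists_sum_map_eq hb
      rw [Fcomb χ v hv r, Fcomb ξ v' hv' r', Finset.sum_mul_sum, Finset.sum_mul_sum]
      rw [Fsum _ _ fun k => sum_mem fun k' _ => mul_mem
        (algebraMap_mul_mem _ (j.map_gr _ _ (hv k))) (algebraMap_mul_mem _ (j.map_gr _ _ (hv' k')))]
      refine Finset.sum_congr rfl fun k _ => ?_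
      rw [Fsum _ _ fun k' => mul_mem
        (algebraMap_mul_mem _ (j.map_gr _ _ (hv k))) (algebraMap_mul_mem _ (j.map_gr _ _ (hv' k')))]
      refine Finset.sum_congr rfl fun k' _ => ?_
      have h₁ : algebraMap B' P'.carrier (r k) * j.map (v k) *
          (algebraMap B' P'.carrier (r' k') * j.map (v' k')) =
          algebraMap B' P'.carrier (r k * r' k') * j.map (v k * v' k') := by
        rw [map_mul, map_mul]; ring
      rw [h₁, Fsmul _ _ (j.map_gr _ _ (mul_mem (hv k) (hv' k'))), Fj _ _ (mul_mem (hv k) (hv' k'))]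
      simp only [map_mul]; ring)
  refine ⟨⟨f, fun b => ?_, fun χ a ha => ?_⟩, fun χ a ha => ?_⟩
  · rw [hf 0 _ (P'.algebraMap_mem b), ← mul_one (algebraMap B' P'.carrier b),
      Fsmul 0 1 P'.one_mem, ← map_one j.map, Fj 0 1 P.one_mem, map_one, mul_one]
  · rw [hf χ a ha]; exact Fgr χ a
  · exact (hf χ _ (j.map_gr _ _ ha)).trans (Fj χ a ha)

end Hom

end TorusTorsor

/-! ### Base change of torsors, and torsors assembled from their pieces. -/

namespace TorusTorsor

section BaseChange

open TensorProduct

variable {I : Type} [Fintype I] {R : Type} [CommRing R] (P : TorusTorsor I R)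

/-- Projection to degree zero splits the structure map. A split injection survives base change, and
it makes the total space faithfully flat. -/
theorem exists_retraction : ∃ π : P.carrier →ₗ[R] R, ∀ r, π (algebraMap R P.carrier r) = r := by
  classical
  have h (a : P.carrier) : GradedAlgebra.proj P.gr 0 a ∈ P.gr 0 := by
    rw [GradedAlgebra.proj_apply]; exact SetLike.coe_mem _
  refine ⟨{ toFun := fun a => P.base (GradedAlgebra.proj P.gr 0 a)
            map_add' := fun a b => by rw [map_add, base_add (h a) (h b)]
            map_smul' := fun r a => by
              rw [map_smul, Algebra.smul_def, base_mul (P.algebraMap_mem r) (h a),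
                base_algebraMap]; rfl }, fun r => ?_⟩
  change P.base (GradedAlgebra.proj P.gr 0 _) = r
  rw [GradedAlgebra.proj_apply, DirectSum.decompose_of_mem_same P.gr (P.algebraMap_mem r),
    base_algebraMap]

/-- The base change of a torsor. -/
noncomputable def baseChange (B : Type) [CommRing B] [Algebra R B] : TorusTorsor I B where
  carrier := B ⊗[R] P.carrier
  gr χ := (P.gr χ).baseChange B
  isInternal := DirectSum.IsInternal.baseChange _ P.isInternal
  algebraMap_injective := by
    obtain ⟨π, hπ⟩ := P.exists_retraction
    refine Function.HasLeftInverse.injective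
      ⟨fun z => TensorProduct.rid R B (LinearMap.lTensor B π z), fun b => ?_⟩
    change TensorProduct.rid R B (LinearMap.lTensor B π (b ⊗ₜ[R] 1)) = b
    rw [LinearMap.lTensor_tmul, ← map_one (algebraMap R P.carrier), hπ]
    simp
  gr_zero := by
    rw [P.gr_zero]
    apply le_antisymm
    · rw [Submodule.baseChange_eq_span, Submodule.span_le]
      rintro _ ⟨a, ha, rfl⟩
      obtain ⟨r, rfl⟩ := Submodule.mem_one.mp ha
      refine Submodule.mem_one.mpr ⟨algebraMap R B r, ?_⟩
      change algebraMap R B r ⊗ₜ[R] 1 = 1 ⊗ₜ[R] algebraMap R P.carrier r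
      rw [Algebra.algebraMap_eq_smul_one, Algebra.algebraMap_eq_smul_one, TensorProduct.smul_tmul]
    · exact Submodule.one_le.mpr (Submodule.tmul_mem_baseChange_of_mem _ (Submodule.one_le.mp le_rfl))
  gr_mul χ ψ := by
    apply le_antisymm
    · rw [Submodule.baseChange_eq_span, Submodule.baseChange_eq_span, Submodule.span_mul_span,
        Submodule.span_le]
      rintro _ ⟨_, ⟨a, ha, rfl⟩, _, ⟨b, hb, rfl⟩, rfl⟩
      have : (1 : B) ⊗ₜ[R] (a * b) = (1 : B) ⊗ₜ[R] a * (1 : B) ⊗ₜ[R] b := by simp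
      change (1 : B) ⊗ₜ[R] a * (1 : B) ⊗ₜ[R] b ∈ _
      rw [← this]
      exact Submodule.tmul_mem_baseChange_of_mem _ (mul_mem ha hb)
    · rw [Submodule.baseChange_eq_span B (P.gr (χ + ψ)), Submodule.span_le]
      rintro _ ⟨a, ha₀, rfl⟩
      have ha : a ∈ P.gr χ * P.gr ψ := by rw [P.gr_mul]; exact ha₀
      clear ha₀
      change (1 : B) ⊗ₜ[R] a ∈ _
      induction ha using Submodule.mul_induction_on' with
      | mem_mul_mem a ha b hb =>
        have : (1 : B) ⊗ₜ[R] (a * b) = (1 : B) ⊗ₜ[R] a * (1 : B) ⊗ₜ[R] b := by simp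
        rw [this]
        exact Submodule.mul_mem_mul (Submodule.tmul_mem_baseChange_of_mem _ ha)
          (Submodule.tmul_mem_baseChange_of_mem _ hb)
      | add a _ b _ ha hb => rw [TensorProduct.tmul_add]; exact add_mem ha hb

/-- The canonical morphism to the base change. -/
noncomputable def toBaseChange (B : Type) [CommRing B] [Algebra R B] :
    Hom (algebraMap R B) P (P.baseChange B) where
  map := (Algebra.TensorProduct.includeRight : P.carrier →ₐ[R] B ⊗[R] P.carrier).toRingHom
  map_base r := by
    change (1 : B) ⊗ₜ[R] (algebraMap R P.carrier r) = (algebraMap R B r) ⊗ₜ[R] 1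
    rw [Algebra.algebraMap_eq_smul_one, Algebra.algebraMap_eq_smul_one, TensorProduct.tmul_smul,
      TensorProduct.smul_tmul']
  map_gr _ _ ha := Submodule.tmul_mem_baseChange_of_mem _ ha

end BaseChange

section OfPieces

variable {I : Type} [Fintype I] {R : Type} [CommRing R] {C : Type} [CommRing C] [Algebra R C]

/-- A torsor given by its pieces, which are submodules of a ring `C`, not necessarily
independent. -/
theorem exists_ofPieces (M : (I → ℤ) → Submodule R C) (one : 1 ∈ M 0)
    (mul : ∀ χ ψ, ∀ a ∈ M χ, ∀ b ∈ M ψ, a * b ∈ M (χ + ψ)) (zero : M 0 ≤ 1)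
    (inj : Function.Injective (algebraMap R C)) (unit : ∀ χ, 1 ∈ M χ * M (-χ)) :
    ∃ (P : TorusTorsor I R) (f : P.carrier →+* C),
      (∀ r, f (algebraMap R P.carrier r) = algebraMap R C r) ∧
      (∀ χ, ∀ a ∈ P.gr χ, f a ∈ M χ) ∧ (∀ χ, ∀ c ∈ M χ, ∃ a ∈ P.gr χ, f a = c) ∧
      ∀ χ, ∀ a ∈ P.gr χ, f a = 0 → a = 0 := by
  classical
  have : SetLike.GradedMonoid M :=
    { one_mem := one, mul_mem := fun _ _ _ _ ha hb => mul _ _ _ ha _ hb }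
  let f : (DirectSum (I → ℤ) fun χ => M χ) →ₐ[R] C := DirectSum.coeAlgHom M
  let ι (χ : I → ℤ) : M χ →ₗ[R] (DirectSum (I → ℤ) fun χ => M χ) :=
    DirectSum.lof R (I → ℤ) (fun χ => M χ) χ
  have hfι (χ) (a : M χ) : f (ι χ a) = a := DirectSum.coeAlgHom_of M χ a
  have ιmul (χ ψ) (a : M χ) (b : M ψ) : ι χ a * ι ψ b = ι (χ + ψ) ⟨a * b, mul _ _ _ a.2 _ b.2⟩ :=
    DirectSum.of_mul_of _ _
  have mulle (χ ψ) : LinearMap.range (ι χ) * LinearMap.range (ι ψ) ≤ LinearMap.range (ι (χ + ψ)) := by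
    rw [Submodule.mul_le]
    rintro _ ⟨a, rfl⟩ _ ⟨b, rfl⟩
    rw [ιmul]; exact ⟨_, rfl⟩
  have hzero : LinearMap.range (ι 0) = 1 := by
    apply le_antisymm
    · rintro _ ⟨⟨a, ha⟩, rfl⟩
      obtain ⟨r, rfl⟩ := Submodule.mem_one.mp (zero ha)
      exact Submodule.mem_one.mpr ⟨r, rfl⟩
    · exact Submodule.one_le.mpr ⟨⟨1, one⟩, rfl⟩
  have hunit (χ) : 1 ∈ LinearMap.range (ι χ) * LinearMap.range (ι (-χ)) := by
    -- The pieces may overlap inside `C`, so `1` is first lifted to the direct sum. The lift lies in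
    -- degree zero, where the map to `C` is injective, hence it is `1`.
    have key : ∀ c ∈ M χ * M (-χ), ∃ z ∈ LinearMap.range (ι χ) * LinearMap.range (ι (-χ)),
        f z = c := by
      intro c hc
      induction hc using Submodule.mul_induction_on' with
      | mem_mul_mem a ha b hb =>
        exact ⟨_, Submodule.mul_mem_mul ⟨⟨a, ha⟩, rfl⟩ ⟨⟨b, hb⟩, rfl⟩, by
          rw [map_mul, hfι, hfι]⟩
      | add c _ d _ h₁ h₂ =>
        obtain ⟨z₁, hz₁, rfl⟩ := h₁
        obtain ⟨z₂, hz₂, rfl⟩ := h₂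
        exact ⟨_, add_mem hz₁ hz₂, map_add _ _ _⟩
    obtain ⟨z, hz, hz1⟩ := key 1 (unit χ)
    have h0 : z ∈ LinearMap.range (ι 0) := by
      have := mulle _ _ hz; rwa [add_neg_cancel] at this
    obtain ⟨a, rfl⟩ := h0
    rw [hfι] at hz1
    have : a = ⟨1, one⟩ := Subtype.ext hz1
    rw [this] at hz
    exact hz
  have hmem : ∀ χ, ∀ a ∈ LinearMap.range (ι χ), f a ∈ M χ := by
    rintro χ _ ⟨a, rfl⟩
    rw [hfι]; exact a.2
  have hsurj : ∀ χ, ∀ c ∈ M χ, ∃ a ∈ LinearMap.range (ι χ), f a = c :=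
    fun χ c hc => ⟨ι χ ⟨c, hc⟩, ⟨_, rfl⟩, hfι χ ⟨c, hc⟩⟩
  have hinj : ∀ χ, ∀ a ∈ LinearMap.range (ι χ), f a = 0 → a = 0 := by
    rintro χ _ ⟨a, rfl⟩ h0
    rw [hfι] at h0
    have : a = 0 := Subtype.ext h0
    rw [this, map_zero]
  refine ⟨{ carrier := DirectSum (I → ℤ) fun χ => M χ
            gr := fun χ => LinearMap.range (ι χ)
            isInternal := ?_
            algebraMap_injective := ?_
            gr_zero := hzero
            gr_mul := ?_ }, f.toRingHom, fun r => f.commutes r, hmem, hsurj, hinj⟩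
  · constructor
    · intro x y hxy
      let p (χ : I → ℤ) : (DirectSum (I → ℤ) fun χ => LinearMap.range (ι χ)) →+ M χ :=
        (DirectSum.component R (I → ℤ) (fun χ => M χ) χ).toAddMonoidHom.comp
          (DirectSum.coeAddMonoidHom _)
      have hp (y) (χ) : ((y χ : LinearMap.range (ι χ)) : DirectSum (I → ℤ) fun χ => M χ) =
          ι χ (p χ y) := by
        induction y using DirectSum.induction_on with
        | zero => simp
        | of ψ z =>
          obtain ⟨_, a, rfl⟩ := z
          simp only [p, AddMonoidHom.comp_apply, DirectSum.coeAddMonoidHom_of]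
          by_cases h : ψ = χ
          · subst h
            rw [DirectSum.of_eq_same]
            change _ = ι ψ (DirectSum.component R (I → ℤ) (fun χ => M χ) ψ (DirectSum.lof R (I → ℤ) (fun χ => M χ) ψ a))
            rw [DirectSum.component.lof_self]
          · rw [DirectSum.of_eq_of_ne _ _ _ (Ne.symm h)]
            change _ = ι χ ((DirectSum.of (fun χ => M χ) ψ a) χ)
            rw [DirectSum.of_eq_of_ne _ _ _ (Ne.symm h)]
            simp
        | add y z hy hz =>
          rw [DirectSum.add_apply, Submodule.coe_add, hy, hz, map_add, map_add]
      refine DFinsupp.ext fun χ => Subtype.ext ?_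
      rw [hp, hp]
      simp only [p, AddMonoidHom.comp_apply, hxy]
    · intro x
      induction x using DirectSum.induction_on with
      | zero => exact ⟨0, map_zero _⟩
      | of χ a =>
        exact ⟨DirectSum.of (fun χ => LinearMap.range (ι χ)) χ ⟨ι χ a, a, rfl⟩,
          DirectSum.coeAddMonoidHom_of _ _ _⟩
      | add x y hx hy =>
        obtain ⟨x, rfl⟩ := hx
        obtain ⟨y, rfl⟩ := hy
        exact ⟨x + y, map_add _ _ _⟩
  · intro r s h
    apply inj
    rw [← f.commutes r, ← f.commutes s, h]
  · intro χ ψ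
    refine le_antisymm (mulle χ ψ) ?_
    -- Inserting `1` as a product of the pieces of degrees `-ψ` and `ψ` turns invertibility into the
    -- missing inclusion.
    calc LinearMap.range (ι (χ + ψ)) = LinearMap.range (ι (χ + ψ)) * 1 := (mul_one _).symm
      _ ≤ LinearMap.range (ι (χ + ψ)) * (LinearMap.range (ι (-ψ)) * LinearMap.range (ι (- -ψ))) :=
        mul_le_mul' le_rfl (Submodule.one_le.mpr (hunit (-ψ)))
      _ = LinearMap.range (ι (χ + ψ)) * LinearMap.range (ι (-ψ)) * LinearMap.range (ι ψ) := by
        rw [neg_neg, mul_assoc]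
      _ ≤ LinearMap.range (ι χ) * LinearMap.range (ι ψ) := by
        refine mul_le_mul' ?_ le_rfl
        have := mulle (χ + ψ) (-ψ)
        rwa [add_neg_cancel_right] at this

end OfPieces

end TorusTorsor

/-! ### Monomials and their weights. -/

section Monomials

variable {I σ : Type} [Fintype σ]

/-- The weight of a monomial. -/
def wt (w : σ → I → ℤ) (u : σ → ℕ) : I → ℤ := ∑ i, u i • w i

/-- The monomial with exponent `u` in the elements `v`. -/
def monom {A : Type} [CommMonoid A] (v : σ → A) (u : σ → ℕ) : A := ∏ i, v i ^ u i

@[simp]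
theorem wt_add (w : σ → I → ℤ) (u u' : σ → ℕ) : wt w (u + u') = wt w u + wt w u' := by
  simp [wt, add_smul, Finset.sum_add_distrib]

@[simp]
theorem wt_nsmul (w : σ → I → ℤ) (n : ℕ) (u : σ → ℕ) : wt w (n • u) = n • wt w u := by
  simp [wt, mul_smul, Finset.smul_sum]

@[simp]
theorem wt_zero (w : σ → I → ℤ) : wt w 0 = 0 := by simp [wt]

theorem wt_single [DecidableEq σ] (w : σ → I → ℤ) (i : σ) : wt w (Pi.single i 1) = w i := by
  rw [wt, Finset.sum_eq_single i]
  · simp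
  · intro j _ h; simp [h]
  · simp

theorem wt_sub (w : σ → I → ℤ) {u u' : σ → ℕ} (h : u' ≤ u) : wt w (u - u') = wt w u - wt w u' := by
  rw [eq_sub_iff_add_eq, ← wt_add, tsub_add_cancel_of_le h]

variable {A : Type} [CommMonoid A]

theorem monom_add (v : σ → A) (u u' : σ → ℕ) : monom v (u + u') = monom v u * monom v u' := by
  simp [monom, pow_add, Finset.prod_mul_distrib]

theorem monom_nsmul (v : σ → A) (n : ℕ) (u : σ → ℕ) : monom v (n • u) = monom v u ^ n := by
  simp [monom, ← Finset.prod_pow, pow_mul']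

@[simp]
theorem monom_zero (v : σ → A) : monom v 0 = 1 := by simp [monom]

theorem monom_single [DecidableEq σ] (v : σ → A) (i : σ) : monom v (Pi.single i 1) = v i := by
  rw [monom, Finset.prod_eq_single i]
  · simp
  · intro j _ h; simp [h]
  · simp

theorem map_monom {A' F : Type} [CommMonoid A'] [FunLike F A A'] [MonoidHomClass F A A'] (f : F)
    (v : σ → A) (u : σ → ℕ) : f (monom v u) = monom (fun i => f (v i)) u := by
  simp [monom, map_prod]

theorem exists_le_nsmul {s u : σ → ℕ} (h : ∀ i, s i = 0 → u i = 0) : ∃ n : ℕ, u ≤ n • s := by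
  refine ⟨∑ i, u i, fun i => ?_⟩
  by_cases hi : s i = 0
  · simp [h i hi]
  · calc u i ≤ ∑ i, u i := Finset.single_le_sum (fun _ _ => Nat.zero_le _) (Finset.mem_univ i)
      _ ≤ (∑ i, u i) * s i := Nat.le_mul_of_pos_right _ (Nat.pos_of_ne_zero hi)

end Monomials

/-! ### Stable points of torsors and the morphisms that match them. -/

namespace TorusTorsor

variable {I σ : Type} [Fintype I] [Fintype σ] {w : σ → I → ℤ} {η : I → ℤ}

theorem monom_mem {R : Type} [CommRing R] {N : TorusTorsor I R} {v : σ → N.carrier}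
    (hv : ∀ i, v i ∈ N.gr (w i)) (u : σ → ℕ) : monom v u ∈ N.gr (wt w u) :=
  prod_mem _ fun i _ => pow_mem (hv i) (u i)

/-- The ideal of the unstable locus of a family of points of weights `w`. -/
def stableIdeal (w : σ → I → ℤ) (η : I → ℤ) {R : Type} [CommRing R] (N : TorusTorsor I R)
    (v : σ → N.carrier) : Ideal R :=
  Ideal.span {r | ∃ u, wt w u = η ∧ ∃ x ∈ N.gr (-η), r = N.base (monom v u * x)}

/-- Monomials of weight `η` have supports whose weights span the character lattice. -/
def SpansLattice (w : σ → I → ℤ) (η : I → ℤ) : Prop :=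
  ∀ s, wt w s = η → ∀ χ, ∃ u u' : σ → ℕ, (∀ i, s i = 0 → u i = 0) ∧ (∀ i, s i = 0 → u' i = 0) ∧
    wt w u' = wt w u + χ

/-- A monomial supported in `s` divides a power of `v^s`. Hence wherever `v^s` does not vanish,
neither does any monomial in its variables. -/
theorem exists_monom_mul_eq_pow {R : Type} [CommRing R] {N : TorusTorsor I R} {v : σ → N.carrier}
    (hv : ∀ i, v i ∈ N.gr (w i)) {s e : σ → ℕ} (hs : wt w s = η) (he : ∀ i, s i = 0 → e i = 0)
    {x : N.carrier} (hx : x ∈ N.gr (-η)) :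
    ∃ n : ℕ, ∃ y ∈ N.gr (-wt w e), monom v e * y = (monom v s * x) ^ n := by
  obtain ⟨n, hn⟩ := exists_le_nsmul he
  refine ⟨n, monom v (n • s - e) * x ^ n, ?_, ?_⟩
  · have := mul_mem (monom_mem hv (n • s - e)) (pow_mem hx n)
    rw [wt_sub _ hn, wt_nsmul, hs, smul_neg] at this
    convert this using 2
    abel
  · rw [← mul_assoc, ← monom_add, add_tsub_cancel_of_le hn, monom_nsmul, mul_pow]

section Lift

variable {R R' : Type} [CommRing R] [CommRing R'] {φ : R →+* R'} {N : TorusTorsor I R}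
  {N' : TorusTorsor I R'} {v : σ → N.carrier} {v' : σ → N'.carrier}

/-- Local existence of points away from the unstable locus. -/
theorem exists_notMem_prime (hv : ∀ i, v i ∈ N.gr (w i)) (hv' : ∀ i, v' i ∈ N'.gr (w i))
    (hN : (stableIdeal w η N v).map φ = ⊤) (hN' : stableIdeal w η N' v' = ⊤)
    (cross : ∀ (n : ℕ) (u u' : σ → ℕ), wt w u = n • η → wt w u' = n • η → ∀ x ∈ N.gr (-(n • η)),
      algebraMap R' N'.carrier (φ (N.base (monom v u * x))) * monom v' u' =
        algebraMap R' N'.carrier (φ (N.base (monom v u' * x))) * monom v' u)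
    (p : Ideal R') [p.IsPrime] :
    ∃ s, wt w s = η ∧ ∀ e : σ → ℕ, (∀ i, s i = 0 → e i = 0) →
      (∃ x ∈ N.gr (-wt w e), φ (N.base (monom v e * x)) ∉ p) ∧
      ∃ y ∈ N'.gr (-wt w e), N'.base (monom v' e * y) ∉ p := by
  have h₁ : ∃ s, wt w s = η ∧ ∃ x ∈ N.gr (-η), φ (N.base (monom v s * x)) ∉ p := by
    by_contra! h
    refine Ideal.IsPrime.ne_top ‹p.IsPrime› (top_le_iff.mp (hN ▸ ?_))
    rw [stableIdeal, Ideal.map_span, Ideal.span_le]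
    rintro _ ⟨_, ⟨s, hs, x, hx, rfl⟩, rfl⟩
    exact h s hs x hx
  have h₂ : ∃ s, wt w s = η ∧ ∃ y ∈ N'.gr (-η), N'.base (monom v' s * y) ∉ p := by
    by_contra! h
    refine Ideal.IsPrime.ne_top ‹p.IsPrime› (top_le_iff.mp (hN' ▸ ?_))
    rw [stableIdeal, Ideal.span_le]
    rintro _ ⟨s, hs, x, hx, rfl⟩
    exact h s hs x hx
  obtain ⟨s, hs, x, hx, hsx⟩ := h₁
  obtain ⟨t, ht, y, hy, hty⟩ := h₂
  -- `s` is nonzero at `p` for `v` and `t` for `v'`. The cross relation shows that `s` is nonzero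
  -- for both.
  have key : φ (N.base (monom v s * x)) * N'.base (monom v' t * y) =
      φ (N.base (monom v t * x)) * N'.base (monom v' s * y) := by
    apply N'.algebraMap_injective
    have ht' : monom v' t * y ∈ N'.gr 0 := mul_mem_zero (ht ▸ monom_mem hv' t) hy
    have hs' : monom v' s * y ∈ N'.gr 0 := mul_mem_zero (hs ▸ monom_mem hv' s) hy
    rw [map_mul, map_mul, algebraMap_base ht', algebraMap_base hs', ← mul_assoc, ← mul_assoc,
      cross 1 s t (by simpa using hs) (by simpa using ht) x (by simpa using hx)]
  have hsy : N'.base (monom v' s * y) ∉ p := fun h => by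
    have h₁ := Ideal.mul_mem_left p (φ (N.base (monom v t * x))) h
    rw [← key] at h₁
    exact (Ideal.IsPrime.mem_or_mem ‹_› h₁).elim hsx hty
  refine ⟨s, hs, fun e he => ⟨?_, ?_⟩⟩
  · obtain ⟨n, z, hz, h⟩ := exists_monom_mul_eq_pow hv hs he hx
    refine ⟨z, hz, fun h' => hsx ?_⟩
    rw [h, base_pow (mul_mem_zero (hs ▸ monom_mem hv s) hx), map_pow] at h'
    exact Ideal.IsPrime.mem_of_pow_mem ‹_› _ h'
  · obtain ⟨n, z, hz, h⟩ := exists_monom_mul_eq_pow hv' hs he hy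
    refine ⟨z, hz, fun h' => hsy ?_⟩
    rw [h, base_pow (mul_mem_zero (hs ▸ monom_mem hv' s) hy)] at h'
    exact Ideal.IsPrime.mem_of_pow_mem ‹_› _ h'

/-- Otherwise the annihilator of `z` would lie in a maximal ideal. -/
theorem eq_zero_of_prime {z : N'.carrier}
    (h : ∀ p : Ideal R', p.IsPrime → ∃ r, r ∉ p ∧ algebraMap R' N'.carrier r * z = 0) : z = 0 := by
  by_contra hz
  have : LinearMap.ker (LinearMap.toSpanSingleton R' N'.carrier z) ≠ ⊤ := fun h => hz <| by
    have h₁ : (1 : R') ∈ LinearMap.ker (LinearMap.toSpanSingleton R' N'.carrier z) := by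
      rw [h]; trivial
    simpa using h₁
  obtain ⟨p, hp, hJ⟩ := Ideal.exists_le_maximal _ this
  obtain ⟨r, hr, h0⟩ := h p hp.isPrime
  refine hr (hJ ?_)
  rw [LinearMap.mem_ker, LinearMap.toSpanSingleton_apply, Algebra.smul_def, h0]

/-- A morphism of torsors which matches stable points with the same invariants. -/
theorem existsUnique_hom (hw : SpansLattice w η) (hv : ∀ i, v i ∈ N.gr (w i))
    (hv' : ∀ i, v' i ∈ N'.gr (w i))
    (hN : (stableIdeal w η N v).map φ = ⊤) (hN' : stableIdeal w η N' v' = ⊤)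
    (cross : ∀ (n : ℕ) (u u' : σ → ℕ), wt w u = n • η → wt w u' = n • η → ∀ x ∈ N.gr (-(n • η)),
      algebraMap R' N'.carrier (φ (N.base (monom v u * x))) * monom v' u' =
        algebraMap R' N'.carrier (φ (N.base (monom v u' * x))) * monom v' u) :
    ∃! h : Hom φ N N', ∀ i, h.map (v i) = v' i := by
  classical
  have loc := fun (p : Ideal R') (hp : p.IsPrime) => exists_notMem_prime hv hv' hN hN' cross p
  set ι := algebraMap R' N'.carrier with hι
  have vm := monom_mem hv
  have vm' := monom_mem hv'
  -- The cross relation extends from multiples of `η` to an arbitrary weight `ω`: near a prime,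
  -- multiply by a nonvanishing monomial `e` that brings the weight to a multiple of `η`.
  have crossAll (ω) (u u' : σ → ℕ) (hu : wt w u = ω) (hu' : wt w u' = ω) (x) (hx : x ∈ N.gr (-ω)) :
      ι (φ (N.base (monom v u * x))) * monom v' u' =
        ι (φ (N.base (monom v u' * x))) * monom v' u := by
    rw [← sub_eq_zero]
    refine eq_zero_of_prime fun p hp => ?_
    obtain ⟨s, hs, hloc⟩ := loc p hp
    -- The difference `t' - t` has weight `-ω`, and adding `K • s` makes it an honest exponent `e`,
    -- of weight `K • η - ω`.
    obtain ⟨t, t', ht, ht', htt'⟩ := hw s hs (-ω)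
    obtain ⟨K, hK⟩ := exists_le_nsmul ht
    have hE : wt w (t' + (K • s - t)) = K • η - ω := by
      rw [wt_add, wt_sub _ hK, htt', wt_nsmul, hs]; abel
    generalize he : t' + (K • s - t) = e at hE
    obtain ⟨⟨x₁, hx₁, hx₁p⟩, y₁, hy₁, hy₁p⟩ := hloc e fun i hi => by
      rw [← he]; simp [ht' i hi, ht i hi, hi]
    refine ⟨φ (N.base (monom v e * x₁)) * N'.base (monom v' e * y₁), fun h =>
      (Ideal.IsPrime.mem_or_mem hp h).elim hx₁p hy₁p, ?_⟩
    have h₁ := cross K (u + e) (u' + e) (by rw [wt_add, hu, hE]; abel)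
      (by rw [wt_add, hu', hE]; abel) (x * x₁) (by
        have := mul_mem hx hx₁
        rw [hE] at this
        convert this using 2
        abel)
    have h₂ (t : σ → ℕ) (ht : wt w t = ω) : N.base (monom v (t + e) * (x * x₁)) =
        N.base (monom v t * x) * N.base (monom v e * x₁) := by
      rw [← base_mul (mul_mem_zero (ht ▸ vm t) hx) (mul_mem_zero (vm e) hx₁), monom_add]
      congr 1; ring
    rw [h₂ u hu, h₂ u' hu'] at h₁
    rw [← hι, map_mul ι, algebraMap_base (mul_mem_zero (vm' e) hy₁), mul_sub, sub_eq_zero]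
    simp only [map_mul, monom_add] at h₁ ⊢
    linear_combination y₁ * h₁
  -- triples which compare degrees differing by `χ` generate the unit ideal
  have span (χ : I → ℤ) : ∃ (n : ℕ) (c : Fin n → R') (u u' : Fin n → σ → ℕ)
      (x : Fin n → N.carrier) (y : Fin n → N'.carrier), (∀ k, wt w (u' k) = wt w (u k) + χ) ∧
      (∀ k, x k ∈ N.gr (-wt w (u' k))) ∧ (∀ k, y k ∈ N'.gr (-wt w (u k))) ∧
      ∑ k, c k * (φ (N.base (monom v (u' k) * x k)) * N'.base (monom v' (u k) * y k)) = 1 := by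
    have h : Ideal.span {r | ∃ (u u' : σ → ℕ) (x : N.carrier) (y : N'.carrier),
        wt w u' = wt w u + χ ∧ x ∈ N.gr (-wt w u') ∧ y ∈ N'.gr (-wt w u) ∧
        φ (N.base (monom v u' * x)) * N'.base (monom v' u * y) = r} = ⊤ := by
      by_contra h
      obtain ⟨p, hp, hle⟩ := Ideal.exists_le_maximal _ h
      have hp' := hp.isPrime
      obtain ⟨s, hs, hloc⟩ := loc p hp'
      obtain ⟨u, u', hu, hu', huu'⟩ := hw s hs χ
      obtain ⟨x, hx, hxp⟩ := (hloc u' hu').1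
      obtain ⟨y, hy, hyp⟩ := (hloc u hu).2
      exact (hp'.mem_or_mem (hle (Ideal.subset_span ⟨u, u', x, y, huu', hx, hy, rfl⟩))).elim hxp hyp
    have h₁ : (1 : R') ∈ Ideal.span _ := h ▸ Submodule.mem_top
    obtain ⟨n, c, g, hg⟩ := Submodule.mem_span_set'.mp h₁
    choose u u' x y h₁ h₂ h₃ h₄ using fun k => (g k).2
    exact ⟨n, c, u, u', x, y, h₁, h₂, h₃, by rw [← hg]; simp [h₄]⟩
  -- A morphism `h` with `h (v i) = v' i` satisfies `h a * h (v^u' * x) * h (v^u) = h (a * v^u * x)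
  -- * h (v^u')`, where the bracketed elements of degree zero are determined by `φ`. So `Rel` is the
  -- equation that characterizes `a' = h a`.
  let Rel (χ : I → ℤ) (a : N.carrier) (a' : N'.carrier) : Prop :=
    ∀ (u u' : σ → ℕ), wt w u' = wt w u + χ → ∀ x ∈ N.gr (-wt w u'),
      a' * (ι (φ (N.base (monom v u' * x))) * monom v' u) =
        ι (φ (N.base (a * monom v u * x))) * monom v' u'
  have mem0 (χ) (a) (ha : a ∈ N.gr χ) (u u') (h : wt w u' = wt w u + χ) (x)
      (hx : x ∈ N.gr (-wt w u')) : a * monom v u * x ∈ N.gr 0 := by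
    have := mul_mem (mul_mem ha (vm u)) hx
    rw [h] at this
    convert this using 2
    abel
  have cancel (χ) (z : N'.carrier) (h : ∀ (u u' : σ → ℕ), wt w u' = wt w u + χ →
      ∀ x ∈ N.gr (-wt w u'), z * (ι (φ (N.base (monom v u' * x))) * monom v' u) = 0) : z = 0 := by
    obtain ⟨n, c, u, u', x, y, h₁, h₂, h₃, h₄⟩ := span χ
    have h₅ := congrArg (fun r => z * ι r) h₄
    simp only [map_one, mul_one, map_sum, Finset.mul_sum] at h₅
    rw [← h₅]
    refine Finset.sum_eq_zero fun k _ => ?_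
    rw [map_mul, map_mul, algebraMap_base (mul_mem_zero (vm' _) (h₃ k))]
    linear_combination ι (c k) * y k * h _ _ (h₁ k) _ (h₂ k)
  have exist (χ) (a) (ha : a ∈ N.gr χ) : ∃ a' ∈ N'.gr χ, Rel χ a a' := by
    obtain ⟨n, c, u, u', x, y, h₁, h₂, h₃, h₄⟩ := span χ
    -- Each triple from `span χ` solves `Rel` up to its own denominator. The local solutions are
    -- added with the weights of the partition of unity.
    refine ⟨∑ k, ι (c k * φ (N.base (a * monom v (u k) * x k))) * (monom v' (u' k) * y k),
      sum_mem fun k _ => algebraMap_mul_mem _ ?_, ?_⟩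
    · have := mul_mem (vm' (u' k)) (h₃ k)
      rw [h₁ k] at this
      convert this using 2
      abel
    · intro t t' htt' z hz
      have h₅ := congrArg (fun r => ι (φ (N.base (a * monom v t * z))) * monom v' t' * ι r) h₄
      simp only [map_one, mul_one, map_sum, Finset.mul_sum] at h₅
      rw [← h₅, Finset.sum_mul]
      refine Finset.sum_congr rfl fun k _ => ?_
      have h₆ := crossAll _ (t' + u k) (u' k + t) rfl (by rw [wt_add, wt_add, h₁ k, htt']; abel)
        (a * x k * z) (by
          have := mul_mem (mul_mem ha (h₂ k)) hz
          rw [h₁ k] at this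
          rw [wt_add]
          convert this using 2
          abel)
      have h₇ : N.base (monom v (t' + u k) * (a * x k * z)) =
          N.base (a * monom v (u k) * x k) * N.base (monom v t' * z) := by
        rw [← base_mul (mem0 χ a ha _ _ (h₁ k) _ (h₂ k)) (mul_mem_zero (vm t') hz), monom_add]
        congr 1; ring
      have h₈ : N.base (monom v (u' k + t) * (a * x k * z)) =
          N.base (a * monom v t * z) * N.base (monom v (u' k) * x k) := by
        rw [← base_mul (mem0 χ a ha _ _ htt' _ hz) (mul_mem_zero (vm _) (h₂ k)), monom_add]
        congr 1; ring
      rw [h₇, h₈] at h₆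
      simp only [map_mul, monom_add, algebraMap_base (mul_mem_zero (vm' (u k)) (h₃ k)), hι] at h₆ ⊢
      linear_combination (algebraMap R' N'.carrier (c k)) * y k * h₆
  choose! F hF hRel using exist
  have uniq (χ a a' b') (h : Rel χ a a') (h' : Rel χ a b') : a' = b' := by
    rw [← sub_eq_zero]
    refine cancel χ _ fun u u' huu' x hx => ?_
    rw [sub_mul, h u u' huu' x hx, h' u u' huu' x hx, sub_self]
  have relOfHom (h : Hom φ N N') (hh : ∀ i, h.map (v i) = v' i) (χ a) (ha : a ∈ N.gr χ) :
      Rel χ a (h.map a) := by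
    intro u u' huu' x hx
    have hm (u : σ → ℕ) : monom v' u = h.map (monom v u) := by rw [map_monom]; simp [hh]
    rw [hι, ← h.base_map (mul_mem_zero (vm u') hx), ← h.base_map (mem0 χ a ha u u' huu' x hx),
      algebraMap_base (h.map_gr _ _ (mul_mem_zero (vm u') hx)),
      algebraMap_base (h.map_gr _ _ (mem0 χ a ha u u' huu' x hx)), hm, hm]
    simp only [map_mul]; ring
  obtain ⟨f, hf⟩ := exists_ringHom (P := N) F
    (by
      intro χ a ha b hb
      refine uniq χ (a + b) _ _ (hRel _ _ (add_mem ha hb)) fun u u' huu' x hx => ?_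
      rw [add_mul, hRel χ a ha u u' huu' x hx, hRel χ b hb u u' huu' x hx, add_mul a, add_mul _ _ x,
        base_add (mem0 χ a ha u u' huu' x hx) (mem0 χ b hb u u' huu' x hx), map_add, map_add,
        add_mul])
    (by
      refine uniq 0 1 _ _ (hRel _ _ N.one_mem) fun u u' huu' x hx => ?_
      rw [one_mul, one_mul]
      rw [crossAll (wt w u') u' u rfl (by rw [huu', add_zero]) x hx])
    (by
      intro χ ψ a ha b hb
      rw [← sub_eq_zero]
      refine cancel χ _ fun u u' huu' x hx => ?_
      refine cancel ψ _ fun t t' htt' z hz => ?_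
      have hxz : x * z ∈ N.gr (-wt w (u' + t')) := by
        have := mul_mem hx hz
        rw [wt_add]; convert this using 2; abel
      have h₁ := hRel _ _ (mul_mem ha hb) (u + t) (u' + t')
        (by rw [wt_add, wt_add, huu', htt']; abel) (x * z) hxz
      have h₂ : N.base (monom v (u' + t') * (x * z)) =
          N.base (monom v u' * x) * N.base (monom v t' * z) := by
        rw [← base_mul (mul_mem_zero (vm u') hx) (mul_mem_zero (vm t') hz), monom_add]
        congr 1; ring
      have h₃ : N.base (a * b * monom v (u + t) * (x * z)) =
          N.base (a * monom v u * x) * N.base (b * monom v t * z) := by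
        rw [← base_mul (mem0 χ a ha u u' huu' x hx) (mem0 ψ b hb t t' htt' z hz), monom_add]
        congr 1; ring
      rw [h₂, h₃] at h₁
      have h₄ := hRel χ a ha u u' huu' x hx
      have h₅ := hRel ψ b hb t t' htt' z hz
      simp only [map_mul, monom_add] at h₁ h₄ h₅ ⊢
      linear_combination h₁ - (F ψ b * (ι (φ (N.base (monom v t'  * z))) * monom v' t)) * h₄
        - ι (φ (N.base (a * monom v u * x))) * monom v' u' * h₅)
  refine ⟨⟨f, fun r => ?_, fun χ a ha => ?_⟩, fun i => ?_, fun h hh => Hom.ext_of_gr ?_⟩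
  · rw [hf 0 _ (N.algebraMap_mem r)]
    refine uniq 0 _ _ _ (hRel _ _ (N.algebraMap_mem r)) fun u u' huu' x hx => ?_
    have hux : monom v u * x ∈ N.gr 0 := by
      have := mem0 0 1 N.one_mem u u' huu' x hx
      rwa [one_mul] at this
    rw [mul_assoc _ (monom v u), base_mul (N.algebraMap_mem r) hux, base_algebraMap, map_mul,
      map_mul, mul_assoc, crossAll (wt w u') u' u rfl (by rw [huu', add_zero]) x hx]
  · rw [hf χ a ha]; exact hF χ a ha
  · change f (v i) = v' i
    rw [hf _ _ (hv i)]
    refine uniq _ _ _ _ (hRel _ _ (hv i)) fun u u' huu' x hx => ?_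
    have := crossAll (wt w u') u' (Pi.single i 1 + u) rfl
      (by rw [wt_add, wt_single, huu', add_comm]) x hx
    rw [monom_add, monom_add, monom_single, monom_single] at this
    rw [← this]; ring
  · intro χ a ha
    exact (uniq χ a _ _ (relOfHom h hh χ a ha) (hRel χ a ha)).trans (hf χ a ha).symm

end Lift

end TorusTorsor

/-! ### The trivial torsor and trivializations over fields. -/

namespace TorusTorsor

variable {I : Type} [Fintype I]

section Trivial

variable {B : Type} [CommRing B]

/-- The homogeneous elements of the trivial torsor. -/
noncomputable def gen (χ : I → ℤ) (b : B) : (trivial I B).carrier :=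
  (AddMonoidAlgebra.single χ b : AddMonoidAlgebra B (I → ℤ))

theorem gen_mem (χ : I → ℤ) (b : B) : gen χ b ∈ (trivial I B).gr χ :=
  AddMonoidAlgebra.single_mem_grade _ _

theorem exists_eq_gen {χ : I → ℤ} {a : (trivial I B).carrier} (ha : a ∈ (trivial I B).gr χ) :
    ∃ b : B, a = gen χ b := by
  change a ∈ AddMonoidAlgebra.grade B χ at ha
  rw [AddMonoidAlgebra.grade_eq_lsingle_range] at ha
  obtain ⟨b, rfl⟩ := ha
  exact ⟨b, rfl⟩

theorem gen_injective (χ : I → ℤ) : Function.Injective (gen (B := B) χ) :=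
  fun _ _ h => AddMonoidAlgebra.single_right_inj.mp h

theorem gen_mul_gen (χ ψ : I → ℤ) (b c : B) : gen χ b * gen ψ c = gen (χ + ψ) (b * c) :=
  AddMonoidAlgebra.single_mul_single ..

theorem algebraMap_trivial (b : B) : algebraMap B (trivial I B).carrier b = gen 0 b := rfl

theorem algebraMap_mul_gen (b c : B) (χ : I → ℤ) :
    algebraMap B (trivial I B).carrier b * gen χ c = gen χ (b * c) := by
  rw [algebraMap_trivial, gen_mul_gen, zero_add]

theorem gen_zero (χ : I → ℤ) : gen χ (0 : B) = 0 :=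
  map_zero (AddMonoidAlgebra.lsingle (R := B) (S := B) χ)

theorem base_gen (b : B) : (trivial I B).base (gen 0 b) = b :=
  base_algebraMap (P := trivial I B) b

theorem monom_gen {σ : Type} [Fintype σ] (w : σ → I → ℤ) (b : σ → B) (u : σ → ℕ) :
    monom (fun i => gen (w i) (b i)) u = gen (wt w u) (monom b u) := by
  classical
  have hpow (χ : I → ℤ) (b : B) (n : ℕ) : gen χ b ^ n = gen (n • χ) (b ^ n) :=
    AddMonoidAlgebra.single_pow ..
  have h (s : Finset σ) : ∏ i ∈ s, gen (w i) (b i) ^ u i =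
      gen (∑ i ∈ s, u i • w i) (∏ i ∈ s, b i ^ u i) := by
    induction s using Finset.induction_on with
    | empty => rfl
    | insert i s hi ih =>
      rw [Finset.prod_insert hi, ih, hpow, gen_mul_gen, Finset.sum_insert hi,
        Finset.prod_insert hi]
  exact h Finset.univ

theorem trivialHom_gen {B' : Type} [CommRing B'] (φ : B →+* B')
    (u : Multiplicative (I → ℤ) →* B') (χ : I → ℤ) (b : B) :
    (trivialHom φ u).map (gen χ b) = gen χ (φ b * u (Multiplicative.ofAdd χ)) :=
  trivialMap_single φ u χ b

end Trivial

/-- The fibre of a torsor over a field-valued point is trivial. -/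
theorem exists_hom_trivial {R : Type} [CommRing R] (N : TorusTorsor I R) {K : Type} [Field K]
    (φ : R →+* K) : Nonempty (Hom φ N (trivial I K)) := by
  classical
  -- A trivialization is found by matching points: elements of the unit-vector degrees that do not
  -- die in `K` are sent to the generators of the trivial torsor. With these weights a monomial is
  -- determined by its weight, so the cross relation is vacuous.
  let w : I → I → ℤ := fun i => Pi.single i 1
  have hwt (u : I → ℕ) (i : I) : wt w u i = u i := by
    simp [wt, w, Finset.sum_apply, Pi.single_apply]
  have inj (u u' : I → ℕ) (h : wt w u = wt w u') : u = u' := by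
    funext i
    have := congrFun h i
    rw [hwt, hwt] at this
    exact_mod_cast this
  have h (i : I) : ∃ s ∈ N.gr (w i), ∃ t ∈ N.gr (-w i), φ (N.base (s * t)) ≠ 0 := by
    obtain ⟨n, u, u', hu, hu', h⟩ := N.exists_sum_eq_one (w i)
    by_contra! h0
    have h₁ : N.base (∑ k, u k * u' k) = ∑ k, N.base (u k * u' k) := by
      rw [base_eq_iff (sum_mem fun k _ => mul_mem_zero (hu k) (hu' k)), map_sum]
      exact Finset.sum_congr rfl fun k _ => (algebraMap_base (mul_mem_zero (hu k) (hu' k))).symm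
    rw [h, base_one] at h₁
    have h₂ := congrArg φ h₁
    rw [map_one, map_sum, Finset.sum_eq_zero fun k _ => h0 _ (hu k) _ (hu' k)] at h₂
    exact one_ne_zero h₂
  choose s hs t ht hst using h
  let v' : I → (trivial I K).carrier :=
    fun i => gen (w i) 1
  obtain ⟨f, -, -⟩ := existsUnique_hom (w := w) (η := wt w 1) (φ := φ) (N := N) (N' := trivial I K)
    (v := s) (v' := v') (by
      intro e _ χ
      have he : e = 1 := inj _ _ ‹_›
      subst he
      refine ⟨fun i => (-χ i).toNat, fun i => (χ i).toNat, by simp, by simp, ?_⟩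
      funext i
      rw [Pi.add_apply, hwt, hwt]
      omega) hs (fun i => gen_mem _ _) (by
      refine Ideal.eq_top_of_isUnit_mem _ (Ideal.mem_map_of_mem φ (Ideal.subset_span
        ⟨1, rfl, monom t 1, ?_, rfl⟩)) (IsUnit.mk0 _ ?_)
      · have := monom_mem (w := fun i => -w i) (v := t) ht 1
        convert this using 2
        simp [wt]
      · have h₁ : N.base (monom s 1 * monom t 1) = ∏ i, N.base (s i * t i) := by
          have h₀ : monom s 1 * monom t 1 = ∏ i, (s i * t i) := by
            simp [monom, Finset.prod_mul_distrib]
          have hm := prod_mem (P := N) Finset.univ (w := fun _ => 0) (v := fun i => s i * t i)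
            fun i _ => mul_mem_zero (hs i) (ht i)
          rw [Finset.sum_const_zero] at hm
          rw [h₀, base_eq_iff hm, map_prod]
          exact Finset.prod_congr rfl fun i _ => (algebraMap_base (mul_mem_zero (hs i) (ht i))).symm
        rw [h₁, map_prod]
        exact Finset.prod_ne_zero_iff.mpr fun i _ => hst i) (by
      refine Ideal.eq_top_of_isUnit_mem _ (Ideal.subset_span
        ⟨1, rfl, gen (-wt w 1) 1, gen_mem _ _, rfl⟩) ?_
      rw [monom_gen, gen_mul_gen, add_neg_cancel, base_gen]
      simp [monom]) (by
      intro n u u' hu hu' x _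
      rw [inj u u' (hu.trans hu'.symm)])
  exact ⟨f⟩

end TorusTorsor

/-! ### Frames: torsors on the line that come from the base. -/

open TorusTorsor

/-- The descent of a torsor on the projective line, up to the standard twist by `γ`, to the base. -/
structure Frame {I : Type} [Fintype I] {R : Type} [CommRing R] (γ : I → ℤ) (N : TorusTorsor I R)
    (P : P1Torsor I R) where
  zero : TorusTorsor.Hom (C : R →+* R[X]) N P.zero
  infty : TorusTorsor.Hom (C : R →+* R[X]) N P.infty
  compat : ∀ χ, ∀ a ∈ N.gr χ, P.resInfty.map (infty.map a) =
    (LaurentPolynomial.T (χ ⬝ᵥ γ) : R[T;T⁻¹]) • P.resZero.map (zero.map a)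

namespace Frame

variable {I : Type} [Fintype I] {R R' : Type} [CommRing R] [CommRing R'] {γ : I → ℤ}
  {N : TorusTorsor I R} {P : P1Torsor I R} {N' : TorusTorsor I R'} {P' : P1Torsor I R'}

theorem overlapZero_C (r : R) : overlapZero R (C r) = LaurentPolynomial.C r :=
  Polynomial.toLaurent_C r

theorem overlapZero_X : overlapZero R X = LaurentPolynomial.T 1 :=
  Polynomial.toLaurent_X

theorem overlapInfty_C (r : R) : overlapInfty R (C r) = LaurentPolynomial.C r := by
  change LaurentPolynomial.invert (Polynomial.toLaurent (C r)) = _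
  rw [Polynomial.toLaurent_C, LaurentPolynomial.invert_C]

theorem overlapInfty_X : overlapInfty R X = LaurentPolynomial.T (-1) := by
  change LaurentPolynomial.invert (Polynomial.toLaurent X) = _
  rw [Polynomial.toLaurent_X, LaurentPolynomial.invert_T]

theorem mapRingHom_T (φ : R →+* R') (n : ℤ) : AddMonoidAlgebra.mapRingHom ℤ φ
    (LaurentPolynomial.T n : R[T;T⁻¹]) = (LaurentPolynomial.T n : R'[T;T⁻¹]) := by
  refine (AddMonoidAlgebra.mapRingHom_single φ n (1 : R)).trans ?_
  rw [map_one]; rfl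

theorem mapRingHom_C (φ : R →+* R') (r : R) : AddMonoidAlgebra.mapRingHom ℤ φ
    (LaurentPolynomial.C r : R[T;T⁻¹]) = (LaurentPolynomial.C (φ r) : R'[T;T⁻¹]) := by
  refine (AddMonoidAlgebra.mapRingHom_single φ 0 r).trans ?_
  rfl

theorem mapRingHom_comp_overlapZero (φ : R →+* R') :
    (AddMonoidAlgebra.mapRingHom ℤ φ : R[T;T⁻¹] →+* R'[T;T⁻¹]).comp (overlapZero R) =
      (overlapZero R').comp (Polynomial.mapRingHom φ) := by
  refine Polynomial.ringHom_ext (fun r => ?_) ?_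
  · simp only [RingHom.comp_apply, coe_mapRingHom, Polynomial.map_C, overlapZero_C]
    exact mapRingHom_C φ r
  · simp only [RingHom.comp_apply, coe_mapRingHom, Polynomial.map_X, overlapZero_X]
    exact mapRingHom_T φ 1

theorem mapRingHom_comp_overlapInfty (φ : R →+* R') :
    (AddMonoidAlgebra.mapRingHom ℤ φ : R[T;T⁻¹] →+* R'[T;T⁻¹]).comp (overlapInfty R) =
      (overlapInfty R').comp (Polynomial.mapRingHom φ) := by
  refine Polynomial.ringHom_ext (fun r => ?_) ?_
  · simp only [RingHom.comp_apply, coe_mapRingHom, Polynomial.map_C, overlapInfty_C]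
    exact mapRingHom_C φ r
  · simp only [RingHom.comp_apply, coe_mapRingHom, Polynomial.map_X, overlapInfty_X]
    exact mapRingHom_T φ (-1)

theorem mapRingHom_comp_C (φ : R →+* R') :
    (Polynomial.mapRingHom φ).comp C = (C : R' →+* R'[X]).comp φ := by
  ext r; simp

/-- Morphisms between the descended torsors extend. -/
theorem exists_hom {φ : R →+* R'} (F : Frame γ N P) (F' : Frame γ N' P') (h : TorusTorsor.Hom φ N N') :
    ∃ f : P1Torsor.Hom φ P P', (∀ χ, ∀ a ∈ N.gr χ, f.zero.map (F.zero.map a) = F'.zero.map (h.map a)) ∧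
      ∀ χ, ∀ a ∈ N.gr χ, f.infty.map (F.infty.map a) = F'.infty.map (h.map a) := by
  obtain ⟨z, hz⟩ := F.zero.exists_extension (ψ := Polynomial.mapRingHom φ) (F'.zero.comp h rfl)
    (mapRingHom_comp_C φ).symm
  obtain ⟨i, hi⟩ := F.infty.exists_extension (ψ := Polynomial.mapRingHom φ) (F'.infty.comp h rfl)
    (mapRingHom_comp_C φ).symm
  obtain ⟨o, ho⟩ := (P.resZero.comp F.zero rfl).exists_extension
    (ψ := (AddMonoidAlgebra.mapRingHom ℤ φ : R[T;T⁻¹] →+* R'[T;T⁻¹]))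
    ((P'.resZero.comp z rfl).comp F.zero rfl)
    (by rw [← mapRingHom_comp_overlapZero]; rfl)
  have hzero : o.comp P.resZero rfl = P'.resZero.comp z (mapRingHom_comp_overlapZero φ) :=
    F.zero.eq_of_comp_eq fun χ a ha => ho χ a ha
  -- The map on the overlap was built from the chart at `0`. It is compatible with the chart at `∞`
  -- because both frames carry the same twist `T ^ ⟨χ, γ⟩`.
  have hinfty : o.comp P.resInfty rfl = P'.resInfty.comp i (mapRingHom_comp_overlapInfty φ) := by
    refine F.infty.eq_of_comp_eq fun χ a ha => ?_
    change o.map (P.resInfty.map (F.infty.map a)) = P'.resInfty.map (i.map (F.infty.map a))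
    have h₁ := hi χ a ha
    have h₂ := hz χ a ha
    have h₃ := ho χ a ha
    change i.map (F.infty.map a) = F'.infty.map (h.map a) at h₁
    change z.map (F.zero.map a) = F'.zero.map (h.map a) at h₂
    change o.map (P.resZero.map (F.zero.map a)) = P'.resZero.map (z.map (F.zero.map a)) at h₃
    rw [h₁, F.compat χ a ha, F'.compat χ _ (h.map_gr _ _ ha), Algebra.smul_def, Algebra.smul_def,
      map_mul, o.map_base, h₃, h₂, mapRingHom_T]
  exact ⟨⟨z, i, o, fun a => congrArg (fun k => k.map a) hzero,
    fun a => congrArg (fun k => k.map a) hinfty⟩, hz, hi⟩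

theorem hom_ext (F : Frame γ N P) {φ : R →+* R'} {f g : P1Torsor.Hom φ P P'}
    (hz : ∀ χ, ∀ a ∈ N.gr χ, f.zero.map (F.zero.map a) = g.zero.map (F.zero.map a))
    (hi : ∀ χ, ∀ a ∈ N.gr χ, f.infty.map (F.infty.map a) = g.infty.map (F.infty.map a)) : f = g := by
  have h₁ : f.zero = g.zero := F.zero.eq_of_comp_eq hz
  have h₂ : f.infty = g.infty := F.infty.eq_of_comp_eq hi
  have h₃ : f.overlap = g.overlap := P.resZero.eq_of_comp_eq fun χ a ha => by
    rw [f.comm_zero, g.comm_zero, h₁]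
  exact P1Torsor.Hom.ext h₁ h₂ h₃

variable (I R γ) in
/-- The frame of the standard torsor. -/
noncomputable def standard : Frame γ (TorusTorsor.trivial I R) (P1Torsor.standard R γ) where
  zero := trivialHom Polynomial.C 1
  infty := trivialHom Polynomial.C 1
  compat χ a ha := by
    obtain ⟨b, rfl⟩ := exists_eq_gen ha
    have h : (trivialHom (I := I) (Polynomial.C : R →+* R[X]) 1).map (gen χ b) =
        gen χ (Polynomial.C b) := by
      rw [trivialHom_gen, MonoidHom.one_apply, mul_one]
    refine (congrArg _ h).trans (Eq.trans ?_ (congrArg _ (congrArg _ h)).symm)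
    refine (trivialHom_gen _ _ _ _).trans ?_
    rw [Algebra.smul_def]
    refine Eq.trans ?_ (congrArg _ (trivialHom_gen _ _ _ _).symm)
    refine Eq.trans ?_ (algebraMap_mul_gen _ _ _).symm
    rw [MonoidHom.one_apply, mul_one, overlapInfty_C, overlapZero_C, mul_comm]
    rfl

/-- A family of torsors on the projective line with a frame has the expected degree. -/
theorem hasDegree (F : Frame γ N P) : P.HasDegree γ := fun K _ φ => by
  obtain ⟨h⟩ := N.exists_hom_trivial φ
  obtain ⟨f, -⟩ := F.exists_hom (standard I K γ) h
  exact ⟨f⟩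

end Frame

namespace Frame

variable {I : Type} [Fintype I] {R : Type} [CommRing R]

/-- Every torsor on the base extends to the projective line, with twist `γ`. -/
theorem exists_of_torsor (γ : I → ℤ) (N : TorusTorsor I R) :
    ∃ P : P1Torsor I R, Nonempty (Frame γ N P) := by
  let Z := N.baseChange R[X]
  let O := N.baseChange R[T;T⁻¹]
  let z : TorusTorsor.Hom (Polynomial.C : R →+* R[X]) N Z := N.toBaseChange R[X]
  let o : TorusTorsor.Hom (LaurentPolynomial.C : R →+* R[T;T⁻¹]) N O := N.toBaseChange R[T;T⁻¹]
  -- The gluing at `∞` multiplies degree `χ` by `T ^ ⟨χ, γ⟩`, which is multiplicative because the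
  -- exponent is additive in `χ`.
  obtain ⟨t, ht⟩ := exists_ringHom (P := N)
    (fun χ a => algebraMap R[T;T⁻¹] O.carrier (LaurentPolynomial.T (χ ⬝ᵥ γ)) * o.map a)
    (fun χ a _ b _ => by simp only [map_add, mul_add])
    (by simp)
    (fun χ ψ a _ b _ => by
      rw [add_dotProduct, LaurentPolynomial.T_add]
      simp only [map_mul]; ring)
  let o' : TorusTorsor.Hom (LaurentPolynomial.C : R →+* R[T;T⁻¹]) N O :=
    { map := t
      map_base := fun r => by
        rw [ht 0 _ (N.algebraMap_mem r), zero_dotProduct, LaurentPolynomial.T_zero, map_one,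
          one_mul, o.map_base]
      map_gr := fun χ a ha => by
        rw [ht χ a ha]; exact algebraMap_mul_mem _ (o.map_gr _ _ ha) }
  obtain ⟨r0, hr0⟩ := z.exists_extension (ψ := overlapZero R) o (by
    exact RingHom.ext fun r => (overlapZero_C r).symm)
  obtain ⟨r1, hr1⟩ := z.exists_extension (ψ := overlapInfty R) o' (by
    exact RingHom.ext fun r => (overlapInfty_C r).symm)
  refine ⟨⟨Z, Z, O, r0, r1⟩, ⟨⟨z, z, fun χ a ha => ?_⟩⟩⟩
  change r1.map (z.map a) = _ • r0.map (z.map a)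
  rw [hr0 χ a ha, hr1 χ a ha, Algebra.smul_def]
  exact ht χ a ha

end Frame

/-! ### Coefficients of elements and sections of the twisted bundles. -/

section Coefficients

variable {I : Type} [Fintype I] {R : Type} [CommRing R]

theorem coeff_C_mul_T (r : R) (n i : ℤ) :
    (LaurentPolynomial.C r * LaurentPolynomial.T n : R[T;T⁻¹]).coeff i = if n = i then r else 0 := by
  rw [← LaurentPolynomial.single_eq_C_mul_T, AddMonoidAlgebra.coeff_single, Finsupp.single_apply]

/-- Coefficients of an element of a torsor over the Laurent polynomials which is extended from a
torsor over the base. -/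
theorem exists_coeff {N : TorusTorsor I R} {O : TorusTorsor I R[T;T⁻¹]}
    (J : TorusTorsor.Hom (LaurentPolynomial.C : R →+* R[T;T⁻¹]) N O) (χ : I → ℤ) (i : ℤ) :
    ∃ κ : O.carrier → N.carrier, ∀ (ι : Type) (s : Finset ι) (f : ι → ℤ) (a : ι → N.carrier),
      (∀ j ∈ s, a j ∈ N.gr χ) →
      κ (∑ j ∈ s, algebraMap R[T;T⁻¹] O.carrier (LaurentPolynomial.T (f j)) * J.map (a j)) =
        ∑ j ∈ s, if f j = i then a j else 0 := by
  classical
  obtain ⟨n, u, u', hu, hu', h⟩ := N.exists_sum_eq_one χ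
  -- Pairing with `u' k` lands in the Laurent polynomials, where the coefficient of `T ^ i` makes
  -- sense. The `u k` reassemble the results into an element of `N`.
  refine ⟨fun z => ∑ k, algebraMap R N.carrier ((O.base (z * J.map (u' k))).coeff i) * u k,
    fun ι s f a ha => ?_⟩
  have h₁ (k) : O.base ((∑ j ∈ s, algebraMap R[T;T⁻¹] O.carrier (LaurentPolynomial.T (f j)) *
      J.map (a j)) * J.map (u' k)) =
      ∑ j ∈ s, LaurentPolynomial.C (N.base (a j * u' k)) * LaurentPolynomial.T (f j) := by
    have h₂ (j) (hj : j ∈ s) : algebraMap R[T;T⁻¹] O.carrier (LaurentPolynomial.T (f j)) *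
        J.map (a j) * J.map (u' k) = algebraMap R[T;T⁻¹] O.carrier
          (LaurentPolynomial.C (N.base (a j * u' k)) * LaurentPolynomial.T (f j)) := by
      rw [map_mul, ← J.map_base, algebraMap_base (mul_mem_zero (ha j hj) (hu' k)), map_mul]
      ring
    rw [Finset.sum_mul, Finset.sum_congr rfl h₂, ← map_sum, base_algebraMap]
  simp only [h₁]
  have h₃ (k) : (∑ j ∈ s, LaurentPolynomial.C (N.base (a j * u' k)) * LaurentPolynomial.T (f j)
      : R[T;T⁻¹]).coeff i = ∑ j ∈ s, if f j = i then N.base (a j * u' k) else 0 := by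
    rw [AddMonoidAlgebra.coeff_sum, Finset.sum_apply']
    exact Finset.sum_congr rfl fun j _ => coeff_C_mul_T _ _ _
  simp only [h₃, map_sum, Finset.sum_mul]
  rw [Finset.sum_comm]
  refine Finset.sum_congr rfl fun j hj => ?_
  split_ifs with hi
  · have h₄ := congrArg (fun z => a j * z) h
    simp only [mul_one, Finset.mul_sum] at h₄
    refine Eq.trans (Finset.sum_congr rfl fun k _ => ?_) h₄
    rw [algebraMap_base (mul_mem_zero (ha j hj) (hu' k))]; ring
  · simp

/-- Elements of a torsor over the polynomials which is extended from a torsor over the base are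
polynomials. -/
theorem exists_polynomial {N : TorusTorsor I R} {Z : TorusTorsor I R[X]}
    (J : TorusTorsor.Hom (Polynomial.C : R →+* R[X]) N Z) {χ : I → ℤ} {z : Z.carrier}
    (hz : z ∈ Z.gr χ) : ∃ (m : ℕ) (c : ℕ → N.carrier), (∀ j, c j ∈ N.gr χ) ∧ (∀ j, m ≤ j → c j = 0) ∧
      z = ∑ j ∈ Finset.range m, algebraMap R[X] Z.carrier (X ^ j) * J.map (c j) := by
  obtain ⟨n, u, b, hu, rfl⟩ := J.exists_sum_map_eq hz
  let m := ∑ k, ((b k).natDegree + 1)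
  have hm (k) : (b k).natDegree < m :=
    Finset.single_le_sum (f := fun k => (b k).natDegree + 1) (fun _ _ => Nat.zero_le _)
      (Finset.mem_univ k)
  refine ⟨m, fun j => ∑ k, algebraMap R N.carrier ((b k).coeff j) * u k,
    fun j => sum_mem fun k _ => algebraMap_mul_mem _ (hu k), fun j hj => ?_, ?_⟩
  · refine Finset.sum_eq_zero fun k _ => ?_
    rw [Polynomial.coeff_eq_zero_of_natDegree_lt ((hm k).trans_le hj), map_zero, zero_mul]
  · simp only [map_sum, Finset.mul_sum]
    rw [Finset.sum_comm]
    refine Finset.sum_congr rfl fun k _ => ?_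
    have h : b k = ∑ j ∈ Finset.range m, Polynomial.C ((b k).coeff j) * X ^ j := by
      conv_lhs => rw [Polynomial.as_sum_range' (b k) m (hm k)]
      simp only [Polynomial.C_mul_X_pow_eq_monomial]
    conv_lhs => rw [h, map_sum, Finset.sum_mul]
    refine Finset.sum_congr rfl fun j _ => ?_
    simp only [map_mul, J.map_base]; ring

end Coefficients

namespace Frame

variable {I : Type} [Fintype I] {R : Type} [CommRing R] {γ : I → ℤ}
  {N : TorusTorsor I R} {P : P1Torsor I R}

/-- The frame restricted to the overlap. -/
noncomputable def overlap (F : Frame γ N P) :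
    TorusTorsor.Hom (LaurentPolynomial.C : R →+* R[T;T⁻¹]) N P.overlap :=
  P.resZero.comp F.zero (RingHom.ext fun r => (overlapZero_C r).symm)

theorem resZero_sum (F : Frame γ N P) {ι : Type} (s : Finset ι) (e : ι → ℕ) (c : ι → N.carrier) :
    P.resZero.map (∑ j ∈ s, algebraMap R[X] P.zero.carrier (X ^ e j) * F.zero.map (c j)) =
      ∑ j ∈ s, algebraMap R[T;T⁻¹] P.overlap.carrier (LaurentPolynomial.T (e j)) *
        F.overlap.map (c j) := by
  rw [map_sum]
  refine Finset.sum_congr rfl fun j _ => ?_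
  rw [map_mul, P.resZero.map_base, map_pow, overlapZero_X, LaurentPolynomial.T_pow, mul_one]
  rfl

theorem resInfty_sum (F : Frame γ N P) {χ : I → ℤ} {ι : Type} (s : Finset ι) (e : ι → ℕ)
    (c : ι → N.carrier) (hc : ∀ j ∈ s, c j ∈ N.gr χ) (p : ℤ) :
    (LaurentPolynomial.T p : R[T;T⁻¹]) •
    P.resInfty.map (∑ j ∈ s, algebraMap R[X] P.infty.carrier (X ^ e j) * F.infty.map (c j)) =
      ∑ j ∈ s, algebraMap R[T;T⁻¹] P.overlap.carrier
        (LaurentPolynomial.T (χ ⬝ᵥ γ + p - e j)) * F.overlap.map (c j) := by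
  rw [map_sum, Finset.smul_sum]
  refine Finset.sum_congr rfl fun j hj => ?_
  rw [map_mul, P.resInfty.map_base, map_pow, overlapInfty_X, LaurentPolynomial.T_pow,
    F.compat χ _ (hc j hj), Algebra.smul_def, Algebra.smul_def, ← mul_assoc, ← mul_assoc, ← map_mul,
    ← map_mul, ← LaurentPolynomial.T_add, ← LaurentPolynomial.T_add]
  congr 3
  ring_nf

/-- The sections of the twisted bundle of degree `k - 1` have `k` coefficients. -/
theorem exists_sections (F : Frame γ N P) {χ : I → ℤ} {p k : ℤ} (hk : k = χ ⬝ᵥ γ - p + 1)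
    {a : P.zero.carrier} {b : P.infty.carrier} (ha : a ∈ P.zero.gr χ) (hb : b ∈ P.infty.gr χ)
    (h : P.resZero.map a = (LaurentPolynomial.T (-p) : R[T;T⁻¹]) • P.resInfty.map b) :
    ∃ v : Fin k.toNat → N.carrier, (∀ j, v j ∈ N.gr χ) ∧
      a = ∑ j : Fin k.toNat, algebraMap R[X] P.zero.carrier (X ^ (j : ℕ)) * F.zero.map (v j) ∧
      b = ∑ j : Fin k.toNat,
        algebraMap R[X] P.infty.carrier (X ^ (k.toNat - 1 - j)) * F.infty.map (v j) := by
  classical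
  obtain ⟨m, c, hc, hc0, ha'⟩ := exists_polynomial F.zero ha
  obtain ⟨m', d, hd, hd0, hb'⟩ := exists_polynomial F.infty hb
  rw [ha', hb', F.resZero_sum _ (fun j => j), F.resInfty_sum _ (fun j => j) d fun j _ => hd j] at h
  -- Around `0` the exponents on the overlap are `j ≥ 0`, around `∞` they are `k - 1 - j ≤ k - 1`.
  -- Comparison leaves the range from `0` to `k - 1` and identifies `c j` with `d (k - 1 - j)`. If
  -- `k ≤ 0` nothing is left, in accordance with `k.toNat = 0`.
  have key (i : ℤ) : (∑ j ∈ Finset.range m, if (j : ℤ) = i then c j else 0) =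
      ∑ j ∈ Finset.range m', if k - 1 - j = i then d j else 0 := by
    obtain ⟨κ, hκ⟩ := exists_coeff F.overlap χ i
    have := congrArg κ h
    rw [hκ _ _ _ _ fun j _ => hc j, hκ _ _ _ _ fun j _ => hd j] at this
    rw [this]
    refine Finset.sum_congr rfl fun j _ => ?_
    rw [hk]
    congr 2
    ring
  have left (i : ℕ) : (∑ j ∈ Finset.range m, if (j : ℤ) = i then c j else 0) = c i := by
    simp only [Nat.cast_inj, Finset.sum_ite_eq', Finset.mem_range]
    split_ifs with hi
    · rfl
    · exact (hc0 i (not_lt.mp hi)).symm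
  have right (i : ℕ) : (∑ j ∈ Finset.range m', if k - 1 - (j : ℤ) = k - 1 - i then d j else 0) =
      d i := by
    simp only [sub_right_inj, Nat.cast_inj, Finset.sum_ite_eq', Finset.mem_range]
    split_ifs with hi
    · rfl
    · exact (hd0 i (not_lt.mp hi)).symm
  have hcd (j : ℕ) (hj : j < k.toNat) : d (k.toNat - 1 - j) = c j := by
    rw [← left j, key, ← right (k.toNat - 1 - j)]
    refine Finset.sum_congr rfl fun i _ => ?_
    congr 2
    omega
  have hc1 (j : ℕ) (hj : k.toNat ≤ j) : c j = 0 := by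
    rw [← left j, key]
    refine Finset.sum_eq_zero fun i _ => if_neg (by omega)
  have hd1 (j : ℕ) (hj : k.toNat ≤ j) : d j = 0 := by
    rw [← right j, ← key]
    refine Finset.sum_eq_zero fun i _ => if_neg (by omega)
  have trunc {A : Type} [AddCommMonoid A] (f : ℕ → A) (m : ℕ) (h₁ : ∀ j, m ≤ j → f j = 0)
      (h₂ : ∀ j, k.toNat ≤ j → f j = 0) :
      ∑ j ∈ Finset.range m, f j = ∑ j ∈ Finset.range k.toNat, f j := by
    rcases le_total m k.toNat with hm | hm
    · exact Finset.sum_subset (by simpa using hm) fun j _ hj => h₁ j (by simpa using hj)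
    · exact (Finset.sum_subset (by simpa using hm) fun j _ hj => h₂ j (by simpa using hj)).symm
  refine ⟨fun j => c j, fun j => hc j, ?_, ?_⟩
  · rw [ha', trunc _ m (fun j hj => by rw [hc0 j hj, map_zero, mul_zero])
      (fun j hj => by rw [hc1 j hj, map_zero, mul_zero]), Finset.sum_range]
  · rw [hb', trunc _ m' (fun j hj => by rw [hd0 j hj, map_zero, mul_zero])
      (fun j hj => by rw [hd1 j hj, map_zero, mul_zero]), Finset.sum_range,
      ← Equiv.sum_comp Fin.revPerm]
    refine Finset.sum_congr rfl fun j _ => ?_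
    have h₁ : ((Fin.revPerm j : Fin k.toNat) : ℕ) = k.toNat - 1 - j := by
      simp [Fin.val_rev]; omega
    rw [h₁, hcd j j.2]

theorem sections_injective (F : Frame γ N P) {χ : I → ℤ} {n : ℕ} {v v' : Fin n → N.carrier}
    (hv : ∀ j, v j ∈ N.gr χ) (hv' : ∀ j, v' j ∈ N.gr χ)
    (h : ∑ j : Fin n, algebraMap R[X] P.zero.carrier (X ^ (j : ℕ)) * F.zero.map (v j) =
      ∑ j : Fin n, algebraMap R[X] P.zero.carrier (X ^ (j : ℕ)) * F.zero.map (v' j)) : v = v' := by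
  classical
  funext i
  obtain ⟨κ, hκ⟩ := exists_coeff F.overlap χ i
  have h₁ := congrArg (fun z => κ (P.resZero.map z)) h
  simp only [F.resZero_sum] at h₁
  rw [hκ _ _ _ _ fun j _ => hv j, hκ _ _ _ _ fun j _ => hv' j] at h₁
  simpa [Fin.val_inj] using h₁

theorem glue_sections (F : Frame γ N P) {χ : I → ℤ} {p k : ℤ} (hk : k = χ ⬝ᵥ γ - p + 1)
    {v : Fin k.toNat → N.carrier} (hv : ∀ j, v j ∈ N.gr χ) :
    P.resZero.map (∑ j : Fin k.toNat, algebraMap R[X] P.zero.carrier (X ^ (j : ℕ)) *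
      F.zero.map (v j)) = (LaurentPolynomial.T (-p) : R[T;T⁻¹]) •
      P.resInfty.map (∑ j : Fin k.toNat,
        algebraMap R[X] P.infty.carrier (X ^ (k.toNat - 1 - j)) * F.infty.map (v j)) := by
  rw [F.resZero_sum, F.resInfty_sum _ _ _ fun j _ => hv j]
  refine Finset.sum_congr rfl fun j _ => ?_
  congr 3
  have := j.2
  omega

end Frame

/-! ### Čech cohomology of the projective line, and Nakayama's lemma. -/

section LaurentSplitting

variable {R : Type} [CommRing R]

theorem overlapZero_C_mul_X_pow (r : R) (n : ℕ) : overlapZero R (Polynomial.C r * X ^ n) =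
    LaurentPolynomial.C r * LaurentPolynomial.T n := by
  rw [map_mul, map_pow, Frame.overlapZero_C, Frame.overlapZero_X, LaurentPolynomial.T_pow, mul_one]

theorem overlapInfty_C_mul_X_pow (r : R) (n : ℕ) : overlapInfty R (Polynomial.C r * X ^ n) =
    LaurentPolynomial.C r * LaurentPolynomial.T (-n) := by
  rw [map_mul, map_pow, Frame.overlapInfty_C, Frame.overlapInfty_X, LaurentPolynomial.T_pow,
    mul_neg_one]

/-- The first cohomology of the structure sheaf of the projective line vanishes. -/
theorem exists_eq_overlapZero_sub_overlapInfty (l : R[T;T⁻¹]) :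
    ∃ p q : R[X], l = overlapZero R p - overlapInfty R q := by
  induction l using LaurentPolynomial.induction_on' with
  | add l l' h h' =>
    obtain ⟨p, q, rfl⟩ := h
    obtain ⟨p', q', rfl⟩ := h'
    exact ⟨p + p', q + q', by simp only [map_add]; ring⟩
  | C_mul_T n a =>
    rcases le_total 0 n with hn | hn
    · refine ⟨Polynomial.C a * X ^ n.toNat, 0, ?_⟩
      rw [overlapZero_C_mul_X_pow, map_zero, sub_zero, Int.toNat_of_nonneg hn]
    · refine ⟨0, -(Polynomial.C a * X ^ (-n).toNat), ?_⟩
      rw [map_neg, overlapInfty_C_mul_X_pow, map_zero, zero_sub, neg_neg,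
        Int.toNat_of_nonneg (by omega), neg_neg]

/-- Global functions on the projective line are constant. -/
theorem eq_C_of_overlapZero_eq_overlapInfty {p q : R[X]}
    (h : overlapZero R p = overlapInfty R q) : ∃ r, p = Polynomial.C r ∧ q = Polynomial.C r := by
  have h₁ (p : R[X]) (i : ℕ) : (overlapZero R p).coeff (i : ℤ) = p.coeff i := by
    induction p using Polynomial.induction_on' with
    | add p q hp hq => rw [map_add, AddMonoidAlgebra.coeff_add, Finsupp.add_apply, hp, hq,
        Polynomial.coeff_add]
    | monomial n a =>
      rw [← Polynomial.C_mul_X_pow_eq_monomial, overlapZero_C_mul_X_pow, coeff_C_mul_T,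
        Polynomial.coeff_C_mul_X_pow]
      simp only [Nat.cast_inj, eq_comm]
  have h₁' (p : R[X]) (i : ℤ) (hi : i < 0) : (overlapZero R p).coeff i = 0 := by
    induction p using Polynomial.induction_on' with
    | add p q hp hq => rw [map_add, AddMonoidAlgebra.coeff_add, Finsupp.add_apply, hp, hq, add_zero]
    | monomial n a =>
      rw [← Polynomial.C_mul_X_pow_eq_monomial, overlapZero_C_mul_X_pow, coeff_C_mul_T,
        if_neg (by omega)]
  have h₂ (p : R[X]) (i : ℕ) : (overlapInfty R p).coeff (-i : ℤ) = p.coeff i := by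
    induction p using Polynomial.induction_on' with
    | add p q hp hq => rw [map_add, AddMonoidAlgebra.coeff_add, Finsupp.add_apply, hp, hq,
        Polynomial.coeff_add]
    | monomial n a =>
      rw [← Polynomial.C_mul_X_pow_eq_monomial, overlapInfty_C_mul_X_pow, coeff_C_mul_T,
        Polynomial.coeff_C_mul_X_pow]
      simp only [neg_inj, Nat.cast_inj, eq_comm]
  have h₂' (p : R[X]) (i : ℤ) (hi : 0 < i) : (overlapInfty R p).coeff i = 0 := by
    induction p using Polynomial.induction_on' with
    | add p q hp hq => rw [map_add, AddMonoidAlgebra.coeff_add, Finsupp.add_apply, hp, hq, add_zero]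
    | monomial n a =>
      rw [← Polynomial.C_mul_X_pow_eq_monomial, overlapInfty_C_mul_X_pow, coeff_C_mul_T,
        if_neg (by omega)]
  refine ⟨p.coeff 0, ?_, ?_⟩ <;> ext i <;> rw [Polynomial.coeff_C] <;> split_ifs with hi
  · rw [hi]
  · rw [← h₁, h, h₂' _ _ (by omega)]
  · have h₃ := h₁ p 0
    have h₄ := h₂ q 0
    rw [hi, ← h₄, ← h₃, h]; simp
  · rw [← h₂, ← h, h₁' _ _ (by omega)]

/-- A sufficiently negative power of `T` moves a Laurent polynomial into the functions around `∞`.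
This makes all but finitely many generators in the computation of `H¹` coboundaries. -/
theorem exists_T_mul_eq_overlapInfty (l : R[T;T⁻¹]) :
    ∃ n : ℤ, ∀ i ≤ n, ∃ q : R[X], LaurentPolynomial.T i * l = overlapInfty R q := by
  induction l using LaurentPolynomial.induction_on' with
  | add l l' h h' =>
    obtain ⟨n, h⟩ := h
    obtain ⟨n', h'⟩ := h'
    refine ⟨min n n', fun i hi => ?_⟩
    obtain ⟨q, hq⟩ := h i (hi.trans (min_le_left _ _))
    obtain ⟨q', hq'⟩ := h' i (hi.trans (min_le_right _ _))
    exact ⟨q + q', by rw [mul_add, hq, hq', map_add]⟩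
  | C_mul_T n a =>
    refine ⟨-n, fun i hi => ⟨Polynomial.C a * X ^ (-(i + n)).toNat, ?_⟩⟩
    rw [overlapInfty_C_mul_X_pow, Int.toNat_of_nonneg (by omega), neg_neg, LaurentPolynomial.T_add]
    ring

theorem laurent_eq_sum (l : R[T;T⁻¹]) :
    l = ∑ i ∈ l.coeff.support, LaurentPolynomial.C (l.coeff i) * LaurentPolynomial.T i := by
  conv_lhs => rw [← AddMonoidAlgebra.sum_coeff_single l]
  exact Finset.sum_congr rfl fun i _ => LaurentPolynomial.single_eq_C_mul_T _ _

end LaurentSplitting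

/-- A form of Nakayama's lemma. -/
theorem Submodule.le_of_forall_maximal {R X : Type} [CommRing R] [AddCommGroup X] [Module R X]
    {D G : Submodule R X} {S : Set X} (hS : S.Finite) (hSG : S ⊆ G)
    (hG : G ≤ D ⊔ Submodule.span R S) (h : ∀ p : Ideal R, p.IsMaximal → G ≤ D ⊔ p • G) : G ≤ D := by
  have hmap (Y : Submodule R X) : (D ⊔ Y).map D.mkQ = Y.map D.mkQ := by
    rw [Submodule.map_sup, Submodule.mkQ_map_self, bot_sup_eq]
  -- `G` itself need not be finitely generated, only its image modulo `D`. At each maximal ideal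
  -- Nakayama yields an element of `1 + p` that kills this image.
  have fg : (G.map D.mkQ).FG := by
    have : G.map D.mkQ = Submodule.span R (D.mkQ '' S) := by
      apply le_antisymm
      · refine (Submodule.map_mono hG).trans ?_
        rw [hmap, Submodule.map_span]
      · rw [← Submodule.map_span]
        exact Submodule.map_mono (Submodule.span_le.mpr hSG)
    rw [this]
    exact Submodule.fg_span (hS.image _)
  let A : Ideal R := (G.map D.mkQ).annihilator
  have hA : A = ⊤ := by
    by_contra hA
    obtain ⟨p, hp, hle⟩ := Ideal.exists_le_maximal A hA
    obtain ⟨r, hr, h0⟩ := Submodule.exists_sub_one_mem_and_smul_eq_zero_of_fg_of_le_smul p _ fg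
      (by
        refine (Submodule.map_mono (h p hp)).trans ?_
        rw [hmap, Submodule.map_smul''])
    have : r ∈ p := hle (Submodule.mem_annihilator.mpr h0)
    refine hp.ne_top ((Ideal.eq_top_iff_one _).mpr ?_)
    have := sub_mem this hr
    rwa [sub_sub_cancel] at this
  intro g hg
  have h1 : (1 : R) ∈ A := hA ▸ Submodule.mem_top
  have := Submodule.mem_annihilator.mp h1 _ (Submodule.mem_map_of_mem hg)
  rwa [one_smul, Submodule.mkQ_apply, Submodule.Quotient.mk_eq_zero] at this

/-! ### Descent of families of degree `γ` to the base. -/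

namespace P1Torsor

variable {I : Type} [Fintype I] {R : Type} [CommRing R] (P : P1Torsor I R) (γ χ : I → ℤ)

/-- The Čech differential, twisted by `γ`. -/
noncomputable def cech (a : P.zero.carrier) (b : P.infty.carrier) : P.overlap.carrier :=
  algebraMap R[T;T⁻¹] P.overlap.carrier (LaurentPolynomial.T (χ ⬝ᵥ γ)) * P.resZero.map a -
    P.resInfty.map b

variable {P γ χ}

theorem cech_add (a a' : P.zero.carrier) (b b' : P.infty.carrier) :
    P.cech γ χ (a + a') (b + b') = P.cech γ χ a b + P.cech γ χ a' b' := by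
  simp only [cech, map_add]; ring

theorem cech_zero : P.cech γ χ 0 0 = 0 := by simp [cech]

theorem cech_sub (a a' : P.zero.carrier) (b b' : P.infty.carrier) :
    P.cech γ χ (a - a') (b - b') = P.cech γ χ a b - P.cech γ χ a' b' := by
  simp only [cech, map_sub]; ring

theorem cech_smul (r : R) (a : P.zero.carrier) (b : P.infty.carrier) :
    P.cech γ χ (algebraMap R[X] P.zero.carrier (Polynomial.C r) * a)
      (algebraMap R[X] P.infty.carrier (Polynomial.C r) * b) =
    algebraMap R[T;T⁻¹] P.overlap.carrier (LaurentPolynomial.C r) * P.cech γ χ a b := by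
  simp only [cech, map_mul, P.resZero.map_base, P.resInfty.map_base, Frame.overlapZero_C,
    Frame.overlapInfty_C]
  ring

theorem cech_mem {a : P.zero.carrier} {b : P.infty.carrier} (ha : a ∈ P.zero.gr χ)
    (hb : b ∈ P.infty.gr χ) : P.cech γ χ a b ∈ P.overlap.gr χ :=
  sub_mem (algebraMap_mul_mem _ (P.resZero.map_gr _ _ ha)) (P.resInfty.map_gr _ _ hb)

variable {K : Type} [CommRing K] {φ : R →+* K}

theorem map_cech (f : Hom φ P (standard K γ)) (a : P.zero.carrier) (b : P.infty.carrier) :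
    f.overlap.map (P.cech γ χ a b) =
      (standard K γ).cech γ χ (f.zero.map a) (f.infty.map b) := by
  rw [cech, map_sub, map_mul, f.overlap.map_base, Frame.mapRingHom_T, f.comm_zero, f.comm_infty]
  rfl

theorem cech_standard (p q : K[X]) : (standard K γ).cech γ χ (gen χ p) (gen χ q) =
    gen χ (LaurentPolynomial.T (χ ⬝ᵥ γ) * (overlapZero K p - overlapInfty K q)) := by
  have h₁ : (standard K γ).resZero.map (gen χ p) = gen χ (overlapZero K p) := by
    refine (trivialHom_gen _ _ _ _).trans ?_
    rw [MonoidHom.one_apply, mul_one]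
  have h₂ : (standard K γ).resInfty.map (gen χ q) =
      gen χ (overlapInfty K q * LaurentPolynomial.T (χ ⬝ᵥ γ)) := trivialHom_gen _ _ _ _
  refine (congrArg₂ (fun x y => algebraMap K[T;T⁻¹] (standard K γ).overlap.carrier
    (LaurentPolynomial.T (χ ⬝ᵥ γ)) * x - y) h₁ h₂).trans ?_
  refine (congrArg (fun z => z - _) (algebraMap_mul_gen _ _ _)).trans ?_
  rw [mul_sub, mul_comm (overlapInfty K q)]
  exact (map_sub (AddMonoidAlgebra.lsingle (R := K[T;T⁻¹]) (S := K[T;T⁻¹]) χ) _ _).symm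

/-- Vanishing of the first cohomology of a family of line bundles of degree zero. -/
theorem exists_cech_eq (h : P.HasDegree γ) {z : P.overlap.carrier} (hz : z ∈ P.overlap.gr χ) :
    ∃ a ∈ P.zero.gr χ, ∃ b ∈ P.infty.gr χ, P.cech γ χ a b = z := by
  classical
  let O := P.overlap
  let : Module R O.carrier := Module.compHom _ (LaurentPolynomial.C : R →+* R[T;T⁻¹])
  have smul_def (r : R) (z : O.carrier) :
      r • z = algebraMap R[T;T⁻¹] O.carrier (LaurentPolynomial.C r) * z := Algebra.smul_def _ _
  let G : Submodule R O.carrier :=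
    { (O.gr χ).toAddSubmonoid with
      smul_mem' := fun r z hz => by rw [smul_def]; exact algebraMap_mul_mem _ hz }
  let D : Submodule R O.carrier :=
    { carrier := {z | ∃ a ∈ P.zero.gr χ, ∃ b ∈ P.infty.gr χ, P.cech γ χ a b = z}
      zero_mem' := ⟨0, zero_mem _, 0, zero_mem _, cech_zero⟩
      add_mem' := by
        rintro _ _ ⟨a, ha, b, hb, rfl⟩ ⟨a', ha', b', hb', rfl⟩
        exact ⟨_, add_mem ha ha', _, add_mem hb hb', cech_add _ _ _ _⟩
      smul_mem' := by
        rintro r _ ⟨a, ha, b, hb, rfl⟩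
        exact ⟨_, algebraMap_mul_mem _ ha, _, algebraMap_mul_mem _ hb,
          (cech_smul r a b).trans (smul_def r _).symm⟩ }
  obtain ⟨n, u, u', hu, hu', hone⟩ := P.zero.exists_sum_eq_one χ
  let t (i : ℤ) (k : Fin n) : O.carrier :=
    algebraMap R[T;T⁻¹] O.carrier (LaurentPolynomial.T i) * P.resZero.map (u k)
  have ht (i k) : t i k ∈ G := algebraMap_mul_mem _ (P.resZero.map_gr _ _ (hu k))
  -- High powers of `T` extend over the chart at `0`.
  have hpos (i : ℤ) (hi : χ ⬝ᵥ γ ≤ i) (k) : t i k ∈ D := by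
    refine ⟨algebraMap R[X] _ (X ^ (i - χ ⬝ᵥ γ).toNat) * u k, algebraMap_mul_mem _ (hu k), 0,
      zero_mem _, ?_⟩
    rw [cech, map_zero, sub_zero, map_mul, P.resZero.map_base, map_pow, Frame.overlapZero_X,
      LaurentPolynomial.T_pow, mul_one, ← mul_assoc, ← map_mul, ← LaurentPolynomial.T_add]
    simp only [t]
    congr 3
    omega
  -- Low powers extend over the chart at `∞`, after the generators at `0` are rewritten in elements
  -- coming from `∞`. The finitely many powers in between form `S`, as Nakayama requires.
  have hneg (k) : ∃ m : ℤ, ∀ i ≤ m, t i k ∈ D := by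
    obtain ⟨n', w, l, hw, hl⟩ := P.resInfty.exists_sum_map_eq (P.resZero.map_gr _ _ (hu k))
    choose m hm using fun k' => exists_T_mul_eq_overlapInfty (l k')
    refine ⟨-∑ k', |m k'|, fun i hi => ?_⟩
    have hi' (k') : i ≤ m k' := by
      have h₁ : |m k'| ≤ ∑ k', |m k'| :=
        Finset.single_le_sum (f := fun k' => |m k'|) (fun _ _ => abs_nonneg _) (Finset.mem_univ k')
      have h₂ := neg_abs_le (m k')
      omega
    choose q hq using fun k' => hm k' i (hi' k')
    refine ⟨0, zero_mem _, -∑ k', algebraMap R[X] _ (q k') * w k',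
      neg_mem (sum_mem fun k' _ => algebraMap_mul_mem _ (hw k')), ?_⟩
    rw [cech, map_zero, mul_zero, zero_sub, map_neg, neg_neg, map_sum]
    simp only [t]
    rw [hl, Finset.mul_sum]
    refine Finset.sum_congr rfl fun k' _ => ?_
    rw [map_mul, P.resInfty.map_base, ← hq k', ← mul_assoc, ← map_mul]
  choose m hm using hneg
  let S : Set O.carrier := ⋃ k, (fun i => t i k) '' Set.Icc (m k) (χ ⬝ᵥ γ)
  have hSfin : S.Finite := Set.finite_iUnion fun k => (Set.finite_Icc _ _).image _
  have hSG : S ⊆ G := by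
    rintro _ hs
    obtain ⟨k, i, _, rfl⟩ := Set.mem_iUnion.mp hs
    exact ht i k
  have htall (i k) : t i k ∈ D ⊔ Submodule.span R S := by
    rcases le_total (χ ⬝ᵥ γ) i with h₁ | h₁
    · exact Submodule.mem_sup_left (hpos i h₁ k)
    rcases le_total i (m k) with h₂ | h₂
    · exact Submodule.mem_sup_left (hm k i h₂)
    · exact Submodule.mem_sup_right (Submodule.subset_span
        (Set.mem_iUnion.mpr ⟨k, i, ⟨h₂, h₁⟩, rfl⟩))
  have expand (z : O.carrier) (hz : z ∈ G) : ∃ l : Fin n → R[T;T⁻¹],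
      z = ∑ k, algebraMap R[T;T⁻¹] O.carrier (l k) * P.resZero.map (u k) := by
    refine ⟨fun k => O.base (z * P.resZero.map (u' k)), ?_⟩
    have h₁ := congrArg (fun c => z * P.resZero.map c) hone
    simp only [map_sum, map_mul, map_one, mul_one, Finset.mul_sum] at h₁
    refine h₁.symm.trans (Finset.sum_congr rfl fun k _ => ?_)
    rw [algebraMap_base (mul_mem_zero hz (P.resZero.map_gr _ _ (hu' k)))]
    ring
  have hG : G ≤ D ⊔ Submodule.span R S := by
    intro z hz
    obtain ⟨l, rfl⟩ := expand z hz
    refine sum_mem fun k _ => ?_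
    rw [laurent_eq_sum (l k), map_sum, Finset.sum_mul]
    refine sum_mem fun i _ => ?_
    rw [map_mul, mul_assoc, ← smul_def]
    exact Submodule.smul_mem _ _ (htall i k)
  refine Submodule.le_of_forall_maximal hSfin hSG hG (fun p hp => ?_) hz
  intro z hz
  let := Ideal.Quotient.field p
  obtain ⟨f⟩ := h (R ⧸ p) (Ideal.Quotient.mk p)
  obtain ⟨l, hl⟩ := exists_eq_gen (f.overlap.map_gr _ _ hz)
  -- On the fibre at `p` the bundle is standard and the class splits explicitly. Lifting the two
  -- parts leaves an error with coefficients in `p`.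
  obtain ⟨q₀, q₁, hq⟩ := exists_eq_overlapZero_sub_overlapInfty (LaurentPolynomial.T (-(χ ⬝ᵥ γ)) * l)
  have hsurj : Function.Surjective (Polynomial.mapRingHom (Ideal.Quotient.mk p)) :=
    Polynomial.map_surjective _ Ideal.Quotient.mk_surjective
  obtain ⟨a, ha, hfa⟩ := f.zero.exists_map_eq_of_surjective hsurj (gen_mem χ q₀)
  obtain ⟨b, hb, hfb⟩ := f.infty.exists_map_eq_of_surjective hsurj (gen_mem χ q₁)
  have e : (standard (R ⧸ p) γ).cech γ χ (gen χ q₀) (gen χ q₁) = gen χ l :=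
    (cech_standard _ _).trans (by
      rw [← hq, ← mul_assoc, ← LaurentPolynomial.T_add, add_neg_cancel, LaurentPolynomial.T_zero,
        one_mul])
  have hker : f.overlap.map (z - P.cech γ χ a b) = 0 := by
    rw [map_sub, map_cech, hfa, hfb, hl]
    exact sub_eq_zero.mpr e.symm
  obtain ⟨n', y, c, hy, hc, hzc⟩ := f.overlap.exists_sum_of_map_eq_zero
    (sub_mem hz (cech_mem ha hb)) hker
  rw [← sub_add_cancel z (P.cech γ χ a b), add_comm]
  refine Submodule.add_mem_sup ⟨a, ha, b, hb, rfl⟩ ?_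
  rw [hzc]
  refine sum_mem fun k _ => ?_
  rw [laurent_eq_sum (c k), map_sum, Finset.sum_mul]
  refine sum_mem fun i _ => ?_
  rw [map_mul, mul_assoc, ← smul_def]
  refine Submodule.smul_mem_smul ?_ (algebraMap_mul_mem _ (hy k))
  have := congrArg (fun l => l.coeff i) (hc k)
  rw [AddMonoidAlgebra.coeff_mapRingHom] at this
  exact Ideal.Quotient.eq_zero_iff_mem.mp this

/-- Sections over the fibre at a maximal ideal lift. -/
theorem exists_lift_section (h : P.HasDegree γ) (p : Ideal R) [p.IsMaximal]
    (f : Hom (Ideal.Quotient.mk p) P (standard (R ⧸ p) γ)) :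
    ∃ a ∈ P.zero.gr χ, ∃ b ∈ P.infty.gr χ, P.cech γ χ a b = 0 ∧ f.zero.map a = gen χ 1 := by
  have hsurj : Function.Surjective (Polynomial.mapRingHom (Ideal.Quotient.mk p)) :=
    Polynomial.map_surjective _ Ideal.Quotient.mk_surjective
  obtain ⟨a, ha, hfa⟩ := f.zero.exists_map_eq_of_surjective hsurj (gen_mem χ 1)
  obtain ⟨b, hb, hfb⟩ := f.infty.exists_map_eq_of_surjective hsurj (gen_mem χ 1)
  have hker : f.overlap.map (P.cech γ χ a b) = 0 := by
    rw [map_cech, hfa, hfb]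
    refine (cech_standard _ _).trans ?_
    rw [map_one, map_one, sub_self, mul_zero]
    exact gen_zero _
  obtain ⟨n, y, c, hy, hc, hzc⟩ := f.overlap.exists_sum_of_map_eq_zero (cech_mem ha hb) hker
  -- The lift fails to glue by a combination with coefficients in `p`. Each `T ^ i * y k` is a
  -- coboundary, so the error is the coboundary of a pair with coefficients in `p`; subtracting that
  -- pair does not change the fibre.
  have key : ∃ a' ∈ P.zero.gr χ, ∃ b' ∈ P.infty.gr χ, f.zero.map a' = 0 ∧
      P.cech γ χ a' b' = P.cech γ χ a b := by
    rw [hzc]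
    have hsum {ι : Type} (s : Finset ι) (z : ι → P.overlap.carrier)
        (hz : ∀ i ∈ s, ∃ a' ∈ P.zero.gr χ, ∃ b' ∈ P.infty.gr χ, f.zero.map a' = 0 ∧
          P.cech γ χ a' b' = z i) : ∃ a' ∈ P.zero.gr χ, ∃ b' ∈ P.infty.gr χ, f.zero.map a' = 0 ∧
          P.cech γ χ a' b' = ∑ i ∈ s, z i := by
      classical
      induction s using Finset.induction_on with
      | empty => exact ⟨0, zero_mem _, 0, zero_mem _, map_zero _, by simp [cech_zero]⟩
      | insert i s hi ih =>
        obtain ⟨a₁, ha₁, b₁, hb₁, h₁, h₁'⟩ := hz i (by simp)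
        obtain ⟨a₂, ha₂, b₂, hb₂, h₂, h₂'⟩ := ih fun j hj => hz j (by simp [hj])
        exact ⟨_, add_mem ha₁ ha₂, _, add_mem hb₁ hb₂, by rw [map_add, h₁, h₂, add_zero],
          by rw [cech_add, h₁', h₂', Finset.sum_insert hi]⟩
    refine hsum _ _ fun k _ => ?_
    rw [laurent_eq_sum (c k), map_sum, Finset.sum_mul]
    refine hsum _ _ fun i _ => ?_
    obtain ⟨a', ha', b', hb', hab⟩ := exists_cech_eq h (algebraMap_mul_mem (P := P.overlap)
      (LaurentPolynomial.T i) (hy k))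
    refine ⟨_, algebraMap_mul_mem (Polynomial.C ((c k).coeff i)) ha', _,
      algebraMap_mul_mem (Polynomial.C ((c k).coeff i)) hb', ?_, ?_⟩
    · have := congrArg (fun l => l.coeff i) (hc k)
      rw [AddMonoidAlgebra.coeff_mapRingHom] at this
      have h0 : (Ideal.Quotient.mk p) ((c k).coeff i) = 0 := this
      rw [map_mul, f.zero.map_base, Polynomial.coe_mapRingHom, Polynomial.map_C, h0, map_zero,
        map_zero, zero_mul]
    · rw [cech_smul, hab, map_mul, mul_assoc]
  obtain ⟨a', ha', b', hb', h0, hab⟩ := key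
  exact ⟨a - a', sub_mem ha ha', b - b', sub_mem hb hb', by rw [cech_sub, hab, sub_self],
    by rw [map_sub, h0, sub_zero]; exact hfa⟩

/-- A family of torsors of degree `γ` on the projective line descends to the base. -/
theorem exists_frame (h : P.HasDegree γ) : ∃ N : TorusTorsor I R, Nonempty (Frame γ N P) := by
  let : Algebra R P.zero.carrier := ((algebraMap R[X] P.zero.carrier).comp Polynomial.C).toAlgebra
  let : Algebra R P.infty.carrier :=
    ((algebraMap R[X] P.infty.carrier).comp Polynomial.C).toAlgebra
  have smz (r : R) (a : P.zero.carrier) :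
      r • a = algebraMap R[X] P.zero.carrier (Polynomial.C r) * a := rfl
  have smi (r : R) (a : P.infty.carrier) :
      r • a = algebraMap R[X] P.infty.carrier (Polynomial.C r) * a := rfl
  -- `M χ` consists of the global sections of the line bundle of degree `χ` twisted down to fibre
  -- degree zero. These are the pieces of the descended torsor.
  let M (χ : I → ℤ) : Submodule R (P.zero.carrier × P.infty.carrier) :=
    { carrier := {c | c.1 ∈ P.zero.gr χ ∧ c.2 ∈ P.infty.gr χ ∧ P.cech γ χ c.1 c.2 = 0}
      zero_mem' := ⟨zero_mem _, zero_mem _, cech_zero⟩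
      add_mem' := fun {c d} hc hd => ⟨add_mem hc.1 hd.1, add_mem hc.2.1 hd.2.1, by
        rw [Prod.fst_add, Prod.snd_add, cech_add, hc.2.2, hd.2.2, add_zero]⟩
      smul_mem' := fun r c hc => ⟨algebraMap_mul_mem _ hc.1, algebraMap_mul_mem _ hc.2.1, by
        rw [Prod.smul_fst, Prod.smul_snd, smz, smi, cech_smul, hc.2.2, mul_zero]⟩ }
  have hM (χ c) : c ∈ M χ ↔ c.1 ∈ P.zero.gr χ ∧ c.2 ∈ P.infty.gr χ ∧ P.cech γ χ c.1 c.2 = 0 :=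
    Iff.rfl
  have mul (χ ψ) (a) (ha : a ∈ M χ) (b) (hb : b ∈ M ψ) : a * b ∈ M (χ + ψ) := by
    refine ⟨mul_mem ha.1 hb.1, mul_mem ha.2.1 hb.2.1, ?_⟩
    have h₁ := ha.2.2
    have h₂ := hb.2.2
    simp only [cech] at h₁ h₂ ⊢
    rw [Prod.fst_mul, Prod.snd_mul, add_dotProduct, LaurentPolynomial.T_add]
    simp only [map_mul]
    linear_combination (algebraMap R[T;T⁻¹] P.overlap.carrier (LaurentPolynomial.T (ψ ⬝ᵥ γ)) *
      P.resZero.map b.1) * h₁ + P.resInfty.map a.2 * h₂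
  have zero : M 0 ≤ 1 := by
    rintro ⟨a, b⟩ ⟨ha, hb, hab⟩
    dsimp only at hab ha hb
    rw [cech, zero_dotProduct, LaurentPolynomial.T_zero, map_one, one_mul, sub_eq_zero,
      ← algebraMap_base ha, ← algebraMap_base hb, P.resZero.map_base, P.resInfty.map_base] at hab
    obtain ⟨r, h₁, h₂⟩ := eq_C_of_overlapZero_eq_overlapInfty (P.overlap.algebraMap_injective hab)
    exact Submodule.mem_one.mpr ⟨r, Prod.ext
      ((congrArg (algebraMap R[X] P.zero.carrier) h₁.symm).trans (algebraMap_base ha))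
      ((congrArg (algebraMap R[X] P.infty.carrier) h₂.symm).trans (algebraMap_base hb))⟩
  have inj : Function.Injective (algebraMap R (P.zero.carrier × P.infty.carrier)) := by
    intro r s hrs
    exact Polynomial.C_injective (P.zero.algebraMap_injective (congrArg Prod.fst hrs))
  have one : 1 ∈ M 0 := by
    refine ⟨P.zero.one_mem, P.infty.one_mem, ?_⟩
    simp [cech]
  -- At a maximal ideal `p`, lifts of the generators of the fibre in degrees `χ` and `-χ` multiply
  -- to a constant `r` that is 1 in the fibre, so `r ∉ p`.
  have unit (χ) : 1 ∈ M χ * M (-χ) := by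
    let A : Ideal R := (M χ * M (-χ)).comap (Algebra.linearMap R _)
    have hA : A = ⊤ := by
      by_contra hA
      obtain ⟨p, hp, hle⟩ := Ideal.exists_le_maximal A hA
      let := Ideal.Quotient.field p
      obtain ⟨f⟩ := h (R ⧸ p) (Ideal.Quotient.mk p)
      obtain ⟨a, ha, b, hb, hab, hfa⟩ := exists_lift_section (χ := χ) h p f
      obtain ⟨a', ha', b', hb', hab', hfa'⟩ := exists_lift_section (χ := -χ) h p f
      have h₁ : ((a, b) : P.zero.carrier × P.infty.carrier) ∈ M χ := ⟨ha, hb, hab⟩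
      have h₂ : ((a', b') : P.zero.carrier × P.infty.carrier) ∈ M (-χ) := ⟨ha', hb', hab'⟩
      have h₃ := mul _ _ _ h₁ _ h₂
      rw [add_neg_cancel] at h₃
      obtain ⟨r, hr⟩ := Submodule.mem_one.mp (zero h₃)
      have hrp : r ∈ p := hle (by
        change algebraMap R (P.zero.carrier × P.infty.carrier) r ∈ M χ * M (-χ)
        rw [hr]; exact Submodule.mul_mem_mul h₁ h₂)
      have h₄ : algebraMap R[X] P.zero.carrier (Polynomial.C r) = a * a' := congrArg Prod.fst hr
      have h₅ := congrArg f.zero.map h₄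
      rw [map_mul, f.zero.map_base, hfa, hfa', Polynomial.coe_mapRingHom, Polynomial.map_C,
        Ideal.Quotient.eq_zero_iff_mem.mpr hrp, map_zero, map_zero] at h₅
      have h₆ : (0 : (TorusTorsor.trivial I (R ⧸ p)[X]).carrier) = gen 0 1 := by
        refine h₅.trans ((gen_mul_gen _ _ _ _).trans ?_)
        rw [add_neg_cancel, mul_one]
      have h₇ : (0 : (R ⧸ p)[X]) = 1 := gen_injective 0 (by rw [← h₆, gen_zero])
      exact zero_ne_one h₇
    have h1 : (1 : R) ∈ A := hA ▸ Submodule.mem_top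
    have h2 : algebraMap R (P.zero.carrier × P.infty.carrier) 1 ∈ M χ * M (-χ) := h1
    rwa [map_one] at h2
  obtain ⟨N, f, hf1, hf2, -, -⟩ := TorusTorsor.exists_ofPieces M one mul zero inj unit
  refine ⟨N, ⟨⟨⟨(RingHom.fst _ _).comp f, fun r => congrArg Prod.fst (hf1 r),
    fun χ a ha => (hf2 χ a ha).1⟩, ⟨(RingHom.snd _ _).comp f, fun r => congrArg Prod.snd (hf1 r),
    fun χ a ha => (hf2 χ a ha).2.1⟩, fun χ a ha => ?_⟩⟩⟩
  have := (hf2 χ a ha).2.2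
  rw [cech, sub_eq_zero] at this
  rw [Algebra.smul_def]
  exact this.symm

end P1Torsor

/-! ### Charts, and reduction to monomials with independent weights. -/

section Charts

variable {I σ : Type} [Fintype σ]

/-- A monomial of weight `η` such that the weights of its variables form a basis of the character
lattice. -/
def IsChart (w : σ → I → ℤ) (η : I → ℤ) (c : σ → ℕ) : Prop :=
  wt w c = η ∧ ∀ χ : I → ℤ, ∃! a : σ → ℤ, (∀ i, c i = 0 → a i = 0) ∧ ∑ i, a i • w i = χ

/-- Every monomial whose weight is a positive multiple of `η` is divisible up to powers by a
chart. -/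
def IsCharted (w : σ → I → ℤ) (η : I → ℤ) : Prop :=
  ∀ (n : ℕ) (u : σ → ℕ), 0 < n → wt w u = n • η → ∃ c, IsChart w η c ∧ ∀ i, u i = 0 → c i = 0

theorem IsCharted.spansLattice {w : σ → I → ℤ} {η : I → ℤ} (h : IsCharted w η) :
    TorusTorsor.SpansLattice w η := by
  intro s hs χ
  obtain ⟨c, ⟨-, hc⟩, hsc⟩ := h 1 s one_pos (by simpa using hs)
  obtain ⟨a, ⟨ha, hχ⟩, -⟩ := hc χ
  refine ⟨fun i => (-a i).toNat, fun i => (a i).toNat, fun i hi => by simp [ha i (hsc i hi)],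
    fun i hi => by simp [ha i (hsc i hi)], ?_⟩
  rw [← hχ, wt, wt, ← Finset.sum_add_distrib]
  refine Finset.sum_congr rfl fun i _ => ?_
  rw [← natCast_zsmul, ← natCast_zsmul, ← add_smul]
  congr 1
  omega

/-- A monomial with minimal support among those with weight a positive multiple of `η` has linearly
independent weights. -/
theorem exists_minimal_support (w : σ → I → ℤ) (η : I → ℤ) {n : ℕ} {u : σ → ℕ} (hn : 0 < n)
    (hu : wt w u = n • η) : ∃ (n' : ℕ) (u' : σ → ℕ), 0 < n' ∧ wt w u' = n' • η ∧
      (∀ i, u i = 0 → u' i = 0) ∧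
      ∀ a : σ → ℤ, (∀ i, u' i = 0 → a i = 0) → ∑ i, a i • w i = 0 → a = 0 := by
  classical
  induction hk : (Finset.univ.filter fun i => u i ≠ 0).card using Nat.strong_induction_on
    generalizing n u with
  | _ k ih =>
  by_cases hind : ∀ a : σ → ℤ, (∀ i, u i = 0 → a i = 0) → ∑ i, a i • w i = 0 → a = 0
  · exact ⟨n, u, hn, hu, fun _ h => h, hind⟩
  push Not at hind
  obtain ⟨a, ha, hsum, hne⟩ := hind
  have hpos : ∃ a : σ → ℤ, (∀ i, u i = 0 → a i = 0) ∧ ∑ i, a i • w i = 0 ∧ ∃ i, 0 < a i := by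
    obtain ⟨i, hi⟩ := Function.ne_iff.mp hne
    rcases lt_or_gt_of_ne hi with hi | hi
    · exact ⟨-a, fun i hi => by simp [ha i hi], by
        simp only [Pi.neg_apply, neg_smul, Finset.sum_neg_distrib, hsum, neg_zero], i, by
        simpa using hi⟩
    · exact ⟨a, ha, hsum, i, hi⟩
  clear! a
  obtain ⟨a, ha, hsum, i, hi⟩ := hpos
  -- As in Carathéodory's theorem, one moves along the relation `a` until a first coordinate reaches
  -- zero. For `j` minimizing `u i / a i`, the vector `a j * u - u j * a` is nonnegative, vanishes
  -- at `j`, and its weight is still a positive multiple of `η`.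
  obtain ⟨j, hj, hmin⟩ := Finset.exists_min_image (Finset.univ.filter fun i => 0 < a i)
    (fun i => (u i : ℚ) / a i) ⟨i, by simpa using hi⟩
  rw [Finset.mem_filter] at hj
  have hle (i) : u j * a i ≤ a j * u i := by
    rcases le_or_gt (a i) 0 with h | h
    · exact (mul_nonpos_of_nonneg_of_nonpos (by positivity) h).trans
        (mul_nonneg hj.2.le (by positivity))
    · have := hmin i (by simpa using h)
      rw [div_le_div_iff₀ (by exact_mod_cast hj.2) (by exact_mod_cast h)] at this
      rw [mul_comm (a j)]
      exact_mod_cast this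
  have huj : u j ≠ 0 := fun h => hj.2.ne' (ha j h)
  let t : σ → ℕ := fun i => (a j * u i - u j * a i).toNat
  have ht (i) : (t i : ℤ) = a j * u i - u j * a i := Int.toNat_of_nonneg (by linarith [hle i])
  have ht0 (i) (h : u i = 0) : t i = 0 := by
    have := ht i
    rw [h, ha i h] at this
    simpa using this
  obtain ⟨n', u', hn', hu', h, hind⟩ := ih _ (by
      rw [← hk]
      refine Finset.card_lt_card (Finset.ssubset_iff_subset_ne.mpr ⟨fun i hi => ?_, fun h => ?_⟩)
      · simp only [Finset.mem_filter, Finset.mem_univ, true_and] at hi ⊢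
        exact fun h => hi (ht0 i h)
      · have : j ∈ Finset.univ.filter fun i => u i ≠ 0 := by simpa using huj
        rw [← h] at this
        refine (Finset.mem_filter.mp this).2 ?_
        have := ht j
        rw [mul_comm, sub_self] at this
        exact_mod_cast this) (n := (a j).toNat * n) (u := t)
    (Nat.mul_pos (by omega) hn) (by
      have haj : ((a j).toNat : ℤ) = a j := Int.toNat_of_nonneg hj.2.le
      rw [mul_smul, ← hu, ← natCast_zsmul (wt w u) (a j).toNat, haj, wt, wt]
      have h₁ (i) : t i • w i = a j • (u i • w i) - (u j : ℤ) • (a i • w i) := by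
        rw [← natCast_zsmul, ht, sub_smul, mul_smul, mul_smul, natCast_zsmul (w i)]
      simp only [h₁, Finset.sum_sub_distrib, ← Finset.smul_sum, hsum, smul_zero, sub_zero]) rfl
  exact ⟨n', u', hn', hu', fun i hi => h i (ht0 i hi), hind⟩

end Charts

/-! ### Charts from genericity and total unimodularity. -/

namespace HypertoricDatum

variable {E I J : Type} [Fintype E] [Fintype I] [Fintype J] (D : HypertoricDatum E I J)

theorem mulVec_incl_apply (ξ : I → ℤ) (e : E) : D.incl.mulVec ξ e = D.incl e ⬝ᵥ ξ := rfl

/-- The support of a nonzero cocharacter contains that of a circuit. -/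
theorem exists_isCircuit {ξ : I → ℤ} (hξ : ξ ≠ 0) : ∃ β, D.IsCircuit β ∧
    Function.support (D.incl.mulVec β) ⊆ Function.support (D.incl.mulVec ξ) := by
  classical
  let S : Set (Set E) := {s | ∃ ξ' : I → ℤ, ξ' ≠ 0 ∧ s = Function.support (D.incl.mulVec ξ')}
  obtain ⟨s, hs, hmin⟩ := (Set.toFinite S).exists_le_minimal (a := Function.support (D.incl.mulVec ξ))
    ⟨ξ, hξ, rfl⟩
  obtain ⟨ξ', hξ', rfl⟩ := hmin.prop
  let g : ℤ := Finset.univ.gcd ξ'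
  have hg : g ≠ 0 := fun h => hξ' (by
    ext i
    exact Finset.gcd_eq_zero_iff.mp h i (Finset.mem_univ _))
  obtain ⟨β, hβ, hβg⟩ := Finset.extract_gcd ξ' (Finset.univ_nonempty_iff.mpr
    (by by_contra h; rw [not_nonempty_iff] at h; exact hξ' (Subsingleton.elim _ _)))
  have hξβ : ξ' = g • β := by ext i; simpa using hβ i (Finset.mem_univ _)
  have hsupp : Function.support (D.incl.mulVec β) = Function.support (D.incl.mulVec ξ') := by
    rw [hξβ, Matrix.mulVec_smul]
    ext e
    simp [hg]
  refine ⟨β, ⟨?_, fun n γ' h => ?_, fun γ' hγ' h => ?_⟩, hsupp ▸ hs⟩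
  · rintro rfl
    exact hξ' (by simp [hξβ])
  · rw [isUnit_iff_dvd_one, ← hβg]
    exact Finset.dvd_gcd fun i _ => ⟨γ' i, congrFun h i⟩
  · rw [hsupp] at h ⊢
    exact h.antisymm (hmin.le_of_le ⟨γ', hγ', rfl⟩ h)

theorem card_eq (D : HypertoricDatum E I J) : Fintype.card E = Fintype.card I + Fintype.card J := by
  have h₁ := Submodule.finrank_quotient_add_finrank (LinearMap.ker D.proj.mulVecLin)
  have h₂ := (D.proj.mulVecLin.quotKerEquivOfSurjective D.proj_surjective).finrank_eq
  have h₃ : LinearMap.ker D.proj.mulVecLin = LinearMap.range D.incl.mulVecLin := by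
    ext z
    exact D.exact z
  have h₄ : Module.finrank ℤ (LinearMap.range D.incl.mulVecLin) = Fintype.card I := by
    rw [LinearMap.finrank_range_of_inj D.incl_injective, Module.finrank_fintype_fun_eq_card]
  rw [h₂, h₃, h₄, Module.finrank_fintype_fun_eq_card,
    Module.finrank_fintype_fun_eq_card] at h₁
  omega

/-- The characters in a set of rows of `∂` which is a basis over `ℚ` take arbitrary integral
values. -/
theorem exists_mulVec_eq (s : Finset E) (hs : s.card = Fintype.card I)
    (h : ∀ ξ, (∀ e ∈ s, D.incl.mulVec ξ e = 0) → ξ = 0) (t : E → ℤ) :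
    ∃ ξ, ∀ e ∈ s, D.incl.mulVec ξ e = t e := by
  classical
  have hcard : Fintype.card J = Fintype.card {e // e ∉ s} := by
    rw [Fintype.card_subtype_compl, D.card_eq]
    simp [hs]
  let f : Fin (Fintype.card J) ≃ J := (Fintype.equivFin J).symm
  let g : Fin (Fintype.card J) ≃ {e // e ∉ s} := (Fintype.equivFinOfCardEq hcard.symm).symm
  -- The maximal minor of `proj` complementary to `s`; it is square because `card E = card I + card
  -- J`.
  let M := D.proj.submatrix f (fun i => (g i : E))
  let ext (z : Fin (Fintype.card J) → ℤ) (e : E) : ℤ := if h : e ∈ s then 0 else z (g.symm ⟨e, h⟩)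
  have hM (z) (j) : D.proj.mulVec (ext z) (f j) = M.mulVec z j := by
    simp only [Matrix.mulVec, dotProduct]
    rw [← Finset.sum_subset (Finset.subset_univ sᶜ)
      (fun e _ he => by
        have : e ∈ s := by simpa using he
        simp [ext, this])]
    rw [Finset.sum_subtype (p := fun e => e ∉ s) sᶜ (by simp)
      (fun e => D.proj (f j) e * ext z e), ← g.sum_comp]
    refine Finset.sum_congr rfl fun i _ => ?_
    simp [ext, M, (g i).2]
  -- A kernel vector, extended by zero on `s`, is by exactness the image of a cocharacter that
  -- vanishes on `s`, hence zero. Total unimodularity then forces the determinant to be `±1`.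
  have hdet : M.det ≠ 0 := fun h0 => by
    obtain ⟨z, hz, hMz⟩ := Matrix.exists_mulVec_eq_zero_iff.mpr h0
    have h₁ : D.proj.mulVec (ext z) = 0 := by
      ext j
      obtain ⟨j, rfl⟩ := f.surjective j
      rw [hM, hMz]; rfl
    obtain ⟨ξ, hξ⟩ := (D.exact _).mp h₁
    have h₂ := h ξ fun e he => by rw [hξ]; simp [ext, he]
    refine hz (funext fun i => ?_)
    have h₃ := congrFun hξ (g i)
    rw [h₂, Matrix.mulVec_zero] at h₃
    simpa [ext, (g i).2] using h₃.symm
  have hunit : IsUnit M.det := by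
    obtain ⟨s, hs⟩ := D.unimodular _ f (fun i => (g i : E)) f.injective
      (Subtype.val_injective.comp g.injective)
    change _ = M.det at hs
    rw [← hs] at hdet ⊢
    cases s <;> simp at hdet ⊢
  let t' : E → ℤ := fun e => if e ∈ s then t e else 0
  -- The correction is supported off `s` and cancels the image of `t'` under `proj`. It is integral
  -- because the minor is invertible over `ℤ`.
  let z := M⁻¹.mulVec (fun j => -D.proj.mulVec t' (f j))
  have h₁ : D.proj.mulVec (t' + ext z) = 0 := by
    ext j
    obtain ⟨j, rfl⟩ := f.surjective j
    rw [Matrix.mulVec_add, Pi.add_apply, hM, Matrix.mulVec_mulVec, Matrix.mul_nonsing_inv _ hunit,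
      Matrix.one_mulVec]
    simp
  obtain ⟨ξ, hξ⟩ := (D.exact _).mp h₁
  exact ⟨ξ, fun e he => by rw [hξ]; simp [t', ext, he]⟩

/-- The index in `E` of a coordinate. -/
def index : E ⊕ E → E := Sum.elim id id

theorem weight_eq_or (ε : E ⊕ E) : D.weight ε = D.incl (index ε) ∨ D.weight ε = -D.incl (index ε) := by
  cases ε
  · exact Or.inl rfl
  · exact Or.inr rfl

/-- The semistable locus is covered by charts for a generic stability condition. -/
theorem isCharted {η : I → ℤ} (hη : D.IsGeneric η) {σ : Type} [Fintype σ] (ε : σ → E ⊕ E) :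
    IsCharted (fun i => D.weight (ε i)) η := by
  classical
  intro n u hn hu
  set w : σ → I → ℤ := fun i => D.weight (ε i) with hw
  obtain ⟨n', c, hn', hc, huc, hind⟩ := exists_minimal_support w η hn hu
  let b : Finset σ := Finset.univ.filter fun i => c i ≠ 0
  have hb (i) : i ∉ b ↔ c i = 0 := by simp [b]
  let s : Finset E := b.image fun i => index (ε i)
  -- Two coordinates over the same `e` have weights equal up to sign, which would be a linear
  -- relation in the support.
  have hinj : Set.InjOn (fun i => index (ε i)) b := by
    intro i hi j hj hij
    by_contra hne
    have hsign : ∃ x : ℤ, w i = x • w j := by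
      rcases D.weight_eq_or (ε i) with h | h <;> rcases D.weight_eq_or (ε j) with h' | h' <;>
        simp only [hw, h, h'] <;> dsimp only at hij <;> rw [hij]
      · exact ⟨1, by simp⟩
      · exact ⟨-1, by simp⟩
      · exact ⟨-1, by simp⟩
      · exact ⟨1, by simp⟩
    obtain ⟨x, hx⟩ := hsign
    have := hind (Pi.single i 1 - x • Pi.single j 1) (fun k hk => by
      have h₁ : k ≠ i := by rintro rfl; exact (hb k).mpr hk hi
      have h₂ : k ≠ j := by rintro rfl; exact (hb k).mpr hk hj
      simp [h₁, h₂]) (by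
        simp only [Pi.sub_apply, sub_smul, Finset.sum_sub_distrib]
        rw [Finset.sum_eq_single i (by intro k _ hk; simp [hk]) (by simp),
          Finset.sum_eq_single j (by intro k _ hk; simp [hk]) (by simp)]
        simp [hx])
    have h₁ := congrFun this i
    simp [hne] at h₁
  have hpair (i) (ξ : I → ℤ) : D.incl.mulVec ξ (index (ε i)) = 0 ↔ w i ⬝ᵥ ξ = 0 := by
    rw [mulVec_incl_apply]
    rcases D.weight_eq_or (ε i) with h | h <;> simp [hw, h]
  -- Genericity enters here: a nonzero `ξ` killed by all rows in `s` would give a circuit killed by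
  -- them too, and hence orthogonal to a positive multiple of `η`.
  have hann (ξ : I → ℤ) (hξ : ∀ e ∈ s, D.incl.mulVec ξ e = 0) : ξ = 0 := by
    by_contra hne
    obtain ⟨β, hβ, hsupp⟩ := D.exists_isCircuit hne
    refine hη β hβ ?_
    have h₁ : (n' • η) ⬝ᵥ β = 0 := by
      rw [← hc, wt, sum_dotProduct]
      refine Finset.sum_eq_zero fun i _ => ?_
      by_cases hi : i ∈ b
      · rw [smul_dotProduct, (hpair i β).mp ?_, smul_zero]
        by_contra h
        exact hsupp h (hξ _ (Finset.mem_image_of_mem _ hi))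
      · simp [(hb i).mp hi]
    rw [smul_dotProduct, smul_eq_zero] at h₁
    exact h₁.resolve_left hn'.ne'
  have hcard : s.card = Fintype.card I := by
    refine le_antisymm ?_ ?_
    · rw [Finset.card_image_of_injOn hinj, ← Fintype.card_coe,
        ← Module.finrank_fintype_fun_eq_card (R := ℤ) (η := I)]
      refine LinearIndependent.fintype_card_le_finrank (b := fun i : b => w i) ?_
      rw [Fintype.linearIndependent_iff]
      intro a ha i
      have := hind (fun i => if h : i ∈ b then a ⟨i, h⟩ else 0)
        (fun i hi => by simp [(hb i).mpr hi]) (by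
          rw [← ha, ← Finset.sum_subset (Finset.subset_univ b) (fun i _ hi => by simp [hi]),
            ← Finset.sum_coe_sort b]
          refine Finset.sum_congr rfl fun i _ => ?_
          simp)
      simpa using congrFun this i
    · rw [← Fintype.card_coe s, ← Module.finrank_fintype_fun_eq_card (R := ℤ) (η := I),
        ← Module.finrank_fintype_fun_eq_card (R := ℤ) (η := s)]
      refine LinearMap.finrank_le_finrank_of_injective
        (f := (LinearMap.funLeft ℤ ℤ (Subtype.val : s → E)).comp D.incl.mulVecLin) ?_
      rw [← LinearMap.ker_eq_bot, LinearMap.ker_eq_bot']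
      intro ξ hξ
      exact hann ξ fun e he => congrFun hξ ⟨e, he⟩
  -- Unimodularity enters here: the rational basis of weights has an integral dual basis, so it is a
  -- basis of the lattice.
  have hdual (i) (hi : i ∈ b) : ∃ ξ : I → ℤ, ∀ j ∈ b, w j ⬝ᵥ ξ = if j = i then 1 else 0 := by
    obtain ⟨ξ, hξ⟩ := D.exists_mulVec_eq s hcard hann (Pi.single (index (ε i)) 1)
    obtain ⟨x, hx⟩ : ∃ x : ℤ, x * w i ⬝ᵥ ξ = 1 := by
      have := hξ _ (Finset.mem_image_of_mem _ hi)
      rw [Pi.single_eq_same, mulVec_incl_apply] at this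
      rcases D.weight_eq_or (ε i) with h | h
      · exact ⟨1, by simp [hw, h, this]⟩
      · exact ⟨-1, by simp [hw, h, this]⟩
    refine ⟨x • ξ, fun j hj => ?_⟩
    split_ifs with hji
    · rw [dotProduct_smul, hji, smul_eq_mul, hx]
    · rw [dotProduct_smul, (hpair j ξ).mp, smul_zero]
      rw [hξ _ (Finset.mem_image_of_mem _ hj), Pi.single_eq_of_ne]
      exact fun h => hji (hinj hj hi h)
  choose! ξ hξ using hdual
  have hexp (χ : I → ℤ) : ∃ a : σ → ℤ, (∀ i, c i = 0 → a i = 0) ∧ ∑ i, a i • w i = χ := by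
    let a : σ → ℤ := fun i => if i ∈ b then χ ⬝ᵥ ξ i else 0
    refine ⟨a, fun i hi => by simp [a, (hb i).mpr hi], ?_⟩
    let W : Matrix b I ℤ := fun i => w i
    let X : Matrix I b ℤ := fun k i => ξ i k
    have hWX : W * X = 1 := by
      ext i j
      rw [Matrix.mul_apply, Matrix.one_apply]
      refine (hξ j j.2 i i.2).trans ?_
      simp only [Subtype.ext_iff]
    have hXW : X * W = 1 := (Matrix.mul_eq_one_comm_of_card_eq _ _ _ (by
      rw [← hcard, Finset.card_image_of_injOn hinj, Fintype.card_coe])).mp hWX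
    have h₁ : χ = Matrix.vecMul (Matrix.vecMul χ X) W := by
      rw [Matrix.vecMul_vecMul, hXW, Matrix.vecMul_one]
    rw [h₁, ← Finset.sum_subset (Finset.subset_univ b) (fun i _ hi => by simp [a, hi]),
      ← Finset.sum_coe_sort b, Matrix.vecMul_eq_sum]
    refine Finset.sum_congr rfl fun i _ => ?_
    simp only [a, i.2, if_true]
    rfl
  -- The integral expansion `a` of `η` satisfies `c = n' • a` by independence. So `a` is nonnegative
  -- with the support of `c`, and it has weight `η` rather than a multiple of it.
  obtain ⟨a, ha, haη⟩ := hexp η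
  have hca : (fun i => (c i : ℤ)) = n' • a := by
    refine sub_eq_zero.mp (hind _ (fun i hi => by simp [hi, ha i hi]) ?_)
    have h₁ : ∑ i, (c i : ℤ) • w i = n' • η := by
      rw [← hc, wt]
      exact Finset.sum_congr rfl fun i _ => natCast_zsmul _ _
    simp only [Pi.sub_apply, sub_smul, Finset.sum_sub_distrib, h₁, Pi.smul_apply, smul_assoc,
      ← Finset.smul_sum, haη, sub_self]
  have hca' (i) : (c i : ℤ) = n' * a i := by simpa using congrFun hca i
  have hn0 : (0 : ℤ) < n' := by exact_mod_cast hn'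
  have hapos (i) : 0 ≤ a i := by
    have : 0 ≤ (n' : ℤ) * a i := hca' i ▸ Int.natCast_nonneg _
    exact nonneg_of_mul_nonneg_right this hn0
  have ha0 (i) : (a i).toNat = 0 ↔ c i = 0 := by
    constructor
    · intro h
      have h₁ := hca' i
      rw [show a i = 0 by have := hapos i; omega, mul_zero] at h₁
      exact_mod_cast h₁
    · intro h
      rw [ha i h]; rfl
  refine ⟨fun i => (a i).toNat, ⟨?_, fun χ => ?_⟩, fun i hi => (ha0 i).mpr (huc i hi)⟩
  · rw [← haη, wt]
    refine Finset.sum_congr rfl fun i _ => ?_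
    rw [← natCast_zsmul, Int.toNat_of_nonneg (hapos i)]
  · obtain ⟨a, ha, hχ⟩ := hexp χ
    simp only [ha0]
    refine ⟨a, ⟨ha, hχ⟩, fun a' ⟨ha', hχ'⟩ => ?_⟩
    have := hind (a' - a) (fun i hi => by simp [ha i hi, ha' i hi]) (by
      simp only [Pi.sub_apply, sub_smul, Finset.sum_sub_distrib, hχ, hχ', sub_self])
    exact sub_eq_zero.mp this

end HypertoricDatum

open scoped TensorProduct

/-! ### Morphisms from affine schemes to `Proj` -/

namespace ProjPoint

variable {A : Type} [CommRing A] [Algebra ℂ A] (𝒜 : ℕ → Submodule ℂ A) [GradedAlgebra 𝒜]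
  {T T' : Type} [CommRing T] [CommRing T']

/-- The map on the homogeneous localization induced by a map which inverts the denominator. -/
noncomputable def awayLift (β : A →+* T) {H : A} (hu : IsUnit (β H)) :
    HomogeneousLocalization.Away 𝒜 H →+* T :=
  (IsLocalization.Away.lift H hu : Localization.Away H →+* T).comp
    (algebraMap (HomogeneousLocalization.Away 𝒜 H) (Localization.Away H))

theorem awayLift_mk_mul (β : A →+* T) {H : A} (hu : IsUnit (β H)) {d : ℕ} (hH : H ∈ 𝒜 d) (n : ℕ)
    (F : A) (hF : F ∈ 𝒜 (n • d)) :
    awayLift 𝒜 β hu (HomogeneousLocalization.Away.mk 𝒜 hH n F hF) * β H ^ n = β F := by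
  rw [awayLift, RingHom.comp_apply, HomogeneousLocalization.algebraMap_apply,
    HomogeneousLocalization.Away.val_mk, Localization.mk_eq_mk']
  have h := IsLocalization.mk'_spec (Localization.Away H) F
    (⟨H ^ n, n, rfl⟩ : Submonoid.powers H)
  have h₁ := congrArg (IsLocalization.Away.lift H hu : Localization.Away H →+* T) h
  rwa [map_mul, IsLocalization.Away.lift_eq, IsLocalization.Away.lift_eq, map_pow] at h₁

theorem away_hom_ext {H : A} {d : ℕ} (hH : H ∈ 𝒜 d)
    {f g : HomogeneousLocalization.Away 𝒜 H →+* T}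
    (h : ∀ n F hF, f (HomogeneousLocalization.Away.mk 𝒜 hH n F hF) =
      g (HomogeneousLocalization.Away.mk 𝒜 hH n F hF)) : f = g := by
  ext x
  obtain ⟨n, F, hF, rfl⟩ := HomogeneousLocalization.Away.mk_surjective 𝒜 hH x
  exact h n F hF

/-- The point of the chart `D₊(H)` with given homogeneous coordinates. -/
noncomputable def pt (β : A →+* T) {H : A} (hH : H ∈ 𝒜 1) (hu : IsUnit (β H)) :
    Spec (CommRingCat.of T) ⟶ Proj 𝒜 :=
  Spec.map (CommRingCat.ofHom (awayLift 𝒜 β hu)) ≫ Proj.awayι 𝒜 H hH one_pos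

variable {𝒜}

theorem comp_pt (β : A →+* T) (ψ : T →+* T') {H : A} (hH : H ∈ 𝒜 1) (hu : IsUnit (β H)) :
    Spec.map (CommRingCat.ofHom ψ) ≫ pt 𝒜 β hH hu = pt 𝒜 (ψ.comp β) hH (hu.map ψ) := by
  rw [pt, pt, ← Category.assoc, ← Spec.map_comp, ← CommRingCat.ofHom_comp]
  congr 3
  refine away_hom_ext 𝒜 hH fun n F hF => ?_
  refine ((hu.map ψ).pow n).mul_right_cancel ?_
  have := awayLift_mk_mul 𝒜 (ψ.comp β) (hu.map ψ) hH n F hF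
  rw [RingHom.comp_apply, RingHom.comp_apply] at this
  rw [this, RingHom.comp_apply, ← map_pow, ← map_mul, awayLift_mk_mul]

/-- Functions on `D₊(H)` are the ratios `F / H ^ n`; the condition says that these agree, with
denominators cleared. -/
theorem pt_eq_iff (β β' : A →+* T) {H : A} (hH : H ∈ 𝒜 1) (hu : IsUnit (β H)) (hu' : IsUnit (β' H)) :
    pt 𝒜 β hH hu = pt 𝒜 β' hH hu' ↔ ∀ n, ∀ F ∈ 𝒜 n, β F * β' H ^ n = β' F * β H ^ n := by
  have key (n : ℕ) (F : A) (hF : F ∈ 𝒜 (n • 1)) :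
      awayLift 𝒜 β hu (HomogeneousLocalization.Away.mk 𝒜 hH n F hF) =
        awayLift 𝒜 β' hu' (HomogeneousLocalization.Away.mk 𝒜 hH n F hF) ↔
      β F * β' H ^ n = β' F * β H ^ n := by
    rw [← awayLift_mk_mul 𝒜 β hu hH n F hF, ← awayLift_mk_mul 𝒜 β' hu' hH n F hF]
    generalize awayLift 𝒜 β hu _ = x
    generalize awayLift 𝒜 β' hu' _ = y
    rw [mul_assoc, mul_assoc, mul_comm (β' H ^ n)]
    exact (IsUnit.mul_left_inj ((hu.pow n).mul (hu'.pow n))).symm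
  constructor
  · intro h n F hF
    rw [pt, pt, cancel_mono] at h
    have h₁ := congrArg CommRingCat.Hom.hom (Spec.map_injective h)
    exact (key n F (by simpa using hF)).mp (RingHom.congr_fun h₁ _)
  · intro h
    rw [pt, pt]
    congr 3
    refine away_hom_ext 𝒜 hH fun n F hF => ?_
    exact (key n F hF).mpr (h n F (by simpa using hF))

/-- Both morphisms factor through `D₊(H * H')`, in the same way. -/
theorem pt_eq_pt (β : A →+* T) {H H' : A} (hH : H ∈ 𝒜 1) (hH' : H' ∈ 𝒜 1) (hu : IsUnit (β H))
    (hu' : IsUnit (β H')) : pt 𝒜 β hH hu = pt 𝒜 β hH' hu' := by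
  have hm : IsUnit (β (H * H')) := by rw [map_mul]; exact hu.mul hu'
  have key {H H' x : A} (hH : H ∈ 𝒜 1) (hH' : H' ∈ 𝒜 1) (hx : x = H * H') (hu : IsUnit (β H))
      (hm : IsUnit (β x)) : pt 𝒜 β hH hu = Spec.map (CommRingCat.ofHom (awayLift 𝒜 β hm)) ≫
        Proj.awayι 𝒜 x (hx ▸ SetLike.mul_mem_graded hH hH') (by decide) := by
    rw [← Proj.SpecMap_awayMap_awayι 𝒜 hH one_pos hH' hx, ← Category.assoc, ← Spec.map_comp,
      ← CommRingCat.ofHom_comp, pt]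
    congr 3
    refine away_hom_ext 𝒜 hH fun n F hF => ?_
    rw [RingHom.comp_apply, HomogeneousLocalization.awayMap_mk]
    refine (hm.pow n).mul_right_cancel ?_
    rw [awayLift_mk_mul, hx, map_mul, mul_pow, ← mul_assoc, awayLift_mk_mul, map_mul, map_pow]
  rw [key hH hH' rfl hu hm, key hH' hH (mul_comm H H') hu' hm]

/-- Homogeneous coordinates which do not vanish simultaneously. -/
def IsStable (𝒜 : ℕ → Submodule ℂ A) (β : A →+* T) : Prop :=
  Ideal.span (Set.range fun H : 𝒜 1 => β H) = ⊤

omit [GradedAlgebra 𝒜] in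
theorem IsStable.comp {β : A →+* T} (h : IsStable 𝒜 β) (ψ : T →+* T') :
    IsStable 𝒜 (ψ.comp β) := by
  rw [IsStable] at h ⊢
  have := congrArg (Ideal.map ψ) h
  rw [Ideal.map_span, Ideal.map_top, ← Set.range_comp] at this
  exact this

omit [GradedAlgebra 𝒜] in
theorem IsStable.hom_ext {β : A →+* T} (h : IsStable 𝒜 β) {Y : Scheme}
    {g g' : Spec (CommRingCat.of T) ⟶ Y} (hg : ∀ (T' : Type) [CommRing T'] (ψ : T →+* T'),
      (∃ H ∈ 𝒜 1, IsUnit (ψ (β H))) →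
      Spec.map (CommRingCat.ofHom ψ) ≫ g = Spec.map (CommRingCat.ofHom ψ) ≫ g') : g = g' := by
  refine Scheme.Cover.hom_ext (Scheme.affineOpenCoverOfSpanRangeEqTop (R := CommRingCat.of T)
    (fun H : 𝒜 1 => β H) h).openCover _ _ fun (H : 𝒜 1) => ?_
  exact hg _ (algebraMap T (Localization.Away (β H))) ⟨H, H.2,
    IsLocalization.Away.algebraMap_isUnit _⟩

/-- Overlaps of basic open sets are spectra of tensor products of localizations, so the gluing
condition becomes a condition on ring maps. -/
theorem exists_glue {ι : Type} {s : ι → T} (hs : Ideal.span (Set.range s) = ⊤) {Y : Scheme.{0}}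
    (p : ∀ i, Spec (CommRingCat.of (Localization.Away (s i))) ⟶ Y)
    (hp : ∀ i j, Spec.map (CommRingCat.ofHom (algebraMap (Localization.Away (s i))
        (Localization.Away (s i) ⊗[T] Localization.Away (s j)))) ≫ p i =
      Spec.map (CommRingCat.ofHom (Algebra.TensorProduct.includeRight :
        Localization.Away (s j) →ₐ[T] Localization.Away (s i) ⊗[T] Localization.Away (s j)).toRingHom)
        ≫ p j) :
    ∃ g : Spec (CommRingCat.of T) ⟶ Y, ∀ i,
      Spec.map (CommRingCat.ofHom (algebraMap T (Localization.Away (s i)))) ≫ g = p i := by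
  let 𝒰 := (Scheme.affineOpenCoverOfSpanRangeEqTop (R := CommRingCat.of T) s hs).openCover
  have hp' (i j : ι) : Limits.pullback.fst (𝒰.f i) (𝒰.f j) ≫ p i =
      Limits.pullback.snd (𝒰.f i) (𝒰.f j) ≫ p j := by
    refine (cancel_epi (pullbackSpecIso T (Localization.Away (s i))
      (Localization.Away (s j))).inv).mp ?_
    have h₁ := pullbackSpecIso_inv_fst T (Localization.Away (s i)) (Localization.Away (s j))
    have h₂ := pullbackSpecIso_inv_snd T (Localization.Away (s i)) (Localization.Away (s j))
    refine ((Category.assoc _ _ _).symm.trans (congrArg (· ≫ p i) h₁)).trans ?_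
    refine Eq.trans ?_ ((Category.assoc _ _ _).symm.trans (congrArg (· ≫ p j) h₂)).symm
    exact hp i j
  exact ⟨𝒰.glueMorphisms p hp', fun i => 𝒰.ι_glueMorphisms p hp' i⟩

/-- The morphism is glued over the localizations at the `β H`. Stating its property for every `ψ`
that inverts some coordinate frees later arguments from the cover. -/
theorem exists_mk {β : A →+* T} (h : IsStable 𝒜 β) : ∃ g : Spec (CommRingCat.of T) ⟶ Proj 𝒜,
    ∀ (T' : Type) [CommRing T'] (ψ : T →+* T') (H : A) (hH : H ∈ 𝒜 1) (hu : IsUnit (ψ (β H))),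
      Spec.map (CommRingCat.ofHom ψ) ≫ g = pt 𝒜 (ψ.comp β) hH hu := by
  have hunit (H : 𝒜 1) : IsUnit (algebraMap T (Localization.Away (β H)) (β H)) :=
    IsLocalization.Away.algebraMap_isUnit _
  obtain ⟨g, hg⟩ := exists_glue h (fun H =>
    pt 𝒜 ((algebraMap T (Localization.Away (β H))).comp β) H.2 (hunit H)) fun H H' => by
      rw [comp_pt, comp_pt]
      have h₁ : ((algebraMap (Localization.Away (β H)) (Localization.Away (β H) ⊗[T]
          Localization.Away (β H'))).comp ((algebraMap T (Localization.Away (β H))).comp β)) =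
          ((Algebra.TensorProduct.includeRight : Localization.Away (β H') →ₐ[T]
            Localization.Away (β H) ⊗[T] Localization.Away (β H')).toRingHom.comp
            ((algebraMap T (Localization.Away (β H'))).comp β)) := by
        ext a
        exact ((Algebra.TensorProduct.includeLeft : Localization.Away (β H) →ₐ[T]
          Localization.Away (β H) ⊗[T] Localization.Away (β H')).commutes (β a)).trans
          ((Algebra.TensorProduct.includeRight : Localization.Away (β H') →ₐ[T]
            Localization.Away (β H) ⊗[T] Localization.Away (β H')).commutes (β a)).symm
      have h₂ := (hunit H').map ((Algebra.TensorProduct.includeRight :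
        Localization.Away (β H') →ₐ[T] Localization.Away (β H) ⊗[T]
          Localization.Away (β H')).toRingHom)
      refine (pt_eq_pt _ H.2 H'.2 _ ?_).trans ?_
      · rw [h₁]; exact h₂
      · congr 1
  refine ⟨g, fun T' _ ψ H hH hu => ?_⟩
  have h₁ : (IsLocalization.Away.lift (β H) hu).comp
      (algebraMap T (Localization.Away (β H))) = ψ := by
    ext t; simp
  have h₂ := congrArg (Spec.map (CommRingCat.ofHom (IsLocalization.Away.lift (β H) hu)) ≫ ·)
    (hg ⟨H, hH⟩)
  dsimp only at h₂
  rw [← Category.assoc, ← Spec.map_comp, ← CommRingCat.ofHom_comp, h₁, comp_pt] at h₂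
  rw [h₂]
  congr 1
  rw [← RingHom.comp_assoc, h₁]

/-- The morphism to `Proj` with given homogeneous coordinates. -/
noncomputable def mk {β : A →+* T} (h : IsStable 𝒜 β) : Spec (CommRingCat.of T) ⟶ Proj 𝒜 :=
  (exists_mk h).choose

theorem comp_mk_of_isUnit {β : A →+* T} (h : IsStable 𝒜 β) (ψ : T →+* T') {H : A} (hH : H ∈ 𝒜 1)
    (hu : IsUnit (ψ (β H))) :
    Spec.map (CommRingCat.ofHom ψ) ≫ mk h = pt 𝒜 (ψ.comp β) hH hu :=
  (exists_mk h).choose_spec T' ψ H hH hu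

theorem mk_eq_pt {β : A →+* T} (h : IsStable 𝒜 β) {H : A} (hH : H ∈ 𝒜 1) (hu : IsUnit (β H)) :
    mk h = pt 𝒜 β hH hu := by
  have := comp_mk_of_isUnit h (RingHom.id T) hH hu
  rwa [CommRingCat.ofHom_id, Spec.map_id, Category.id_comp] at this

theorem comp_mk {β : A →+* T} (h : IsStable 𝒜 β) (ψ : T →+* T') :
    Spec.map (CommRingCat.ofHom ψ) ≫ mk h = mk (h.comp ψ) := by
  refine (h.comp ψ).hom_ext fun T'' _ ψ' ⟨H, hH, hu⟩ => ?_
  rw [← Category.assoc, ← Spec.map_comp, ← CommRingCat.ofHom_comp,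
    comp_mk_of_isUnit h (ψ'.comp ψ) hH hu, comp_mk_of_isUnit (h.comp ψ) ψ' hH hu]
  rfl

omit [GradedAlgebra 𝒜] in
theorem IsStable.eq_zero {β : A →+* T} (h : IsStable 𝒜 β) {x : T}
    (hx : ∀ (T' : Type) [CommRing T'] (ψ : T →+* T'), (∃ H ∈ 𝒜 1, IsUnit (ψ (β H))) → ψ x = 0) :
    x = 0 := by
  by_contra hne
  have : LinearMap.ker (LinearMap.toSpanSingleton T T x) ≠ ⊤ := fun h => hne <| by
    have h₁ : (1 : T) ∈ LinearMap.ker (LinearMap.toSpanSingleton T T x) := by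
      rw [h]; trivial
    simpa using h₁
  obtain ⟨p, hp, hJ⟩ := Ideal.exists_le_maximal _ this
  refine hp.ne_top (top_le_iff.mp (h ▸ Ideal.span_le.mpr ?_))
  rintro _ ⟨H, rfl⟩
  obtain ⟨⟨_, n, rfl⟩, hn⟩ := (IsLocalization.map_eq_zero_iff (Submonoid.powers (β H))
    (Localization.Away (β H)) x).mp (hx _ _ ⟨H, H.2, IsLocalization.Away.algebraMap_isUnit _⟩)
  exact hp.isPrime.mem_of_pow_mem n (hJ (by
    rw [LinearMap.mem_ker, LinearMap.toSpanSingleton_apply, smul_eq_mul]; exact hn))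

theorem mk_congr {β β' : A →+* T} (h : IsStable 𝒜 β) (h' : IsStable 𝒜 β')
    (cross : ∀ n, ∀ F ∈ 𝒜 n, ∀ G ∈ 𝒜 n, β F * β' G = β G * β' F) : mk h = mk h' := by
  refine h.hom_ext fun T₁ _ ψ ⟨H, hH, hu⟩ => (h'.comp ψ).hom_ext fun T₂ _ ψ' ⟨H', hH', hu'⟩ => ?_
  rw [← Category.assoc, ← Category.assoc, ← Spec.map_comp, ← CommRingCat.ofHom_comp]
  have c := fun n F hF G hG => congrArg (ψ'.comp ψ) (cross n F hF G hG)
  simp only [map_mul] at c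
  have hu₂ : IsUnit (ψ'.comp ψ (β H)) := hu.map ψ'
  -- The cross relation in degree 1 reads `β H * β' H' = β H' * β' H`, and its left side has become
  -- a unit.
  have hv : IsUnit (ψ'.comp ψ (β' H)) := by
    refine isUnit_of_mul_isUnit_right (x := ψ'.comp ψ (β H')) ?_
    rw [← c 1 H hH H' hH']
    exact hu₂.mul hu'
  rw [comp_mk_of_isUnit h _ hH hu₂, comp_mk_of_isUnit h' _ hH hv, pt_eq_iff]
  intro n F hF
  have := c n F hF (H ^ n) (by simpa using SetLike.pow_mem_graded n hH)
  simp only [map_pow] at this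
  simp only [RingHom.comp_apply] at this ⊢
  rw [this, mul_comm]

/-- Points of `D₊(H)` have invertible coordinate `H`. -/
theorem isUnit_of_pt_eq {β β' : A →+* T} {H H' : A} (hH : H ∈ 𝒜 1) (hH' : H' ∈ 𝒜 1)
    (hu : IsUnit (β H)) (hu' : IsUnit (β' H')) (h : pt 𝒜 β hH hu = pt 𝒜 β' hH' hu') :
    IsUnit (β' H) := by
  by_contra hn
  obtain ⟨p, hp, hmem⟩ := exists_max_ideal_of_mem_nonunits hn
  -- The first description puts the image of `x` in `D₊(H)`; the second would put it outside,
  -- because `β' H ∈ p`.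
  let x : Spec (CommRingCat.of T) := ⟨p, hp.isPrime⟩
  have h₁ : (pt 𝒜 β hH hu) x ∈ Proj.basicOpen 𝒜 H := by
    rw [pt, Scheme.Hom.comp_apply, ← Proj.opensRange_awayι 𝒜 H hH one_pos]
    exact ⟨_, rfl⟩
  rw [h, pt, Scheme.Hom.comp_apply] at h₁
  have h₂ : (Spec.map (CommRingCat.ofHom (awayLift 𝒜 β' hu'))) x ∈
      Proj.awayι 𝒜 H' hH' one_pos ⁻¹ᵁ Proj.basicOpen 𝒜 H := h₁
  rw [Proj.awayι_preimage_basicOpen 𝒜 hH' one_pos hH one_pos] at h₂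
  refine h₂ ?_
  change awayLift 𝒜 β' hu' (HomogeneousLocalization.Away.mk 𝒜 hH' 1 (H ^ 1) _) ∈ p
  have h₃ := awayLift_mk_mul 𝒜 β' hu' hH' 1 (H ^ 1) (by simpa using hH)
  have h₄ : β' (H ^ 1) ∈ p := by rwa [pow_one]
  rw [← h₃] at h₄
  refine (hp.isPrime.mem_or_mem h₄).resolve_right fun h => ?_
  exact hp.ne_top (Ideal.eq_top_of_isUnit_mem _ h (hu'.pow 1))

theorem map_cross_eq_zero_of_mk_eq {β β' : A →+* T} (h : IsStable 𝒜 β) (h' : IsStable 𝒜 β')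
    (heq : mk h = mk h') {n : ℕ} {F G : A} (hF : F ∈ 𝒜 n) (hG : G ∈ 𝒜 n) {H H' : A}
    (hH : H ∈ 𝒜 1) (hH' : H' ∈ 𝒜 1) (χ : T →+* T') (hu₂ : IsUnit (χ (β H)))
    (hu' : IsUnit (χ (β' H'))) : χ (β F * β' G - β G * β' F) = 0 := by
  have e := congrArg (Spec.map (CommRingCat.ofHom χ) ≫ ·) heq
  rw [comp_mk_of_isUnit h χ hH hu₂, comp_mk_of_isUnit h' χ hH' hu'] at e
  have hv : IsUnit (χ (β' H)) :=
    isUnit_of_pt_eq (β := χ.comp β) (β' := χ.comp β') hH hH' hu₂ hu' e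
  have h₀ := e.trans (pt_eq_pt (χ.comp β') hH hH' hv hu').symm
  rw [pt_eq_iff] at h₀
  have h₁ := h₀ n F hF
  have h₂ := h₀ n G hG
  simp only [RingHom.comp_apply] at h₁ h₂
  rw [map_sub, sub_eq_zero, map_mul, map_mul]
  refine (hu₂.pow n).mul_right_cancel ?_
  linear_combination χ (β G) * h₁ - χ (β F) * h₂

/-- The converse of `mk_congr`: vanishing of the difference can be tested after inverting a
coordinate of each point, where both morphisms land in a common chart. -/
theorem cross_of_mk_eq {β β' : A →+* T} (h : IsStable 𝒜 β) (h' : IsStable 𝒜 β')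
    (heq : mk h = mk h') {n : ℕ} {F G : A} (hF : F ∈ 𝒜 n) (hG : G ∈ 𝒜 n) :
    β F * β' G = β G * β' F := by
  rw [← sub_eq_zero]
  refine h.eq_zero fun T₁ _ ψ ⟨H, hH, hu⟩ => (h'.comp ψ).eq_zero fun T₂ _ ψ' ⟨H', hH', hu'⟩ => ?_
  have hu₂ : IsUnit (ψ'.comp ψ (β H)) := hu.map ψ'
  have hu'₂ : IsUnit (ψ'.comp ψ (β' H')) := hu'
  rw [← RingHom.comp_apply ψ' ψ]
  exact map_cross_eq_zero_of_mk_eq h h' heq hF hG hH hH' (ψ'.comp ψ) hu₂ hu'₂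

/-- Compatibility with the structure morphisms. -/
theorem mk_toSpecZero {β : A →+* T} (h : IsStable 𝒜 β) :
    mk h ≫ Proj.toSpecZero 𝒜 = Spec.map (CommRingCat.ofHom (β.comp (algebraMap (𝒜 0) A))) := by
  refine h.hom_ext fun T' _ ψ ⟨H, hH, hu⟩ => ?_
  rw [← Category.assoc, comp_mk_of_isUnit h ψ hH hu, pt, Category.assoc,
    Proj.awayι_toSpecZero, ← Spec.map_comp, ← Spec.map_comp, ← CommRingCat.ofHom_comp,
    ← CommRingCat.ofHom_comp]
  congr 2
  ext a
  change awayLift 𝒜 (ψ.comp β) hu (HomogeneousLocalization.fromZeroRingHom 𝒜 _ a) = ψ (β a)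
  have h₁ := awayLift_mk_mul 𝒜 (ψ.comp β) hu hH 0 a (by simp)
  rw [pow_zero, mul_one] at h₁
  refine Eq.trans (congrArg _ ?_) h₁
  refine HomogeneousLocalization.val_injective _ ?_
  rw [HomogeneousLocalization.Away.val_mk]
  change Localization.mk (a : A) _ = _
  congr 1
  exact Subtype.ext (pow_zero H).symm

end ProjPoint

/-! ### The GIT quotient of an affine space by a torus -/

namespace ToricQuotient

variable {I σ : Type} [Fintype σ] (w : σ → I → ℤ) (η : I → ℤ)

/-- The pairs of an exponent `u` and a degree `n` such that the weight of `u` is `n • η`. -/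
def exponents : AddSubmonoid ((σ → ℕ) × ℕ) where
  carrier := {p | wt w p.1 = p.2 • η}
  zero_mem' := by simp
  add_mem' {p q} hp hq := by
    simp only [Set.mem_ofPred_eq, Prod.fst_add, Prod.snd_add, wt_add, add_smul] at hp hq ⊢
    rw [hp, hq]

/-- The ring of semi-invariants. -/
abbrev SemiInvariants : Type := AddMonoidAlgebra ℂ (exponents w η)

/-- The degree. -/
def degree : exponents w η →+ ℕ := (AddMonoidHom.snd (σ → ℕ) ℕ).comp (exponents w η).subtype

/-- The grading of the ring of semi-invariants. -/
abbrev grading : ℕ → Submodule ℂ (SemiInvariants w η) := AddMonoidAlgebra.gradeBy ℂ (degree w η)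

variable {w η}

/-- The semi-invariant monomials. -/
noncomputable def mono (u : σ → ℕ) (n : ℕ) (h : wt w u = n • η) : SemiInvariants w η :=
  AddMonoidAlgebra.single ⟨(u, n), h⟩ 1

theorem mono_mem (u : σ → ℕ) (n : ℕ) (h : wt w u = n • η) : mono u n h ∈ grading w η n :=
  AddMonoidAlgebra.single_mem_gradeBy (degree w η) ⟨(u, n), h⟩ 1

theorem mono_mul (u u' : σ → ℕ) (n n' : ℕ) (h : wt w u = n • η) (h' : wt w u' = n' • η) :
    mono u n h * mono u' n' h' = mono (u + u') (n + n') (by rw [wt_add, h, h', add_smul]) := by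
  refine (AddMonoidAlgebra.single_mul_single ..).trans ?_
  rw [mul_one]; rfl

theorem mono_pow (u : σ → ℕ) (n : ℕ) (h : wt w u = n • η) (k : ℕ) :
    mono u n h ^ k = mono (k • u) (k * n) (by rw [wt_nsmul, h, mul_smul]) := by
  refine (AddMonoidAlgebra.single_pow ..).trans ?_
  rw [one_pow]; rfl

theorem mem_grading_iff {n : ℕ} {F : SemiInvariants w η} : F ∈ grading w η n ↔
    ∀ s ∈ F.coeff.support, s.1.2 = n := Iff.rfl

theorem wt_exponent (s : exponents w η) : wt w s.1.1 = s.1.2 • η := s.2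

theorem eq_sum_mono (F : SemiInvariants w η) : F = ∑ s ∈ F.coeff.support,
    algebraMap ℂ _ (F.coeff s) * mono s.1.1 s.1.2 (wt_exponent s) := by
  refine (AddMonoidAlgebra.sum_coeff_single F).symm.trans (Finset.sum_congr rfl fun s _ => ?_)
  rw [← Algebra.smul_def]
  refine Eq.trans ?_ (AddMonoidAlgebra.smul_single ..).symm
  rw [smul_eq_mul, mul_one]

variable {T T' : Type} [CommRing T] [CommRing T']

/-- Evaluation of semi-invariants at a point of the affine space. -/
noncomputable def eval (φ : ℂ →+* T) (v : σ → T) : SemiInvariants w η →+* T :=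
  AddMonoidAlgebra.liftNCRingHom φ
    { toFun := fun s => monom v s.toAdd.1.1
      map_one' := monom_zero v
      map_mul' := fun _ _ => monom_add v _ _ } (fun _ _ => Commute.all _ _)

@[simp]
theorem eval_mono (φ : ℂ →+* T) (v : σ → T) (u : σ → ℕ) (n : ℕ) (h : wt w u = n • η) :
    eval φ v (mono u n h) = monom v u := by
  refine (AddMonoidAlgebra.liftNC_single _ _ _ _).trans ?_
  simp

@[simp]
theorem eval_algebraMap (φ : ℂ →+* T) (v : σ → T) (z : ℂ) :
    eval φ v (algebraMap ℂ (SemiInvariants w η) z) = φ z := by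
  refine (AddMonoidAlgebra.liftNC_single _ _ _ _).trans ?_
  refine (congrArg (φ z * ·) (monom_zero v)).trans (mul_one _)

theorem ringHom_ext {f g : SemiInvariants w η →+* T} (h₁ : ∀ z, f (algebraMap ℂ _ z) = g (algebraMap ℂ _ z))
    (h₂ : ∀ u n h, f (mono u n h) = g (mono u n h)) : f = g := by
  refine AddMonoidAlgebra.ringHom_ext (fun z => h₁ z) fun s => h₂ s.1.1 s.1.2 s.2

theorem comp_eval (ψ : T →+* T') (φ : ℂ →+* T) (v : σ → T) :
    ψ.comp (eval φ v : SemiInvariants w η →+* T) = eval (ψ.comp φ) (fun i => ψ (v i)) := by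
  refine ringHom_ext (fun z => ?_) fun u n h => ?_
  · rw [RingHom.comp_apply, eval_algebraMap, eval_algebraMap, RingHom.comp_apply]
  · rw [RingHom.comp_apply, eval_mono, eval_mono, map_monom]

theorem isStable_eval (φ : ℂ →+* T) (v : σ → T)
    (h : Ideal.span {r | ∃ u, wt w u = η ∧ r = monom v u} = ⊤) :
    ProjPoint.IsStable (grading w η) (eval φ v) := by
  refine top_le_iff.mp (h ▸ Ideal.span_le.mpr ?_)
  rintro _ ⟨u, hu, rfl⟩
  exact Ideal.subset_span ⟨⟨mono u 1 (by simpa using hu), mono_mem _ _ _⟩, eval_mono ..⟩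

section Chart

variable {c : σ → ℕ} (hc : IsChart w η c)

/-- The monomial of a chart. -/
noncomputable def chartMono : SemiInvariants w η := mono c 1 (by simpa using hc.1)

theorem chartMono_mem : chartMono hc ∈ grading w η 1 := mono_mem _ _ _

/-- The ring of functions on the slice `v_i = 1` for `i` in the support of `c`. -/
abbrev Slice (c : σ → ℕ) : Type := MvPolynomial {i // c i = 0} ℂ

open Classical in
/-- The universal point of the slice. -/
noncomputable def slicePoint (c : σ → ℕ) : σ → Slice c :=
  fun i => if h : c i = 0 then MvPolynomial.X ⟨i, h⟩ else 1

theorem monom_slicePoint (u : σ → ℕ) : monom (slicePoint c) u =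
    MvPolynomial.monomial (Finsupp.equivFunOnFinite.symm fun i : {i // c i = 0} => u i) 1 := by
  classical
  rw [MvPolynomial.monomial_eq, map_one, one_mul, Finsupp.prod_fintype _ _ (by simp), monom]
  have h₁ (i : σ) (hi : i ∉ Finset.univ.filter fun i => c i = 0) : slicePoint c i ^ u i = 1 := by
    have : c i ≠ 0 := by simpa using hi
    simp [slicePoint, this]
  rw [← Finset.prod_subset (Finset.subset_univ _) fun i _ hi => h₁ i hi,
    Finset.prod_subtype (p := fun i => c i = 0) _ (by simp)]
  refine Finset.prod_congr rfl fun i _ => ?_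
  simp [slicePoint, i.2]

theorem eval_chartMono : eval MvPolynomial.C (slicePoint c) (chartMono hc) = 1 := by
  classical
  rw [chartMono, eval_mono, monom]
  refine Finset.prod_eq_one fun i _ => ?_
  by_cases h : c i = 0 <;> simp [h, slicePoint]

theorem isUnit_eval_chartMono : IsUnit (eval MvPolynomial.C (slicePoint c) (chartMono hc)) := by
  rw [eval_chartMono]; exact isUnit_one

/-- The functions on the chart are those on the slice. -/
noncomputable def chartHom :
    HomogeneousLocalization.Away (grading w η) (chartMono hc) →+* Slice c :=
  ProjPoint.awayLift (grading w η) (eval MvPolynomial.C (slicePoint c)) (isUnit_eval_chartMono hc)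

theorem chartHom_mk (n : ℕ) (F : SemiInvariants w η) (hF : F ∈ grading w η (n • 1)) :
    chartHom hc (HomogeneousLocalization.Away.mk (grading w η) (chartMono_mem hc) n F hF) =
      eval MvPolynomial.C (slicePoint c) F := by
  have := ProjPoint.awayLift_mk_mul (grading w η) (eval MvPolynomial.C (slicePoint c))
    (isUnit_eval_chartMono hc) (chartMono_mem hc) n F hF
  rw [eval_chartMono, one_pow, mul_one] at this
  exact this

-- Two such exponents differ by a relation among the weights in the support of `c`, which form a
-- basis. So the exponents off that support and the degree determine the rest.
include hc in
theorem eq_of_restrict_eq {u u' : σ → ℕ} {n : ℕ} (h : wt w u = n • η) (h' : wt w u' = n • η)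
    (hr : ∀ i, c i = 0 → u i = u' i) : u = u' := by
  have h₁ : ∑ i, ((u i : ℤ) - u' i) • w i = 0 := by
    simp only [sub_smul, Finset.sum_sub_distrib, natCast_zsmul]
    exact sub_eq_zero.mpr (h.trans h'.symm)
  have h₂ := (hc.2 0).unique ⟨fun i hi => by rw [hr i hi, sub_self], h₁⟩
    (y₂ := 0) ⟨fun _ _ => rfl, by simp⟩
  ext i
  have := congrFun h₂ i
  simp only [Pi.zero_apply] at this
  omega

/-- Distinct monomials of one degree stay distinct on the slice, by `eq_of_restrict_eq`. -/
theorem chartHom_injective : Function.Injective (chartHom hc) := by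
  classical
  rw [injective_iff_map_eq_zero]
  intro x hx
  obtain ⟨n, F, hF, rfl⟩ := HomogeneousLocalization.Away.mk_surjective (grading w η)
    (chartMono_mem hc) x
  rw [chartHom_mk] at hx
  suffices h : F = 0 by
    refine HomogeneousLocalization.val_injective _ ?_
    rw [HomogeneousLocalization.Away.val_mk, h, Localization.mk_zero,
      HomogeneousLocalization.val_zero]
  by_contra hne
  obtain ⟨s, hs⟩ : F.coeff.support.Nonempty := by
    rw [Finset.nonempty_iff_ne_empty]
    intro h
    refine hne ?_
    rw [eq_sum_mono F, h, Finset.sum_empty]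
  rw [eq_sum_mono F, map_sum] at hx
  have h₁ := congrArg (MvPolynomial.coeff
    (Finsupp.equivFunOnFinite.symm fun i : {i // c i = 0} => s.1.1 i)) hx
  simp only [map_mul, eval_algebraMap, eval_mono, monom_slicePoint, MvPolynomial.coeff_sum,
    MvPolynomial.coeff_C_mul, MvPolynomial.coeff_monomial, MvPolynomial.coeff_zero] at h₁
  rw [Finset.sum_eq_single s] at h₁
  · simp only [if_true, mul_one] at h₁
    exact Finsupp.mem_support_iff.mp hs h₁
  · intro t ht hts
    rw [if_neg, mul_zero]
    intro h
    refine hts (Subtype.ext (Prod.ext ?_ ?_))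
    · have hd : t.1.2 = s.1.2 := (mem_grading_iff.mp hF t ht).trans (mem_grading_iff.mp hF s hs).symm
      refine eq_of_restrict_eq hc (n := s.1.2) (t.2.trans (by rw [hd])) s.2 fun i hi => ?_
      have := DFunLike.congr_fun h ⟨i, hi⟩
      simpa using this
    · exact (mem_grading_iff.mp hF t ht).trans (mem_grading_iff.mp hF s hs).symm
  · exact fun h => absurd hs h

/-- A slice coordinate `v_j` becomes a function on the chart after its weight is cancelled by the
chart variables, whose weights generate the lattice and whose values on the slice are 1. -/
theorem chartHom_surjective : Function.Surjective (chartHom hc) := by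
  classical
  intro p
  induction p using MvPolynomial.induction_on with
  | C z =>
    refine ⟨HomogeneousLocalization.Away.mk (grading w η) (chartMono_mem hc) 0
      (algebraMap ℂ _ z) ?_, ?_⟩
    · rw [zero_smul]; exact SetLike.algebraMap_mem_graded (grading w η) z
    · rw [chartHom_mk, eval_algebraMap]
  | add p q hp hq =>
    obtain ⟨x, rfl⟩ := hp
    obtain ⟨y, rfl⟩ := hq
    exact ⟨x + y, map_add _ _ _⟩
  | mul_X p j hp =>
    obtain ⟨x, rfl⟩ := hp
    obtain ⟨a, ⟨ha, haj⟩, -⟩ := hc.2 (w j)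
    -- Large enough for `k • c - a` to be nonnegative: `c i ≥ 1` on its support, and `a` vanishes
    -- elsewhere.
    let k : ℕ := ∑ i, (a i).natAbs
    have hk (i) : 0 ≤ (k : ℤ) * c i - a i := by
      by_cases hi : c i = 0
      · simp [hi, ha i hi]
      · have h₁ : (a i).natAbs ≤ k :=
          Finset.single_le_sum (f := fun i => (a i).natAbs) (fun _ _ => Nat.zero_le _)
            (Finset.mem_univ i)
        have h₂ : k * 1 ≤ k * c i := Nat.mul_le_mul_left k (Nat.pos_of_ne_zero hi)
        have h₃ : (k : ℤ) * 1 ≤ k * c i := by exact_mod_cast h₂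
        omega
    let u : σ → ℕ := fun i => ((k : ℤ) * c i - a i).toNat
    have hu : wt w u = k • η - w j := by
      rw [← hc.1, ← haj, wt, wt, Finset.smul_sum, ← Finset.sum_sub_distrib]
      refine Finset.sum_congr rfl fun i _ => ?_
      rw [← natCast_zsmul, Int.toNat_of_nonneg (hk i), sub_smul, mul_smul, natCast_zsmul,
        natCast_zsmul]
    refine ⟨x * HomogeneousLocalization.Away.mk (grading w η) (chartMono_mem hc) k
      (mono (Pi.single (j : σ) 1 + u) k (by rw [wt_add, wt_single, hu]; abel)) (by
        rw [smul_eq_mul, mul_one]; exact mono_mem _ _ _), ?_⟩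
    rw [map_mul, chartHom_mk, eval_mono, monom_add, monom_single]
    have h₁ : monom (slicePoint c) u = 1 := by
      refine Finset.prod_eq_one fun i _ => ?_
      by_cases hi : c i = 0
      · simp [u, hi, ha i hi]
      · simp [slicePoint, hi]
    rw [h₁, mul_one]
    simp [slicePoint, j.2]

variable (w η) in
/-- The quotient. -/
noncomputable abbrev quotient : Scheme.{0} := Proj (grading w η)

/-- The parametrization of a chart by the slice. -/
noncomputable def chart : Spec (CommRingCat.of (Slice c)) ⟶ quotient w η :=
  ProjPoint.pt (grading w η) (eval MvPolynomial.C (slicePoint c)) (chartMono_mem hc)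
    (isUnit_eval_chartMono hc)

instance isIso_chartHom : IsIso (CommRingCat.ofHom (chartHom hc)) :=
  (ConcreteCategory.isIso_iff_bijective _).mpr ⟨chartHom_injective hc, chartHom_surjective hc⟩

instance : IsOpenImmersion (chart hc) := by
  have h : IsIso (Spec.map (CommRingCat.ofHom (chartHom hc))) := inferInstance
  exact @IsOpenImmersion.comp _ _ _ _ _ (@IsOpenImmersion.of_isIso _ _ _ h) _

theorem opensRange_chart :
    (chart hc).opensRange = Proj.basicOpen (grading w η) (chartMono hc) := by
  refine Eq.trans ?_ (Proj.opensRange_awayι (grading w η) _ (chartMono_mem hc) one_pos)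
  have h : IsIso (Spec.map (CommRingCat.ofHom (chartHom hc))) := inferInstance
  exact @Scheme.Hom.opensRange_comp_of_isIso _ _ _ _ _ h _

end Chart

end ToricQuotient

/-! ### Smoothness, finiteness and integrality of the toric quotient. -/

namespace ToricQuotient

variable {I σ : Type} [Fintype σ] (w : σ → I → ℤ) (η : I → ℤ)

/-- The structure morphism of the quotient. -/
noncomputable def structureMap : quotient w η ⟶ Spec (CommRingCat.of ℂ) :=
  Proj.toSpecZero (grading w η) ≫
    Spec.map (CommRingCat.ofHom (algebraMap ℂ (grading w η 0)))

variable {w η} {T : Type} [CommRing T]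

theorem mk_structureMap {φ : ℂ →+* T} {v : σ → T}
    (h : ProjPoint.IsStable (grading w η) (eval φ v)) :
    ProjPoint.mk h ≫ structureMap w η = Spec.map (CommRingCat.ofHom φ) := by
  rw [structureMap, ← Category.assoc, ProjPoint.mk_toSpecZero, ← Spec.map_comp,
    ← CommRingCat.ofHom_comp]
  congr 2
  ext z
  exact eval_algebraMap φ v z

variable {c : σ → ℕ} (hc : IsChart w η c)

include hc in
theorem isStable_slicePoint :
    ProjPoint.IsStable (grading w η) (eval MvPolynomial.C (slicePoint c)) := by
  refine Ideal.eq_top_of_isUnit_mem _ (Ideal.subset_span ⟨⟨_, chartMono_mem hc⟩, rfl⟩)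
    (isUnit_eval_chartMono hc)

theorem chart_eq_mk : chart hc = ProjPoint.mk (isStable_slicePoint hc) :=
  (ProjPoint.mk_eq_pt _ _ _).symm

theorem chart_structureMap : chart hc ≫ structureMap w η =
    Spec.map (CommRingCat.ofHom (algebraMap ℂ (Slice c))) := by
  rw [chart_eq_mk, mk_structureMap]
  rfl

theorem mono_congr {u u' : σ → ℕ} {n n' : ℕ} {h : wt w u = n • η} {h' : wt w u' = n' • η}
    (hu : u = u') (hn : n = n') : mono u n h = mono u' n' h' := by
  subst hu hn; rfl

/-- A point outside all charts contains every chart monomial. Each monomial of positive degree has a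
power divisible by one of them, so the point would contain the irrelevant ideal. -/
theorem exists_chart (h : IsCharted w η) (x : quotient w η) :
    ∃ (c : σ → ℕ) (hc : IsChart w η c), x ∈ (chart hc).opensRange := by
  by_contra! hx
  simp only [opensRange_chart, Proj.mem_basicOpen, not_not] at hx
  refine x.not_irrelevant_le fun F hF => ?_
  have hdec (n : ℕ) (hn : 0 < n) (F : SemiInvariants w η) (hF : F ∈ grading w η n) :
      F ∈ x.asHomogeneousIdeal := by
    rw [eq_sum_mono F]
    refine sum_mem fun s hs => Ideal.mul_mem_left _ _ ?_
    have hs2 : s.1.2 = n := mem_grading_iff.mp hF s hs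
    obtain ⟨c, hc, hsc⟩ := h s.1.2 s.1.1 (hs2 ▸ hn) (wt_exponent s)
    obtain ⟨N, hN⟩ := exists_le_nsmul hsc
    have hcx := hx c hc
    -- The exponent `N + 1` is positive even for `N = 0`, so the subtraction of 1 from the degree is
    -- not truncated.
    have h₁ : mono s.1.1 s.1.2 (wt_exponent s) ^ (N + 1) = chartMono hc *
        mono ((N + 1) • s.1.1 - c) ((N + 1) * s.1.2 - 1) (by
          have hle : c ≤ (N + 1) • s.1.1 := hN.trans (by rw [succ_nsmul]; exact le_self_add)
          have hpos : 1 ≤ (N + 1) * s.1.2 := Nat.mul_pos (Nat.succ_pos _) (hs2 ▸ hn)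
          rw [wt_sub _ hle, wt_nsmul, wt_exponent, hc.1, smul_smul, sub_eq_iff_eq_add,
            ← succ_nsmul, Nat.sub_add_cancel hpos]) := by
      rw [mono_pow, chartMono, mono_mul]
      refine mono_congr ?_ ?_
      · exact (add_tsub_cancel_of_le (hN.trans (by rw [succ_nsmul]; exact le_self_add))).symm
      · exact (add_tsub_cancel_of_le (Nat.mul_pos (Nat.succ_pos _) (hs2 ▸ hn))).symm
    exact x.isPrime.mem_of_pow_mem (N + 1) (h₁ ▸ Ideal.mul_mem_right _ _ hcx)
  classical
  rw [← DirectSum.sum_support_decompose (grading w η) F]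
  refine sum_mem fun n hn => ?_
  refine hdec n (Nat.pos_of_ne_zero ?_) _ (SetLike.coe_mem _)
  rintro rfl
  refine (DFinsupp.mem_support_iff.mp hn) (Subtype.ext ?_)
  have h₁ : GradedRing.proj (grading w η) 0 F = 0 := hF
  rwa [GradedRing.proj_apply] at h₁

variable (w η) in
/-- The index type of the charts. -/
abbrev Charts : Type := {c : σ → ℕ // IsChart w η c}

/-- A chart is determined by the set where its exponent vanishes. -/
instance : Finite (Charts w η) := by
  classical
  refine Finite.of_injective (fun c : Charts w η => Finset.univ.filter fun i => c.1 i = 0) ?_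
  intro c c' h
  refine Subtype.ext (eq_of_restrict_eq c.2 (n := 1) (by simpa using c.2.1) (by simpa using c'.2.1)
    fun i hi => ?_)
  have h₁ : i ∈ Finset.univ.filter fun i => c.1 i = 0 := by simpa using hi
  have h₂ : i ∈ Finset.univ.filter fun i => c'.1 i = 0 := (Finset.ext_iff.mp h i).mp h₁
  rw [hi, (Finset.mem_filter.mp h₂).2]

/-- The cover by charts. -/
noncomputable def chartCover (h : IsCharted w η) : (quotient w η).AffineOpenCover where
  I₀ := Charts w η
  X c := CommRingCat.of (Slice c.1)
  f c := chart c.2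
  idx x := ⟨_, (exists_chart h x).choose_spec.choose⟩
  covers x := (exists_chart h x).choose_spec.choose_spec

theorem smooth_structureMap (h : IsCharted w η) : Smooth (structureMap w η) := by
  have : IsZariskiLocalAtSource.{0} @Smooth.{0} :=
    HasRingHomProperty.instIsZariskiLocalAtSource (P := @Smooth.{0}) (Q := RingHom.Smooth)
  refine (IsZariskiLocalAtSource.iff_of_openCover (P := @Smooth.{0})
    (chartCover h).openCover).mpr fun c => ?_
  change Smooth (chart c.2 ≫ structureMap w η)
  rw [chart_structureMap, HasRingHomProperty.Spec_iff (P := @Smooth.{0})]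
  change (algebraMap ℂ (Slice c.1)).Smooth
  rw [RingHom.smooth_algebraMap]
  exact ⟨inferInstance, inferInstance⟩

theorem isReduced_quotient (h : IsCharted w η) : AlgebraicGeometry.IsReduced (quotient w η) := by
  have (c : Charts w η) : AlgebraicGeometry.IsReduced ((chartCover h).openCover.X c) :=
    inferInstanceAs (AlgebraicGeometry.IsReduced (Spec (CommRingCat.of (Slice c.1))))
  exact @AlgebraicGeometry.IsReduced.of_openCover _ (chartCover h).openCover this

theorem compactSpace_quotient (h : IsCharted w η) : CompactSpace (quotient w η) := by
  rw [← isCompact_univ_iff]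
  have h₁ : (Set.univ : Set (quotient w η)) =
      ⋃ c : Charts w η, Set.range (chart c.2) := by
    refine (Set.eq_univ_of_forall fun x => ?_).symm
    obtain ⟨c, hc, hx⟩ := exists_chart h x
    exact Set.mem_iUnion.mpr ⟨⟨c, hc⟩, hx⟩
  rw [h₁]
  exact isCompact_iUnion fun c => isCompact_range (chart c.2).continuous

/-- The point with all coordinates 1 lies in every chart. This makes the union of the charts
irreducible. -/
theorem exists_mem_inter_range {c' : σ → ℕ} (hc' : IsChart w η c') :
    ∃ x, x ∈ Set.range (chart hc) ∧ x ∈ Set.range (chart hc') := by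
  let β : SemiInvariants w η →+* ℂ := eval (RingHom.id ℂ) (fun _ => 1)
  have hβ {c : σ → ℕ} (hc : IsChart w η c) : β (chartMono hc) = 1 := by
    rw [chartMono, eval_mono]; simp [monom]
  have key {c : σ → ℕ} (hc : IsChart w η c) (y : Spec (CommRingCat.of ℂ)) :
      ProjPoint.pt (grading w η) β (chartMono_mem hc) (by rw [hβ]; exact isUnit_one) y ∈
        Set.range (chart hc) := by
    have h₁ : ProjPoint.pt (grading w η) β (chartMono_mem hc) (by rw [hβ]; exact isUnit_one) y ∈
        (chart hc).opensRange := by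
      rw [opensRange_chart, ← Proj.opensRange_awayι (grading w η) _ (chartMono_mem hc) one_pos,
        ProjPoint.pt, Scheme.Hom.comp_apply]
      exact ⟨_, rfl⟩
    exact h₁
  obtain ⟨y⟩ : Nonempty (Spec (CommRingCat.of ℂ)) := inferInstance
  refine ⟨_, key hc y, ?_⟩
  rw [ProjPoint.pt_eq_pt β (chartMono_mem hc) (chartMono_mem hc')]
  exact key hc' y

theorem isIntegral_quotient (h : IsCharted w η) [hne : Nonempty (quotient w η)] :
    IsIntegral (quotient w η) := by
  have := isReduced_quotient h
  have hirr (c : Charts w η) : IsPreirreducible (Set.range (chart c.2)) := by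
    rw [← Set.image_univ]
    exact (PreirreducibleSpace.isPreirreducible_univ
      (X := Spec (CommRingCat.of (Slice c.1)))).image _ (chart c.2).continuous.continuousOn
  have : PreirreducibleSpace (quotient w η) := by
    refine ⟨fun U V hU hV ⟨x, _, hx⟩ ⟨y, _, hy⟩ => ?_⟩
    obtain ⟨c, hc, hxc⟩ := exists_chart h x
    obtain ⟨c', hc', hyc⟩ := exists_chart h y
    obtain ⟨z, hz, hz'⟩ := exists_mem_inter_range hc hc'
    -- Irreducibility of the first chart carries `U` into the second, where irreducibility makes it
    -- meet `V`.
    obtain ⟨z₁, hz₁, hz₁U, hz₁c⟩ := hirr ⟨c, hc⟩ U (Set.range (chart hc')) hU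
      (chart hc').isOpenEmbedding.isOpen_range ⟨x, hxc, hx⟩ ⟨z, hz, hz'⟩
    obtain ⟨z₂, hz₂, hz₂U, hz₂V⟩ := hirr ⟨c', hc'⟩ U V hU hV ⟨z₁, hz₁c, hz₁U⟩ ⟨y, hyc, hy⟩
    exact ⟨z₂, trivial, hz₂U, hz₂V⟩
  have : IrreducibleSpace (quotient w η) := { toNonempty := hne }
  exact isIntegral_of_irreducibleSpace_of_isReduced _

/-- The quotient is a smooth variety. -/
theorem isSmoothVariety (h : IsCharted w η) : IsSmoothVariety (structureMap w η) where
  smooth := smooth_structureMap h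
  separated := by
    rw [structureMap]; infer_instance
  quasiCompact := by
    have := compactSpace_quotient h
    exact quasiCompact_of_compactSpace _
  locallyOfFiniteType := by
    have := smooth_structureMap h
    infer_instance
  integral := fun _ => isIntegral_quotient h

end ToricQuotient

/-! ### Descent along the total space of a torsor -/

section Descent

variable {R S : Type} [CommRing R] [CommRing S] [Algebra R S] [Module.FaithfullyFlat R S]

theorem flat_and_surjective_spec : Flat (Spec.map (CommRingCat.ofHom (algebraMap R S))) ∧
    Surjective (Spec.map (CommRingCat.ofHom (algebraMap R S))) := by
  rw [flat_and_surjective_SpecMap_iff]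
  exact (RingHom.faithfullyFlat_algebraMap_iff).mpr ‹_›

theorem epi_spec_of_faithfullyFlat : Epi (Spec.map (CommRingCat.ofHom (algebraMap R S))) := by
  obtain ⟨_, _⟩ := flat_and_surjective_spec (R := R) (S := S)
  exact Flat.epi_of_flat_of_surjective _

/-- A faithfully flat morphism of affine schemes is a regular epimorphism, and its kernel pair is
the spectrum of `S ⊗[R] S`. -/
theorem exists_descent {Y : Scheme.{0}} (f : Spec (CommRingCat.of S) ⟶ Y)
    (h : Spec.map (CommRingCat.ofHom
        (Algebra.TensorProduct.includeLeft : S →ₐ[R] S ⊗[R] S).toRingHom) ≫ f =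
      Spec.map (CommRingCat.ofHom
        (Algebra.TensorProduct.includeRight : S →ₐ[R] S ⊗[R] S).toRingHom) ≫ f) :
    ∃ g, Spec.map (CommRingCat.ofHom (algebraMap R S)) ≫ g = f := by
  obtain ⟨_, _⟩ := flat_and_surjective_spec (R := R) (S := S)
  have := isRegularEpi_of_flat_of_surjective_of_isAffine
    (Spec.map (CommRingCat.ofHom (algebraMap R S)))
  exact IsRegularEpi.exists_of_isKernelPair _
    (isPullback_SpecMap_of_isPushout _ _ _ _ (CommRingCat.isPushout_tensorProduct R S S)) f h

end Descent

/-! ### Faithful flatness of the total space. -/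

namespace TorusTorsor

variable {I : Type} [Fintype I] {R : Type} [CommRing R] (N : TorusTorsor I R)

/-- The partition of unity exhibits the piece as a direct summand of `R ^ n`. -/
theorem flat_gr (χ : I → ℤ) : Module.Flat R (N.gr χ) := by
  classical
  obtain ⟨n, u, u', hu, hu', h⟩ := N.exists_sum_eq_one χ
  refine Module.Flat.of_retract (M := Fin n → R)
    { toFun := fun a k => N.base (a * u' k)
      map_add' := fun a b => funext fun k => by
        rw [Submodule.coe_add, add_mul, base_add (mul_mem_zero a.2 (hu' k))
          (mul_mem_zero b.2 (hu' k))]; rfl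
      map_smul' := fun r a => funext fun k => by
        rw [Submodule.coe_smul, Algebra.smul_def, mul_assoc, base_mul (N.algebraMap_mem r)
          (mul_mem_zero a.2 (hu' k)), base_algebraMap]; rfl }
    (∑ k, (LinearMap.toSpanSingleton R (N.gr χ) ⟨u k, hu k⟩).comp (LinearMap.proj k)) ?_
  refine LinearMap.ext fun a => Subtype.ext ?_
  have h₁ := congrArg (fun z => (a : N.carrier) * z) h
  simp only [mul_one, Finset.mul_sum] at h₁
  rw [LinearMap.comp_apply, LinearMap.sum_apply, LinearMap.id_apply, ← h₁, AddSubmonoidClass.coe_finsetSum]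
  refine Finset.sum_congr rfl fun k _ => ?_
  change (N.base (a * u' k)) • u k = _
  rw [Algebra.smul_def, algebraMap_base (mul_mem_zero a.2 (hu' k))]
  ring

theorem flat_carrier : Module.Flat R N.carrier := by
  classical
  have (χ : I → ℤ) : Module.Flat R (N.gr χ) := N.flat_gr χ
  exact Module.Flat.of_linearEquiv (DirectSum.decomposeLinearEquiv N.gr)

/-- If an ideal `J` generates the unit ideal upstairs, the degree zero retraction sends `1` into
`J`. -/
instance : Module.FaithfullyFlat R N.carrier := by
  rw [Module.FaithfullyFlat.iff_flat_and_proper_ideal]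
  refine ⟨N.flat_carrier, fun J hJ h => hJ ?_⟩
  obtain ⟨π, hπ⟩ := N.exists_retraction
  have h₁ : (1 : N.carrier) ∈ J • (⊤ : Submodule R N.carrier) := by
    rw [h]; exact Submodule.mem_top
  have h₂ := Submodule.mem_map_of_mem (f := π) h₁
  rw [Submodule.map_smul'', ← map_one (algebraMap R N.carrier), hπ] at h₂
  exact (Ideal.eq_top_iff_one _).mpr ((Submodule.smul_le.mpr fun r hr s _ => J.mul_mem_right s hr :
    J • Submodule.map π ⊤ ≤ J) h₂)

end TorusTorsor

/-! ### The classifying morphism of a torsor with a stable point. -/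

namespace ToricQuotient

variable {I σ : Type} [Fintype I] [Fintype σ] {w : σ → I → ℤ} {η : I → ℤ}

section Eval

variable {T : Type} [CommRing T] {φ φ' : ℂ →+* T} {v v' : σ → T}

omit [Fintype I] in
theorem eval_mul_eval_comm
    (h : ∀ (n : ℕ) u u', wt w u = n • η → wt w u' = n • η →
      monom v u * monom v' u' = monom v u' * monom v' u) (n : ℕ) {F G : SemiInvariants w η}
    (hF : F ∈ grading w η n) (hG : G ∈ grading w η n) :
    eval φ v F * eval φ v' G = eval φ v G * eval φ v' F := by
  rw [eq_sum_mono F, eq_sum_mono G]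
  simp only [map_sum, map_mul, eval_algebraMap, eval_mono, Finset.sum_mul, Finset.mul_sum]
  rw [Finset.sum_comm]
  refine Finset.sum_congr rfl fun s hs => Finset.sum_congr rfl fun t ht => ?_
  have h₁ := h n s.1.1 t.1.1 (by rw [wt_exponent, mem_grading_iff.mp hF s hs])
    (by rw [wt_exponent, mem_grading_iff.mp hG t ht])
  linear_combination φ (F.coeff s) * φ (G.coeff t) * h₁

omit [Fintype I] in
theorem mk_eval_congr (h : ProjPoint.IsStable (grading w η) (eval φ v))
    (h' : ProjPoint.IsStable (grading w η) (eval φ' v')) (hφ : φ = φ')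
    (cross : ∀ (n : ℕ) u u', wt w u = n • η → wt w u' = n • η →
      monom v u * monom v' u' = monom v u' * monom v' u) :
    ProjPoint.mk h = ProjPoint.mk h' := by
  subst hφ
  exact ProjPoint.mk_congr h h' fun n F hF G hG => eval_mul_eval_comm cross n hF hG

omit [Fintype I] in
theorem monom_cross_of_mk_eq (h : ProjPoint.IsStable (grading w η) (eval φ v))
    (h' : ProjPoint.IsStable (grading w η) (eval φ' v')) (heq : ProjPoint.mk h = ProjPoint.mk h')
    (n : ℕ) (u u' : σ → ℕ) (hu : wt w u = n • η) (hu' : wt w u' = n • η) :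
    monom v u * monom v' u' = monom v u' * monom v' u := by
  have := ProjPoint.cross_of_mk_eq h h' heq (mono_mem u n hu) (mono_mem u' n hu')
  simpa using this

omit [Fintype I] in
theorem comp_mk_eval {T' : Type} [CommRing T'] (h : ProjPoint.IsStable (grading w η) (eval φ v))
    (ψ : T →+* T') : ∃ h' : ProjPoint.IsStable (grading w η) (eval (ψ.comp φ) fun i => ψ (v i)),
      Spec.map (CommRingCat.ofHom ψ) ≫ ProjPoint.mk h = ProjPoint.mk h' := by
  rw [← comp_eval]
  exact ⟨_, ProjPoint.comp_mk h ψ⟩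

end Eval

section Classify

variable {R R' : Type} [CommRing R] [Algebra ℂ R] [CommRing R'] [Algebra ℂ R']
  {N : TorusTorsor I R} {v : σ → N.carrier} {N' : TorusTorsor I R'} {v' : σ → N'.carrier}

/-- The scalars in the functions on the total space. -/
noncomputable def scalars (N : TorusTorsor I R) : ℂ →+* N.carrier :=
  (algebraMap R N.carrier).comp (algebraMap ℂ R)

theorem isStable_total (hv : ∀ i, v i ∈ N.gr (w i)) (hN : stableIdeal w η N v = ⊤) :
    ProjPoint.IsStable (grading w η) (eval (scalars N) v) := by
  refine isStable_eval _ _ (top_le_iff.mp ?_)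
  rw [← Ideal.map_top (algebraMap R N.carrier), ← hN, stableIdeal, Ideal.map_span, Ideal.span_le]
  rintro _ ⟨_, ⟨u, hu, x, hx, rfl⟩, rfl⟩
  rw [algebraMap_base (mul_mem_zero (hu ▸ monom_mem hv u) hx)]
  exact Ideal.mul_mem_right _ _ (Ideal.subset_span ⟨u, hu, rfl⟩)

/-- The invariant map on the total space of a stable family. -/
noncomputable def totalMap (hv : ∀ i, v i ∈ N.gr (w i)) (hN : stableIdeal w η N v = ⊤) :
    Spec (CommRingCat.of N.carrier) ⟶ quotient w η :=
  ProjPoint.mk (isStable_total hv hN)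

-- The piece of degree `χ` is locally free of rank one, so tensors in it are symmetric. This is the
-- descent condition for ratios of elements of the same degree.
omit [Algebra ℂ R] in
theorem tmul_comm_of_mem {χ : I → ℤ} {a b : N.carrier} (ha : a ∈ N.gr χ) (hb : b ∈ N.gr χ) :
    a ⊗ₜ[R] b = b ⊗ₜ[R] a := by
  obtain ⟨n, u, u', hu, hu', h⟩ := N.exists_sum_eq_one χ
  have key (c : N.carrier) (hc : c ∈ N.gr χ) : c = ∑ k, N.base (c * u' k) • u k := by
    have h₁ := congrArg (fun z => c * z) h
    simp only [mul_one, Finset.mul_sum] at h₁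
    refine h₁.symm.trans (Finset.sum_congr rfl fun k _ => ?_)
    rw [Algebra.smul_def, algebraMap_base (mul_mem_zero hc (hu' k))]
    ring
  have h₂ (k) : N.base (a * u' k) • b = N.base (b * u' k) • a := by
    rw [Algebra.smul_def, Algebra.smul_def, algebraMap_base (mul_mem_zero ha (hu' k)),
      algebraMap_base (mul_mem_zero hb (hu' k))]
    ring
  conv_lhs => rw [key a ha]
  conv_rhs => rw [key b hb]
  rw [TensorProduct.sum_tmul, TensorProduct.sum_tmul]
  refine Finset.sum_congr rfl fun k _ => ?_
  rw [TensorProduct.smul_tmul, TensorProduct.smul_tmul, h₂]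

theorem exists_classify (hv : ∀ i, v i ∈ N.gr (w i)) (hN : stableIdeal w η N v = ⊤) :
    ∃ c, Spec.map (CommRingCat.ofHom (algebraMap R N.carrier)) ≫ c = totalMap hv hN := by
  apply exists_descent
  obtain ⟨h₁, e₁⟩ := comp_mk_eval (isStable_total hv hN)
    (Algebra.TensorProduct.includeLeft : N.carrier →ₐ[R] N.carrier ⊗[R] N.carrier).toRingHom
  obtain ⟨h₂, e₂⟩ := comp_mk_eval (isStable_total hv hN)
    (Algebra.TensorProduct.includeRight : N.carrier →ₐ[R] N.carrier ⊗[R] N.carrier).toRingHom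
  refine e₁.trans (Eq.trans ?_ e₂.symm)
  refine mk_eval_congr h₁ h₂ ?_ fun n u u' hu hu' => ?_
  · ext z
    exact (AlgHom.commutes (Algebra.TensorProduct.includeLeft :
      N.carrier →ₐ[R] N.carrier ⊗[R] N.carrier) _).trans (AlgHom.commutes
        (Algebra.TensorProduct.includeRight : N.carrier →ₐ[R] N.carrier ⊗[R] N.carrier) _).symm
  · rw [← map_monom, ← map_monom, ← map_monom, ← map_monom]
    have h := tmul_comm_of_mem (hu ▸ monom_mem hv u) (hu' ▸ monom_mem hv u')
    have l (a b : N.carrier) : a ⊗ₜ[R] (1 : N.carrier) * (1 : N.carrier) ⊗ₜ[R] b = a ⊗ₜ[R] b := by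
      rw [Algebra.TensorProduct.tmul_mul_tmul, one_mul, mul_one]
    exact (l _ _).trans (h.trans (l _ _).symm)

/-- The classifying morphism of a stable family. -/
noncomputable def classify (hv : ∀ i, v i ∈ N.gr (w i)) (hN : stableIdeal w η N v = ⊤) :
    Spec (CommRingCat.of R) ⟶ quotient w η :=
  (exists_classify hv hN).choose

theorem spec_classify (hv : ∀ i, v i ∈ N.gr (w i)) (hN : stableIdeal w η N v = ⊤) :
    Spec.map (CommRingCat.ofHom (algebraMap R N.carrier)) ≫ classify hv hN = totalMap hv hN :=
  (exists_classify hv hN).choose_spec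

theorem eq_classify (hv : ∀ i, v i ∈ N.gr (w i)) (hN : stableIdeal w η N v = ⊤)
    {c : Spec (CommRingCat.of R) ⟶ quotient w η}
    (h : Spec.map (CommRingCat.ofHom (algebraMap R N.carrier)) ≫ c = totalMap hv hN) :
    classify hv hN = c := by
  have := epi_spec_of_faithfullyFlat (R := R) (S := N.carrier)
  rw [← cancel_epi (Spec.map (CommRingCat.ofHom (algebraMap R N.carrier))), h, spec_classify]

theorem classify_structureMap (hv : ∀ i, v i ∈ N.gr (w i)) (hN : stableIdeal w η N v = ⊤) :
    classify hv hN ≫ structureMap w η = specStr R := by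
  have := epi_spec_of_faithfullyFlat (R := R) (S := N.carrier)
  rw [← cancel_epi (Spec.map (CommRingCat.ofHom (algebraMap R N.carrier))), ← Category.assoc,
    spec_classify, totalMap, mk_structureMap, specStr, ← Spec.map_comp, ← CommRingCat.ofHom_comp]
  rfl

theorem classify_of_hom (hv : ∀ i, v i ∈ N.gr (w i)) (hN : stableIdeal w η N v = ⊤)
    (hv' : ∀ i, v' i ∈ N'.gr (w i)) (hN' : stableIdeal w η N' v' = ⊤) (φ : R →ₐ[ℂ] R')
    (f : Hom (φ : R →+* R') N N') (hf : ∀ i, f.map (v i) = v' i) :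
    classify hv' hN' = Spec.map (CommRingCat.ofHom (φ : R →+* R')) ≫ classify hv hN := by
  apply eq_classify
  have h₁ : (algebraMap R' N'.carrier).comp (φ : R →+* R') =
      f.map.comp (algebraMap R N.carrier) := RingHom.ext fun r => (f.map_base r).symm
  rw [← Category.assoc, ← Spec.map_comp, ← CommRingCat.ofHom_comp, h₁, CommRingCat.ofHom_comp,
    Spec.map_comp, Category.assoc, spec_classify, totalMap, totalMap]
  obtain ⟨h₂, e₂⟩ := comp_mk_eval (isStable_total hv hN) f.map
  refine e₂.trans (mk_eval_congr _ _ ?_ fun n u u' hu hu' => ?_)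
  · ext z
    refine (f.map_base _).trans ?_
    exact congrArg _ (φ.commutes z)
  · simp only [hf]; rw [mul_comm]

theorem existsUnique_hom_of_classify (hw : SpansLattice w η) (hv : ∀ i, v i ∈ N.gr (w i))
    (hN : stableIdeal w η N v = ⊤)
    (hv' : ∀ i, v' i ∈ N'.gr (w i)) (hN' : stableIdeal w η N' v' = ⊤) (φ : R →ₐ[ℂ] R')
    (h : classify hv' hN' = Spec.map (CommRingCat.ofHom (φ : R →+* R')) ≫ classify hv hN) :
    ∃! f : Hom (φ : R →+* R') N N', ∀ i, f.map (v i) = v' i := by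
  refine existsUnique_hom hw hv hv' (by rw [hN, Ideal.map_top]) hN' fun n u u' hu hu' x hx => ?_
  let : Algebra R N'.carrier := ((algebraMap R' N'.carrier).comp (φ : R →+* R')).toAlgebra
  -- The product of the two total spaces over `Spec R'`, where both coefficient vectors are
  -- functions. Equality of the classifying morphisms gives the cross relation there, and it
  -- descends because `N'.carrier` embeds in `B`.
  let B := N.baseChange N'.carrier
  let j := N.toBaseChange N'.carrier
  let q : N'.carrier →+* B.carrier := algebraMap N'.carrier B.carrier
  have hjq (r : R) : j.map (algebraMap R N.carrier r) = q (algebraMap R' N'.carrier (φ r)) :=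
    j.map_base r
  obtain ⟨h₁, e₁⟩ := comp_mk_eval (isStable_total hv hN) j.map
  obtain ⟨h₂, e₂⟩ := comp_mk_eval (isStable_total hv' hN') q
  have e : ProjPoint.mk h₁ = ProjPoint.mk h₂ := by
    rw [← e₁, ← e₂]
    change _ ≫ totalMap hv hN = _ ≫ totalMap hv' hN'
    rw [← spec_classify, ← spec_classify, h, ← Category.assoc, ← Category.assoc, ← Category.assoc,
      ← Spec.map_comp, ← Spec.map_comp, ← Spec.map_comp, ← CommRingCat.ofHom_comp,
      ← CommRingCat.ofHom_comp, ← CommRingCat.ofHom_comp]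
    congr 3
    exact RingHom.ext hjq
  apply B.algebraMap_injective
  change q _ = q _
  have cross := monom_cross_of_mk_eq h₁ h₂ e n u u' hu hu'
  have hm (t : σ → ℕ) (ht : wt w t = n • η) : q (algebraMap R' N'.carrier (φ (N.base (monom v t * x)))) =
      monom (fun i => j.map (v i)) t * j.map x := by
    rw [← hjq, algebraMap_base (mul_mem_zero (ht ▸ monom_mem hv t) hx), map_mul, map_monom]
  have hm' (t : σ → ℕ) : q (monom v' t) = monom (fun i => q (v' i)) t := map_monom q v' t
  rw [map_mul, map_mul]
  refine (congrArg₂ (· * ·) (hm u hu) (hm' u')).trans (Eq.trans ?_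
    (congrArg₂ (· * ·) (hm u' hu') (hm' u)).symm)
  linear_combination j.map x * cross

end Classify

end ToricQuotient

namespace ToricQuotient

variable {I σ : Type} [Fintype I] [Fintype σ] {w : σ → I → ℤ} {η : I → ℤ}

/-! ### Existence of a family with a given classifying morphism -/

section Transition

variable {T : Type} [CommRing T] {v v' : σ → T}

theorem stableIdeal_trivial (h : Ideal.span {r | ∃ u, wt w u = η ∧ r = monom v u} = ⊤) :
    stableIdeal w η (trivial I T) (fun i => gen (w i) (v i)) = ⊤ := by
  refine top_le_iff.mp (h ▸ Ideal.span_le.mpr ?_)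
  rintro _ ⟨u, hu, rfl⟩
  refine Ideal.subset_span ⟨u, hu, gen (-η) 1, gen_mem _ _, ?_⟩
  have h₁ : monom (fun i => gen (w i) (v i)) u * gen (-η) (1 : T) = gen 0 (monom v u) := by
    rw [monom_gen, gen_mul_gen, hu, add_neg_cancel, mul_one]
  exact ((congrArg (trivial I T).base h₁).trans (base_gen _)).symm

/-- A morphism of trivial torsors over a fixed base is a `T`-valued point `g` of `G`. So stable
points with the same ratios of semi-invariants lie in one orbit, with trivial stabilizer. -/
theorem existsUnique_transition (hw : SpansLattice w η)
    (h : Ideal.span {r | ∃ u, wt w u = η ∧ r = monom v u} = ⊤)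
    (h' : Ideal.span {r | ∃ u, wt w u = η ∧ r = monom v' u} = ⊤)
    (cross : ∀ (n : ℕ) u u', wt w u = n • η → wt w u' = n • η →
      monom v u * monom v' u' = monom v u' * monom v' u) :
    ∃! g : Multiplicative (I → ℤ) →* T, ∀ i, g (Multiplicative.ofAdd (w i)) * v i = v' i := by
  have hbase (u : σ → ℕ) (ω : I → ℤ) (hu : wt w u = ω) (b : T) :
      (trivial I T).base (monom (fun i => gen (w i) (v i)) u * gen (-ω) b) = monom v u * b := by
    have h₁ : monom (fun i => gen (w i) (v i)) u * gen (-ω) b = gen 0 (monom v u * b) := by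
      rw [monom_gen, gen_mul_gen, hu, add_neg_cancel]
    exact (congrArg (trivial I T).base h₁).trans (base_gen _)
  obtain ⟨f, hf, huniq⟩ := existsUnique_hom (φ := RingHom.id T) (N := trivial I T)
    (N' := trivial I T) hw (fun i => gen_mem (w i) (v i)) (fun i => gen_mem (w i) (v' i))
    (by rw [stableIdeal_trivial h, Ideal.map_top]) (stableIdeal_trivial h') (by
      intro n u u' hu hu' x hx
      obtain ⟨b, rfl⟩ := exists_eq_gen hx
      refine (congrArg₂ (fun r z => algebraMap T (trivial I T).carrier r * z)
        (hbase u _ hu b) (monom_gen w v' u')).trans (Eq.trans ?_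
        (congrArg₂ (fun r z => algebraMap T (trivial I T).carrier r * z)
        (hbase u' _ hu' b) (monom_gen w v' u)).symm)
      refine (algebraMap_mul_gen _ _ _).trans (Eq.trans ?_ (algebraMap_mul_gen _ _ _).symm)
      rw [hu, hu']
      exact congrArg _ (by linear_combination b * cross n u u' hu hu'))
  have hg (χ : I → ℤ) : ∃ g : T, f.map (gen χ 1) = gen χ g :=
    exists_eq_gen (f.map_gr _ _ (gen_mem χ 1))
  choose g hg using hg
  have hgb (χ : I → ℤ) (b : T) : f.map (gen χ b) = gen χ (g χ * b) := by
    have h₁ : gen χ b = algebraMap T (trivial I T).carrier b * gen χ 1 := by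
      rw [algebraMap_mul_gen, mul_one]
    refine (congrArg f.map h₁).trans ((map_mul f.map _ _).trans ?_)
    refine (congrArg₂ (· * ·) (f.map_base b) (hg χ)).trans ((algebraMap_mul_gen _ _ _).trans ?_)
    rw [mul_comm]; rfl
  refine ⟨⟨⟨fun χ => g χ.toAdd, ?_⟩, ?_⟩, fun i => ?_, fun g' hg' => ?_⟩
  · apply gen_injective (I := I) 0
    refine (hg 0).symm.trans ((map_one f.map).trans rfl)
  · intro χ ψ
    apply gen_injective (χ.toAdd + ψ.toAdd)
    refine (hg _).symm.trans ?_
    have h₁ : gen (χ.toAdd + ψ.toAdd) (1 : T) = gen χ.toAdd 1 * gen ψ.toAdd 1 := by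
      rw [gen_mul_gen, mul_one]
    refine (congrArg f.map h₁).trans ((map_mul f.map _ _).trans ?_)
    exact (congrArg₂ (· * ·) (hg _) (hg _)).trans (gen_mul_gen _ _ _ _)
  · apply gen_injective (w i)
    exact (hgb (w i) (v i)).symm.trans (hf i)
  · have h₁ := huniq (trivialHom (RingHom.id T) g') fun i => by
      refine (trivialHom_gen _ _ _ _).trans ?_
      rw [RingHom.id_apply, mul_comm, hg']
    refine MonoidHom.ext fun χ => ?_
    apply gen_injective χ.toAdd
    refine Eq.trans ?_ (hg χ.toAdd)
    rw [← h₁]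
    refine Eq.trans ?_ (trivialHom_gen _ _ _ _).symm
    rw [RingHom.id_apply, one_mul]
    rfl

end Transition

omit [Fintype I] in
theorem span_monom_map {S T : Type} [CommRing S] [CommRing T] {v : σ → S}
    (h : Ideal.span {r | ∃ u, wt w u = η ∧ r = monom v u} = ⊤) (ψ : S →+* T) :
    Ideal.span {r | ∃ u, wt w u = η ∧ r = monom (fun i => ψ (v i)) u} = ⊤ := by
  rw [← Ideal.map_top ψ, ← h, Ideal.map_span]
  congr 1
  ext r
  constructor
  · rintro ⟨u, hu, rfl⟩
    exact ⟨_, ⟨u, hu, rfl⟩, map_monom ψ v u⟩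
  · rintro ⟨_, ⟨u, hu, rfl⟩, rfl⟩
    exact ⟨u, hu, map_monom ψ v u⟩

section Descend

variable {R S : Type} [CommRing R] [CommRing S] [Algebra R S] [Module.FaithfullyFlat R S]
  {v : σ → S}

/-- Descent of a point of the trivial torsor to a point of a torsor. -/
theorem exists_descended_point (hw : SpansLattice w η)
    (h : Ideal.span {r | ∃ u, wt w u = η ∧ r = monom v u} = ⊤)
    (cross : ∀ (n : ℕ) u u', wt w u = n • η → wt w u' = n • η →
      monom v u ⊗ₜ[R] monom v u' = monom v u' ⊗ₜ[R] monom v u) :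
    ∃ (N : TorusTorsor I R) (b : σ → N.carrier) (f : Hom (algebraMap R S) N (trivial I S)),
      (∀ i, b i ∈ N.gr (w i)) ∧ stableIdeal w η N b = ⊤ ∧ ∀ i, f.map (b i) = gen (w i) (v i) := by
  let L : S →ₐ[R] S ⊗[R] S := Algebra.TensorProduct.includeLeft
  let Rt : S →ₐ[R] S ⊗[R] S := Algebra.TensorProduct.includeRight
  let p₁₂ : S ⊗[R] S →ₐ[R] S ⊗[R] (S ⊗[R] S) := Algebra.TensorProduct.map (AlgHom.id R S) L
  let p₁₃ : S ⊗[R] S →ₐ[R] S ⊗[R] (S ⊗[R] S) := Algebra.TensorProduct.map (AlgHom.id R S) Rt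
  let p₂₃ : S ⊗[R] S →ₐ[R] S ⊗[R] (S ⊗[R] S) := Algebra.TensorProduct.includeRight
  have hmul (a b : S) : L a * Rt b = a ⊗ₜ[R] b := by
    change a ⊗ₜ[R] (1 : S) * (1 : S) ⊗ₜ[R] b = _
    rw [Algebra.TensorProduct.tmul_mul_tmul, one_mul, mul_one]
  have cross₂ (n : ℕ) (u u' : σ → ℕ) (hu : wt w u = n • η) (hu' : wt w u' = n • η) :
      monom (fun i => L (v i)) u * monom (fun i => Rt (v i)) u' =
        monom (fun i => L (v i)) u' * monom (fun i => Rt (v i)) u := by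
    rw [← map_monom, ← map_monom, ← map_monom, ← map_monom, hmul, hmul, cross n u u' hu hu']
  obtain ⟨g, hg, -⟩ := existsUnique_transition (v := fun i => L (v i)) (v' := fun i => Rt (v i)) hw
    (span_monom_map h L.toRingHom) (span_monom_map h Rt.toRingHom) cross₂
  -- the cocycle condition
  have cocycle (χ) : p₁₃ (g χ) = p₂₃ (g χ) * p₁₂ (g χ) := by
    have e₁ (s : S) : p₁₃ (L s) = p₁₂ (L s) := by
      change (AlgHom.id R S s) ⊗ₜ[R] Rt 1 = (AlgHom.id R S s) ⊗ₜ[R] L 1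
      rw [map_one, map_one]
    have e₂ (s : S) : p₁₃ (Rt s) = p₂₃ (Rt s) := rfl
    have e₃ (s : S) : p₁₂ (Rt s) = p₂₃ (L s) := rfl
    -- Both sides carry the first copy of `v` to the third, so uniqueness of the transition
    -- identifies them.
    have hu := (existsUnique_transition (v := fun i => p₁₃ (L (v i)))
      (v' := fun i => p₁₃ (Rt (v i))) hw
      (span_monom_map h (p₁₃.comp L).toRingHom) (span_monom_map h (p₁₃.comp Rt).toRingHom)
      fun n u u' hu hu' => by
        have := congrArg p₁₃ (cross₂ n u u' hu hu')
        rwa [map_mul, map_mul, map_monom, map_monom, map_monom, map_monom] at this).unique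
      (y₁ := (p₁₃ : S ⊗[R] S →* _).comp g)
      (y₂ := (p₂₃ : S ⊗[R] S →* _).comp g * (p₁₂ : S ⊗[R] S →* _).comp g)
      (fun i => by
        change p₁₃ (g _) * _ = _
        rw [← map_mul, hg])
      (fun i => by
        change p₂₃ (g _) * p₁₂ (g _) * _ = _
        rw [e₁, mul_assoc, ← map_mul, hg, e₃, ← map_mul, hg, e₂])
    exact DFunLike.congr_fun hu χ
  let F₂ (χ : I → ℤ) : S →ₗ[R] S ⊗[R] S :=
    (LinearMap.mulLeft R (g (Multiplicative.ofAdd χ))).comp L.toLinearMap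
  -- The pieces of the descended torsor: elements whose two pullbacks to `S ⊗[R] S` differ by the
  -- cocycle `g χ`.
  let M (χ : I → ℤ) : Submodule R S := LinearMap.eqLocus Rt.toLinearMap (F₂ χ)
  have hM (χ) (s : S) : s ∈ M χ ↔ Rt s = g (Multiplicative.ofAdd χ) * L s := Iff.rfl
  have one : 1 ∈ M 0 := by
    rw [hM, ofAdd_zero, map_one, map_one, map_one, mul_one]
  have mul (χ ψ) (a) (ha : a ∈ M χ) (b) (hb : b ∈ M ψ) : a * b ∈ M (χ + ψ) := by
    rw [hM] at ha hb ⊢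
    rw [ofAdd_add, map_mul, map_mul, map_mul, ha, hb]; ring
  have zero : M 0 ≤ 1 := by
    intro s hs
    rw [hM, ofAdd_zero, map_one, one_mul] at hs
    rw [Submodule.mem_one]
    have := (Algebra.IsEffective.of_faithfullyFlat R S).eqLocus_includeLeft_includeRight
    exact this.subset hs.symm
  have inj : Function.Injective (algebraMap R S) := FaithfulSMul.algebraMap_injective R S
  -- The cocycle condition says that `g χ` itself lies in the equalizer defining `M χ` after
  -- tensoring with `S`. By flatness it comes from `S ⊗[R] M χ`, which proves that `M χ` is large
  -- enough.
  have key (χ) : ∃ z : S ⊗[R] M χ, LinearMap.lTensor S (M χ).subtype z =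
      g (Multiplicative.ofAdd χ) := by
    have h₁ := Module.Flat.eqLocus_lTensor_eq R S Rt.toLinearMap (F₂ χ)
    have h₂ : g (Multiplicative.ofAdd χ) ∈ LinearMap.eqLocus
        (TensorProduct.AlgebraTensorModule.lTensor R S Rt.toLinearMap)
        (TensorProduct.AlgebraTensorModule.lTensor R S (F₂ χ)) := by
      change LinearMap.lTensor S Rt.toLinearMap _ = LinearMap.lTensor S (F₂ χ) _
      have e₁ (t : S ⊗[R] S) : LinearMap.lTensor S Rt.toLinearMap t = p₁₃ t := rfl
      have e₂ (t : S ⊗[R] S) : LinearMap.lTensor S (F₂ χ) t =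
          p₂₃ (g (Multiplicative.ofAdd χ)) * p₁₂ t := by
        induction t with
        | zero => simp
        | add x y hx hy => rw [map_add, map_add, mul_add, hx, hy]
        | tmul x y =>
          change x ⊗ₜ[R] (g (Multiplicative.ofAdd χ) * L y) =
            (1 : S) ⊗ₜ[R] (g (Multiplicative.ofAdd χ)) * (x ⊗ₜ[R] L y)
          rw [Algebra.TensorProduct.tmul_mul_tmul, one_mul]
      rw [e₁, e₂, cocycle]
    rw [h₁] at h₂
    exact h₂
  have generate (χ) : ∃ (ι : Type) (_ : Fintype ι) (s a : ι → S), (∀ k, a k ∈ M χ) ∧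
      ∑ k, s k ⊗ₜ[R] a k = g (Multiplicative.ofAdd χ) := by
    obtain ⟨z, hz⟩ := key χ
    obtain ⟨s, rfl⟩ := TensorProduct.exists_finset z
    refine ⟨s, inferInstance, fun k => k.1.1, fun k => k.1.2, fun k => k.1.2.2, ?_⟩
    rw [← hz, map_sum]
    exact Finset.sum_coe_sort s fun k => k.1 ⊗ₜ[R] (k.2 : S)
  have unitS (χ) : ∃ (ι : Type) (_ : Fintype ι) (s a b : ι → S), (∀ k, a k ∈ M χ) ∧ (∀ k, b k ∈ M (-χ)) ∧
      ∑ k, s k * (a k * b k) = 1 := by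
    obtain ⟨n, _, s, a, ha, hs⟩ := generate χ
    obtain ⟨n', _, s', b, hb, hs'⟩ := generate (-χ)
    -- Multiplying out the tensors in this identity shows that `M χ * M (-χ)` generates the unit
    -- ideal of `S`. Faithful flatness then brings `1` down to `R`.
    have h₁ : g (Multiplicative.ofAdd χ) * g (Multiplicative.ofAdd (-χ)) = 1 := by
      rw [← map_mul, ← ofAdd_add, add_neg_cancel, ofAdd_zero, map_one]
    have h₂ := congrArg (Algebra.TensorProduct.lmul' R (S := S)) h₁
    rw [← hs, ← hs', map_mul, map_sum, map_sum, map_one, Finset.sum_mul_sum,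
      ← Finset.sum_product'] at h₂
    refine ⟨n × n', inferInstance, fun k => s k.1 * s' k.2, fun k => a k.1,
      fun k => b k.2, fun k => ha _, fun k => hb _, ?_⟩
    rw [← h₂]
    refine Finset.sum_congr (by simp) fun k _ => ?_
    rw [Algebra.TensorProduct.lmul'_apply_tmul, Algebra.TensorProduct.lmul'_apply_tmul]
    ring
  have unit (χ) : 1 ∈ M χ * M (-χ) := by
    let J : Ideal R := (M χ * M (-χ)).comap (Algebra.linearMap R S)
    suffices hJ : J = ⊤ by
      have h₁ : (1 : R) ∈ J := hJ ▸ Submodule.mem_top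
      have h₂ : algebraMap R S 1 ∈ M χ * M (-χ) := h₁
      rwa [map_one] at h₂
    apply Ideal.map_injective_of_faithfullyFlat (B := S)
    rw [Ideal.map_top, Ideal.eq_top_iff_one]
    obtain ⟨n, _, s, a, b, ha, hb, hs⟩ := unitS χ
    rw [← hs]
    refine sum_mem fun k _ => Ideal.mul_mem_left _ _ ?_
    have h₀ : a k * b k ∈ M 0 := by
      have := mul _ _ _ (ha k) _ (hb k); rwa [add_neg_cancel] at this
    obtain ⟨r, hr⟩ := Submodule.mem_one.mp (zero h₀)
    rw [← hr]
    refine Ideal.mem_map_of_mem _ ?_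
    change algebraMap R S r ∈ M χ * M (-χ)
    rw [hr]
    exact Submodule.mul_mem_mul (ha k) (hb k)
  obtain ⟨N, f, hfb, hfM, hfs, hfi⟩ := exists_ofPieces M one mul zero inj unit
  have hvM (i) : v i ∈ M (w i) := (hM _ _).mpr (hg i).symm
  choose b hb hbv using fun i => hfs (w i) (v i) (hvM i)
  obtain ⟨F, hF⟩ := exists_ringHom (P := N) (S := (trivial I S).carrier)
    (fun χ a => gen χ (f a))
    (fun χ a _ b _ => by
      refine (congrArg (gen χ) (map_add f a b)).trans ?_
      exact AddMonoidAlgebra.single_add ..)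
    (by
      refine (congrArg (gen 0) (map_one f)).trans rfl)
    (fun χ ψ a _ b _ => by
      refine (congrArg (gen (χ + ψ)) (map_mul f a b)).trans ?_
      exact (gen_mul_gen ..).symm)
  refine ⟨N, b, ⟨F, fun r => ?_, fun χ a ha => ?_⟩, hb, ?_, fun i => ?_⟩
  · rw [hF 0 _ (N.algebraMap_mem r), hfb]; rfl
  · rw [hF χ a ha]; exact gen_mem _ _
  · apply Ideal.map_injective_of_faithfullyFlat (B := S)
    rw [Ideal.map_top, eq_top_iff, ← h, Ideal.span_le]
    rintro _ ⟨u, hu, rfl⟩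
    obtain ⟨n, _, s, a, c, ha, hc, hs⟩ := unitS η
    have h₁ := congrArg (fun z => monom v u * z) hs
    simp only [mul_one, Finset.mul_sum] at h₁
    change monom v u ∈ Ideal.map (algebraMap R S) (stableIdeal w η N b)
    rw [← h₁]
    refine sum_mem fun k _ => ?_
    obtain ⟨x, hx, hxc⟩ := hfs _ _ (hc k)
    have h₂ : monom v u * (s k * (a k * c k)) =
        s k * a k * algebraMap R S (N.base (monom b u * x)) := by
      rw [← hfb, algebraMap_base (mul_mem_zero (hu ▸ monom_mem hb u) hx), map_mul, map_monom, hxc]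
      simp only [hbv]
      ring
    rw [h₂]
    exact Ideal.mul_mem_left _ _ (Ideal.mem_map_of_mem _ (Ideal.subset_span ⟨u, hu, x, hx, rfl⟩))
  · change F (b i) = _
    rw [hF _ _ (hb i), hbv]

end Descend

end ToricQuotient

/-! ### Finite Zariski covers as faithfully flat algebras, and surjectivity of classification. -/

theorem flat_pi {R ι : Type} [CommRing R] [Finite ι] (S : ι → Type) [∀ i, AddCommGroup (S i)]
    [∀ i, Module R (S i)] [∀ i, Module.Flat R (S i)] : Module.Flat R (∀ i, S i) := by
  classical
  have := Fintype.ofFinite ι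
  exact Module.Flat.of_linearEquiv (DirectSum.linearEquivFunOnFintype R ι S).symm

theorem faithfullyFlat_pi_away {R ι : Type} [CommRing R] [Finite ι] (r : ι → R)
    (h : Ideal.span (Set.range r) = ⊤) :
    Module.FaithfullyFlat R (∀ i, Localization.Away (r i)) := by
  have (i : ι) : Module.Flat R (Localization.Away (r i)) :=
    IsLocalization.flat _ (Submonoid.powers (r i))
  have := flat_pi (R := R) fun i => Localization.Away (r i)
  refine Module.FaithfullyFlat.of_comap_surjective fun p => ?_
  obtain ⟨i, hi⟩ : ∃ i, r i ∉ p.asIdeal := by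
    by_contra! hr
    refine p.isPrime.ne_top (top_le_iff.mp (h ▸ Ideal.span_le.mpr ?_))
    rintro _ ⟨i, rfl⟩
    exact hr i
  have hp : p ∈ Set.range (PrimeSpectrum.comap (algebraMap R (Localization.Away (r i)))) := by
    rw [PrimeSpectrum.localization_away_comap_range _ (r i)]
    exact hi
  obtain ⟨q, rfl⟩ := hp
  refine ⟨PrimeSpectrum.comap (Pi.evalRingHom (fun i => Localization.Away (r i)) i) q, ?_⟩
  rw [← PrimeSpectrum.comap_comp_apply]
  rfl

theorem spec_pi_hom_ext {ι : Type} [Finite ι] (S : ι → Type) [∀ i, CommRing (S i)] {Y : Scheme.{0}}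
    {f g : Spec (CommRingCat.of (∀ i, S i)) ⟶ Y}
    (h : ∀ i, Spec.map (CommRingCat.ofHom (Pi.evalRingHom S i)) ≫ f =
      Spec.map (CommRingCat.ofHom (Pi.evalRingHom S i)) ≫ g) : f = g := by
  rw [← cancel_epi (sigmaSpec fun i => CommRingCat.of (S i))]
  refine Limits.Sigma.hom_ext _ _ fun i => ?_
  rw [← Category.assoc, ← Category.assoc, ι_sigmaSpec]
  exact h i

/-- Basic open sets which refine the preimages of an open cover. -/
theorem exists_basicOpen_cover {R ι : Type} [CommRing R] {Y : Scheme.{0}}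
    (f : Spec (CommRingCat.of R) ⟶ Y) (U : ι → Y.Opens) (hU : ∀ y, ∃ i, y ∈ U i) :
    ∃ (n : ℕ) (r : Fin n → R), Ideal.span (Set.range r) = ⊤ ∧ ∀ k, ∃ i,
      PrimeSpectrum.basicOpen (r k) ≤ f ⁻¹ᵁ (U i) := by
  let s : Set R := {r | ∃ i, PrimeSpectrum.basicOpen r ≤ f ⁻¹ᵁ (U i)}
  have hs : Ideal.span s = ⊤ := by
    by_contra hne
    obtain ⟨p, hp, hle⟩ := Ideal.exists_le_maximal _ hne
    let x : Spec (CommRingCat.of R) := ⟨p, hp.isPrime⟩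
    obtain ⟨i, hi⟩ := hU (f x)
    obtain ⟨_, ⟨_, ⟨r, rfl⟩, rfl⟩, hxr, hr⟩ := PrimeSpectrum.isBasis_basic_opens.exists_subset_of_mem_open
      (show x ∈ (f ⁻¹ᵁ (U i) : Set _) from hi) (f ⁻¹ᵁ (U i)).isOpen
    exact hxr (hle (Ideal.subset_span ⟨i, hr⟩))
  have h₁ : (1 : R) ∈ Ideal.span s := hs ▸ Submodule.mem_top
  obtain ⟨n, c, g, hg⟩ := Submodule.mem_span_set'.mp h₁
  refine ⟨n, fun k => g k, ?_, fun k => (g k).2⟩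
  rw [Ideal.eq_top_iff_one, ← hg]
  exact sum_mem fun k _ => Ideal.mul_mem_left _ _ (Ideal.subset_span ⟨k, rfl⟩)

namespace ToricQuotient

variable {I σ : Type} [Fintype I] [Fintype σ] {w : σ → I → ℤ} {η : I → ℤ}

-- On a small enough basic open set the morphism lands in one chart, and the slice provides a lift
-- to the affine space.
omit [Fintype I] in
theorem exists_local_point {R : Type} [CommRing R] (hI : IsCharted w η)
    (f : Spec (CommRingCat.of R) ⟶ quotient w η) :
    ∃ (n : ℕ) (r : Fin n → R), Ideal.span (Set.range r) = ⊤ ∧ ∀ k, ∃ (c : σ → ℕ) (hc : IsChart w η c)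
      (θ : Slice c →+* Localization.Away (r k)),
        Spec.map (CommRingCat.ofHom θ) ≫ chart hc =
          Spec.map (CommRingCat.ofHom (algebraMap R (Localization.Away (r k)))) ≫ f := by
  obtain ⟨n, r, hr, h⟩ := exists_basicOpen_cover f (fun c : Charts w η => (chart c.2).opensRange)
    fun y => by
      obtain ⟨c, hc, hy⟩ := exists_chart hI y
      exact ⟨⟨c, hc⟩, hy⟩
  refine ⟨n, r, hr, fun k => ?_⟩
  obtain ⟨⟨c, hc⟩, hk⟩ := h k
  let g := Spec.map (CommRingCat.ofHom (algebraMap R (Localization.Away (r k)))) ≫ f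
  have hg : Set.range g ⊆ Set.range (chart hc) := by
    rintro _ ⟨x, rfl⟩
    have hx : (Spec.map (CommRingCat.ofHom (algebraMap R (Localization.Away (r k))))) x ∈
        PrimeSpectrum.basicOpen (r k) := by
      have := PrimeSpectrum.localization_away_comap_range (Localization.Away (r k)) (r k)
      exact this.subset ⟨x, rfl⟩
    exact hk hx
  refine ⟨c, hc, (Spec.preimage (IsOpenImmersion.lift (chart hc) g hg)).hom, ?_⟩
  rw [CommRingCat.ofHom_hom, Spec.map_preimage, IsOpenImmersion.lift_fac]

/-- Every morphism to the quotient is classifying. -/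
theorem exists_classify_eq {R : Type} [CommRing R] [Algebra ℂ R] (hI : IsCharted w η)
    (f : Spec (CommRingCat.of R) ⟶ quotient w η) (hf : f ≫ structureMap w η = specStr R) :
    ∃ (N : TorusTorsor I R) (v : σ → N.carrier) (hv : ∀ i, v i ∈ N.gr (w i))
      (hN : stableIdeal w η N v = ⊤), classify hv hN = f := by
  obtain ⟨n, r, hr, hloc⟩ := exists_local_point hI f
  choose c hc θ hθ using hloc
  let S := ∀ k, Localization.Away (r k)
  have hS : Module.FaithfullyFlat R S := faithfullyFlat_pi_away r hr
  -- The local lifts form a single point over the product ring `S`. It is stable because the chart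
  -- monomial of the `k`th factor takes the value 1 there.
  let v : σ → S := fun i k => θ k (slicePoint (c k) i)
  have hspan : Ideal.span {r | ∃ u, wt w u = η ∧ r = monom v u} = ⊤ := by
    classical
    rw [Ideal.eq_top_iff_one]
    have h₁ (k) : (Pi.single k 1 : S) = Pi.single k 1 * monom v (c k) := by
      funext l
      by_cases h : l = k
      · subst h
        have h₂ : monom v (c l) l = 1 := by
          have h₃ := map_monom (Pi.evalRingHom (fun k => Localization.Away (r k)) l) v (c l)
          refine h₃.trans ?_
          refine (map_monom (θ l) (slicePoint (c l)) (c l)).symm.trans ?_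
          have h₄ := eval_chartMono (hc l)
          rw [chartMono, eval_mono] at h₄
          rw [h₄, map_one]
        rw [Pi.mul_apply, h₂, mul_one]
      · rw [Pi.mul_apply, Pi.single_eq_of_ne h, zero_mul]
    have h₂ : (1 : S) = ∑ k, Pi.single k 1 := (Finset.univ_sum_single (1 : S)).symm
    rw [h₂]
    refine sum_mem fun k _ => ?_
    rw [h₁ k]
    exact Ideal.mul_mem_left _ _ (Ideal.subset_span ⟨c k, (hc k).1, rfl⟩)
  let φ : ℂ →+* S := (algebraMap R S).comp (algebraMap ℂ R)
  have hst : ProjPoint.IsStable (grading w η) (eval φ v) := isStable_eval φ v hspan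
  have hmk : ProjPoint.mk hst = Spec.map (CommRingCat.ofHom (algebraMap R S)) ≫ f := by
    refine spec_pi_hom_ext _ fun k => ?_
    obtain ⟨h₁, e₁⟩ := comp_mk_eval hst (Pi.evalRingHom (fun k => Localization.Away (r k)) k)
    obtain ⟨h₂, e₂⟩ := comp_mk_eval (isStable_slicePoint (hc k)) (θ k)
    rw [e₁, ← Category.assoc, ← Spec.map_comp, ← CommRingCat.ofHom_comp]
    refine Eq.trans ?_ (e₂.symm.trans ((congrArg _ (chart_eq_mk (hc k)).symm).trans (hθ k)))
    refine mk_eval_congr h₁ h₂ ?_ fun _ _ _ _ _ => mul_comm _ _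
    have h₃ := congrArg (· ≫ structureMap w η) (hθ k)
    simp only [Category.assoc, hf, chart_structureMap, specStr, ← Spec.map_comp] at h₃
    have h₄ := congrArg CommRingCat.Hom.hom (Spec.map_injective h₃)
    exact h₄.symm
  -- Both pullbacks of `v` to `S ⊗[R] S` have as their image in the quotient the pullback of `f`,
  -- hence the same ratios of semi-invariants.
  have cross (n : ℕ) (u u' : σ → ℕ) (hu : wt w u = n • η) (hu' : wt w u' = n • η) :
      monom v u ⊗ₜ[R] monom v u' = monom v u' ⊗ₜ[R] monom v u := by
    let L : S →ₐ[R] S ⊗[R] S := Algebra.TensorProduct.includeLeft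
    let Rt : S →ₐ[R] S ⊗[R] S := Algebra.TensorProduct.includeRight
    obtain ⟨h₁, e₁⟩ := comp_mk_eval hst L.toRingHom
    obtain ⟨h₂, e₂⟩ := comp_mk_eval hst Rt.toRingHom
    have e : ProjPoint.mk h₁ = ProjPoint.mk h₂ := by
      rw [← e₁, ← e₂, hmk, ← Category.assoc, ← Category.assoc, ← Spec.map_comp, ← Spec.map_comp,
        ← CommRingCat.ofHom_comp, ← CommRingCat.ofHom_comp]
      congr 3
      ext r
      exact (L.commutes r).trans (Rt.commutes r).symm
    have := monom_cross_of_mk_eq h₁ h₂ e n u u' hu hu'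
    rw [← map_monom, ← map_monom, ← map_monom, ← map_monom] at this
    have hmul (a b : S) : L a * Rt b = a ⊗ₜ[R] b := by
      change a ⊗ₜ[R] (1 : S) * (1 : S) ⊗ₜ[R] b = _
      rw [Algebra.TensorProduct.tmul_mul_tmul, one_mul, mul_one]
    exact (hmul _ _).symm.trans (this.trans (hmul _ _))
  obtain ⟨N, b, F, hb, hN, hF⟩ := exists_descended_point hI.spansLattice hspan cross
  refine ⟨N, b, hb, hN, ?_⟩
  have := epi_spec_of_faithfullyFlat (R := R) (S := S)
  rw [← cancel_epi (Spec.map (CommRingCat.ofHom (algebraMap R S))), ← hmk]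
  let : Algebra ℂ S := φ.toAlgebra
  let ψ : R →ₐ[ℂ] S := ⟨algebraMap R S, fun _ => rfl⟩
  have hv : ∀ i, gen (w i) (v i) ∈ (trivial I S).gr (w i) := fun i => gen_mem _ _
  have h₁ := classify_of_hom hb hN hv (stableIdeal_trivial hspan) ψ F hF
  refine h₁.symm.trans (eq_classify hv _ ?_)
  obtain ⟨h₂, e₂⟩ := comp_mk_eval hst (algebraMap S (trivial I S).carrier)
  refine e₂.trans (mk_eval_congr _ _ rfl fun n u u' hu hu' => ?_)
  have h₃ (t : σ → ℕ) : monom (fun i => algebraMap S (trivial I S).carrier (v i)) t =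
      algebraMap S (trivial I S).carrier (monom v t) := (map_monom _ v t).symm
  refine (congrArg₂ (· * ·) (h₃ u) (monom_gen w v u')).trans (Eq.trans ?_
    (congrArg₂ (· * ·) (h₃ u') (monom_gen w v u)).symm)
  refine (algebraMap_mul_gen _ _ _).trans (Eq.trans ?_ (algebraMap_mul_gen _ _ _).symm)
  rw [hu, hu', mul_comm]

end ToricQuotient

/-! ### Coordinates of quasimaps -/

namespace TorusTorsor

variable {I : Type} [Fintype I] {R : Type} [CommRing R] {N : TorusTorsor I R}

/-- Two trivializations of a torsor over a field differ by a nonzero scalar in each degree. -/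
theorem exists_scale {K κ : Type} [CommRing K] [Field κ] {φ : R →+* K} (g : Hom φ N (trivial I K))
    (θ : K →+* κ) (τ : N.carrier →+* κ) (hτ : ∀ r, τ (algebraMap R N.carrier r) = θ (φ r))
    (χ : I → ℤ) : ∃ t : κ, t ≠ 0 ∧ ∀ a ∈ N.gr χ, ∀ c, g.map a = gen χ c → τ a = θ c * t := by
  obtain ⟨n, u, u', hu, hu', h⟩ := N.exists_sum_eq_one χ
  choose d hd using fun k => exists_eq_gen (g.map_gr _ _ (hu' k))
  have key : ∀ a ∈ N.gr χ, ∀ c, g.map a = gen χ c → τ a = θ c * ∑ k, θ (d k) * τ (u k) := by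
    intro a ha c hc
    have h₁ := congrArg (fun z => τ (a * z)) h
    simp only [mul_one, Finset.mul_sum, map_sum] at h₁
    rw [← h₁, Finset.mul_sum]
    refine Finset.sum_congr rfl fun k _ => ?_
    have h₂ : φ (N.base (a * u' k)) = c * d k := by
      rw [← g.base_map (mul_mem_zero ha (hu' k)), map_mul]
      refine (congrArg _ (congrArg₂ (· * ·) hc (hd k))).trans ?_
      refine (congrArg _ (gen_mul_gen _ _ _ _)).trans ?_
      rw [add_neg_cancel]
      exact base_gen _
    have h₃ : a * (u k * u' k) = algebraMap R N.carrier (N.base (a * u' k)) * u k := by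
      rw [algebraMap_base (mul_mem_zero ha (hu' k))]; ring
    rw [h₃, map_mul, hτ, h₂, map_mul]
    ring
  refine ⟨_, fun h0 => ?_, key⟩
  have h₁ := congrArg τ h
  rw [map_sum, map_one] at h₁
  refine zero_ne_one (h₁ ▸ (Finset.sum_eq_zero fun k _ => ?_).symm)
  obtain ⟨c, hc⟩ := exists_eq_gen (g.map_gr _ _ (hu k))
  rw [map_mul, key _ (hu k) c hc, h0, mul_zero, zero_mul]

variable {σ : Type} [Fintype σ] {w : σ → I → ℤ} {η : I → ℤ} {v : σ → N.carrier}

/-- Translates `stableIdeal` on a fibre into nonvanishing of monomials in honest coordinates: the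
elements of degree `-η` generate the fibre, so some multiplier `x` is nonzero there. -/
theorem exists_base_ne_zero_iff (hv : ∀ i, v i ∈ N.gr (w i)) {K : Type} [Field K] {φ : R →+* K}
    (g : Hom φ N (trivial I K)) {c : σ → K} (hc : ∀ i, g.map (v i) = gen (w i) (c i))
    {u : σ → ℕ} (hu : wt w u = η) :
    (∃ x ∈ N.gr (-η), φ (N.base (monom v u * x)) ≠ 0) ↔ monom c u ≠ 0 := by
  have key (x) (hx : x ∈ N.gr (-η)) (d : K) (hd : g.map x = gen (-η) d) :
      φ (N.base (monom v u * x)) = monom c u * d := by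
    rw [← g.base_map (mul_mem_zero (hu ▸ monom_mem hv u) hx), map_mul]
    have h₁ : g.map (monom v u) = gen η (monom c u) := by
      rw [map_monom]
      simp only [hc]
      rw [← hu]
      exact monom_gen w c u
    refine (congrArg _ (congrArg₂ (· * ·) h₁ hd)).trans ?_
    refine (congrArg _ (gen_mul_gen _ _ _ _)).trans ?_
    rw [add_neg_cancel]
    exact base_gen _
  constructor
  · rintro ⟨x, hx, h⟩ h0
    obtain ⟨d, hd⟩ := exists_eq_gen (g.map_gr _ _ hx)
    rw [key x hx d hd, h0, zero_mul] at h
    exact h rfl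
  · intro h
    by_contra! h'
    obtain ⟨n, x, x', hx, hx', h₁⟩ := N.exists_sum_eq_one (-η)
    have h₂ := congrArg g.map h₁
    rw [map_sum, map_one] at h₂
    have h₃ : (0 : (trivial I K).carrier) = 1 := by
      rw [← h₂]
      refine (Finset.sum_eq_zero fun k _ => ?_).symm
      obtain ⟨d, hd⟩ := exists_eq_gen (g.map_gr _ _ (hx k))
      have h₄ := h' _ (hx k)
      rw [key _ (hx k) d hd] at h₄
      have h₅ : d = 0 := (mul_eq_zero.mp h₄).resolve_left h
      rw [map_mul, hd, h₅]
      exact (congrArg (· * _) (gen_zero _)).trans (zero_mul _)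
    have h₄ : gen (I := I) 0 (0 : K) = gen 0 1 := (gen_zero _).trans h₃
    exact zero_ne_one (gen_injective _ h₄)

/-- The section of the trivial torsor. -/
noncomputable def augmentation (I : Type) [Fintype I] (B : Type) [CommRing B] :
    (trivial I B).carrier →+* B :=
  AddMonoidAlgebra.liftNCRingHom (RingHom.id B) (1 : Multiplicative (I → ℤ) →* B)
    (fun _ _ => Commute.all _ _)

theorem augmentation_gen {B : Type} [CommRing B] (χ : I → ℤ) (b : B) :
    augmentation I B (gen χ b) = b := by
  refine (AddMonoidAlgebra.liftNC_single _ _ _ _).trans ?_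
  simp

end TorusTorsor

namespace Frame

variable {I : Type} [Fintype I] {R R' : Type} [CommRing R] [CommRing R'] {γ : I → ℤ}
  {N : TorusTorsor I R} {P : P1Torsor I R} {N' : TorusTorsor I R'} {P' : P1Torsor I R'}

theorem zero_injective (F : Frame γ N P) {χ : I → ℤ} {a b : N.carrier} (ha : a ∈ N.gr χ)
    (hb : b ∈ N.gr χ) (h : F.zero.map a = F.zero.map b) : a = b := by
  have := F.sections_injective (n := 1) (v := fun _ => a) (v' := fun _ => b) (fun _ => ha)
    (fun _ => hb) (by simp [h])
  exact congrFun this 0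

/-- Morphisms between torsors with frames restrict to the descended torsors. -/
theorem exists_restrict {φ : R →+* R'} (F : Frame γ N P) (F' : Frame γ N' P')
    (f : P1Torsor.Hom φ P P') : ∃ h : TorusTorsor.Hom φ N N',
      (∀ χ, ∀ a ∈ N.gr χ, f.zero.map (F.zero.map a) = F'.zero.map (h.map a)) ∧
      ∀ χ, ∀ a ∈ N.gr χ, f.infty.map (F.infty.map a) = F'.infty.map (h.map a) := by
  have exist (χ : I → ℤ) (a : N.carrier) (ha : a ∈ N.gr χ) : ∃ a' ∈ N'.gr χ,
      f.zero.map (F.zero.map a) = F'.zero.map a' ∧ f.infty.map (F.infty.map a) = F'.infty.map a' := by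
    -- Twisting by `⟨χ, γ⟩` leaves a bundle of degree zero, so `k = 1` and a section is a single
    -- coefficient, the required image of `a`.
    obtain ⟨v, hv, h₁, h₂⟩ := F'.exists_sections (χ := χ) (p := χ ⬝ᵥ γ) (k := 1) (by ring)
      (f.zero.map_gr _ _ (F.zero.map_gr _ _ ha)) (f.infty.map_gr _ _ (F.infty.map_gr _ _ ha)) (by
        rw [← f.comm_zero, ← f.comm_infty, F.compat χ a ha, Algebra.smul_def, Algebra.smul_def,
          map_mul, f.overlap.map_base, mapRingHom_T, ← mul_assoc, ← map_mul,
          ← LaurentPolynomial.T_add, neg_add_cancel, LaurentPolynomial.T_zero, map_one, one_mul])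
    refine ⟨v ⟨0, by decide⟩, hv _, ?_, ?_⟩
    · rw [h₁]
      refine (Fin.sum_univ_one _).trans ?_
      simp
    · rw [h₂]
      refine (Fin.sum_univ_one _).trans ?_
      simp
  choose! H hH hz hi using exist
  obtain ⟨h, hh⟩ := exists_ringHom (P := N) H
    (fun χ a ha b hb => F'.zero_injective (hH _ _ (add_mem ha hb)) (add_mem (hH _ _ ha) (hH _ _ hb))
      (by rw [← hz _ _ (add_mem ha hb), map_add, map_add, map_add, hz _ _ ha, hz _ _ hb]))
    (F'.zero_injective (hH _ _ N.one_mem) N'.one_mem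
      (by rw [← hz _ _ N.one_mem, map_one, map_one, map_one]))
    (fun χ ψ a ha b hb => F'.zero_injective (hH _ _ (mul_mem ha hb))
      (mul_mem (hH _ _ ha) (hH _ _ hb))
      (by rw [← hz _ _ (mul_mem ha hb), map_mul, map_mul, map_mul, hz _ _ ha, hz _ _ hb]))
  refine ⟨⟨h, fun r => ?_, fun χ a ha => ?_⟩, fun χ a ha => ?_, fun χ a ha => ?_⟩
  · rw [hh 0 _ (N.algebraMap_mem r)]
    refine F'.zero_injective (hH _ _ (N.algebraMap_mem r)) (N'.algebraMap_mem _) ?_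
    rw [← hz _ _ (N.algebraMap_mem r), F.zero.map_base, f.zero.map_base, F'.zero.map_base]
    simp
  · rw [hh χ a ha]; exact hH _ _ ha
  · change _ = F'.zero.map (h a)
    rw [hh χ a ha]; exact hz _ _ ha
  · change _ = F'.infty.map (h a)
    rw [hh χ a ha]; exact hi _ _ ha

end Frame

/-! ### Quasimaps as vectors of coefficients. -/

section Coordinates

variable {E I J : Type} [Fintype E] [Fintype I] [Fintype J]

/-- The degrees of the twisting bundles. -/
def twist (m : E → ℤ) : E ⊕ E → ℤ := Sum.elim (fun e => m e + 1) (fun e => -m e + 1)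

/-- The Euler characteristics of the twisted bundles. -/
def sectionCount (D : HypertoricDatum E I J) (m : E → ℤ) (γ : I → ℤ) (ε : E ⊕ E) : ℤ :=
  D.weight ε ⬝ᵥ γ - twist m ε + 1

/-- The indices of the coefficients of quasimaps. -/
abbrev Coord (D : HypertoricDatum E I J) (m : E → ℤ) (γ : I → ℤ) : Type :=
  Σ ε : E ⊕ E, Fin (sectionCount D m γ ε).toNat

variable {D : HypertoricDatum E I J} {m : E → ℤ} {γ : I → ℤ} {R : Type} [CommRing R]

/-- The twists of `x_e` and `y_e` have total degree 2 while `L_e` and its inverse cancel. So one of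
the two counts is nonpositive, and the corresponding section is zero. -/
theorem sectionCount_inl_add_inr (e : E) :
    sectionCount D m γ (Sum.inl e) + sectionCount D m γ (Sum.inr e) = 0 := by
  simp only [sectionCount, HypertoricDatum.weight, twist, Sum.elim_inl, Sum.elim_inr, neg_dotProduct]
  ring

/-- The weights of the coefficients of quasimaps. -/
abbrev coordWeight (D : HypertoricDatum E I J) (m : E → ℤ) (γ : I → ℤ) (i : Coord D m γ) : I → ℤ :=
  D.weight i.1

namespace TwistedQuasimap

/-- The sections around `0`. -/
def secZero (ℱ : TwistedQuasimap D m R) : E ⊕ E → ℱ.torsor.zero.carrier := Sum.elim ℱ.xZero ℱ.yZero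

/-- The sections around `∞`. -/
def secInfty (ℱ : TwistedQuasimap D m R) : E ⊕ E → ℱ.torsor.infty.carrier :=
  Sum.elim ℱ.xInfty ℱ.yInfty

theorem secZero_mem (ℱ : TwistedQuasimap D m R) (ε : E ⊕ E) :
    ℱ.secZero ε ∈ ℱ.torsor.zero.gr (D.weight ε) := by
  cases ε with
  | inl e => exact ℱ.xZero_mem e
  | inr e => exact ℱ.yZero_mem e

theorem secInfty_mem (ℱ : TwistedQuasimap D m R) (ε : E ⊕ E) :
    ℱ.secInfty ε ∈ ℱ.torsor.infty.gr (D.weight ε) := by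
  cases ε with
  | inl e => exact ℱ.xInfty_mem e
  | inr e => exact ℱ.yInfty_mem e

theorem glue_sec (ℱ : TwistedQuasimap D m R) (ε : E ⊕ E) : ℱ.torsor.resZero.map (ℱ.secZero ε) =
    (LaurentPolynomial.T (-twist m ε) : R[T;T⁻¹]) • ℱ.torsor.resInfty.map (ℱ.secInfty ε) := by
  cases ε with
  | inl e => exact ℱ.glue_x e
  | inr e => exact ℱ.glue_y e

end TwistedQuasimap

/-- Coefficients of a quasimap of degree `γ` with respect to a frame. -/
structure Coefficients (ℱ : TwistedQuasimap D m R) (N : TorusTorsor I R)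
    (v : Coord D m γ → N.carrier) where
  frame : Frame γ N ℱ.torsor
  mem : ∀ i, v i ∈ N.gr (coordWeight D m γ i)
  zero_eq : ∀ ε, ℱ.secZero ε = ∑ j : Fin (sectionCount D m γ ε).toNat,
    algebraMap R[X] ℱ.torsor.zero.carrier (X ^ (j : ℕ)) * frame.zero.map (v ⟨ε, j⟩)
  infty_eq : ∀ ε, ℱ.secInfty ε = ∑ j : Fin (sectionCount D m γ ε).toNat,
    algebraMap R[X] ℱ.torsor.infty.carrier (X ^ ((sectionCount D m γ ε).toNat - 1 - j)) *
      frame.infty.map (v ⟨ε, j⟩)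

namespace Coefficients

theorem exists_of_hasDegree (ℱ : TwistedQuasimap D m R) (h : ℱ.torsor.HasDegree γ) :
    ∃ (N : TorusTorsor I R) (v : Coord D m γ → N.carrier), Nonempty (Coefficients ℱ N v) := by
  obtain ⟨N, ⟨F⟩⟩ := P1Torsor.exists_frame h
  choose v hv hz hi using fun ε => F.exists_sections (k := sectionCount D m γ ε) rfl
    (ℱ.secZero_mem ε) (ℱ.secInfty_mem ε) (ℱ.glue_sec ε)
  exact ⟨N, fun i => v i.1 i.2, ⟨⟨F, fun i => hv i.1 i.2, hz, hi⟩⟩⟩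

theorem exists_of_point {N : TorusTorsor I R} {v : Coord D m γ → N.carrier}
    (hv : ∀ i, v i ∈ N.gr (coordWeight D m γ i)) :
    ∃ ℱ : TwistedQuasimap D m R, Nonempty (Coefficients ℱ N v) := by
  obtain ⟨P, ⟨F⟩⟩ := Frame.exists_of_torsor γ N
  let z (ε : E ⊕ E) : P.zero.carrier := ∑ j : Fin (sectionCount D m γ ε).toNat,
    algebraMap R[X] P.zero.carrier (X ^ (j : ℕ)) * F.zero.map (v ⟨ε, j⟩)
  let y (ε : E ⊕ E) : P.infty.carrier := ∑ j : Fin (sectionCount D m γ ε).toNat,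
    algebraMap R[X] P.infty.carrier (X ^ ((sectionCount D m γ ε).toNat - 1 - j)) *
      F.infty.map (v ⟨ε, j⟩)
  have hz (ε) : z ε ∈ P.zero.gr (D.weight ε) :=
    sum_mem fun j _ => algebraMap_mul_mem _ (F.zero.map_gr _ _ (hv ⟨ε, j⟩))
  have hy (ε) : y ε ∈ P.infty.gr (D.weight ε) :=
    sum_mem fun j _ => algebraMap_mul_mem _ (F.infty.map_gr _ _ (hv ⟨ε, j⟩))
  have hg (ε) : P.resZero.map (z ε) =
      (LaurentPolynomial.T (-twist m ε) : R[T;T⁻¹]) • P.resInfty.map (y ε) :=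
    F.glue_sections (k := sectionCount D m γ ε) rfl fun j => hv ⟨ε, j⟩
  -- One section of each pair is an empty sum. Hence the moment map equations impose nothing on the
  -- coefficients.
  have hempty (e : E) : IsEmpty (Fin (sectionCount D m γ (Sum.inl e)).toNat) ∨
      IsEmpty (Fin (sectionCount D m γ (Sum.inr e)).toNat) := by
    have := sectionCount_inl_add_inr (D := D) (m := m) (γ := γ) e
    rcases le_total (sectionCount D m γ (Sum.inl e)) 0 with h | h
    · left; rw [Int.toNat_of_nonpos h]; infer_instance
    · right; rw [Int.toNat_of_nonpos (by omega)]; infer_instance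
  have hmz (e : E) : z (Sum.inl e) * z (Sum.inr e) = 0 := by
    rcases hempty e with h | h
    · rw [show z (Sum.inl e) = 0 from Finset.sum_of_isEmpty _, zero_mul]
    · rw [show z (Sum.inr e) = 0 from Finset.sum_of_isEmpty _, mul_zero]
  have hmy (e : E) : y (Sum.inl e) * y (Sum.inr e) = 0 := by
    rcases hempty e with h | h
    · rw [show y (Sum.inl e) = 0 from Finset.sum_of_isEmpty _, zero_mul]
    · rw [show y (Sum.inr e) = 0 from Finset.sum_of_isEmpty _, mul_zero]
  refine ⟨{ torsor := P
            xZero := fun e => z (Sum.inl e)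
            yZero := fun e => z (Sum.inr e)
            xInfty := fun e => y (Sum.inl e)
            yInfty := fun e => y (Sum.inr e)
            xZero_mem := fun e => hz (Sum.inl e)
            yZero_mem := fun e => hz (Sum.inr e)
            xInfty_mem := fun e => hy (Sum.inl e)
            yInfty_mem := fun e => hy (Sum.inr e)
            glue_x := fun e => hg (Sum.inl e)
            glue_y := fun e => hg (Sum.inr e)
            moment_zero := fun ξ => Finset.sum_eq_zero fun e _ => by rw [hmz, smul_zero]
            moment_infty := fun ξ => Finset.sum_eq_zero fun e _ => by rw [hmy, smul_zero] },
    ⟨⟨F, hv, fun ε => ?_, fun ε => ?_⟩⟩⟩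
  · cases ε <;> rfl
  · cases ε <;> rfl

variable {R' : Type} [CommRing R'] {φ : R →+* R'} {ℱ : TwistedQuasimap D m R}
  {ℱ' : TwistedQuasimap D m R'} {N : TorusTorsor I R} {N' : TorusTorsor I R'}
  {v : Coord D m γ → N.carrier} {v' : Coord D m γ → N'.carrier}

theorem exists_hom (c : Coefficients ℱ N v) (c' : Coefficients ℱ' N' v')
    (h : TorusTorsor.Hom φ N N') (hh : ∀ i, h.map (v i) = v' i) :
    Nonempty (TwistedQuasimap.Hom φ ℱ ℱ') := by
  obtain ⟨f, hz, hi⟩ := c.frame.exists_hom c'.frame h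
  have h₁ (ε) : f.zero.map (ℱ.secZero ε) = ℱ'.secZero ε := by
    rw [c.zero_eq, c'.zero_eq, map_sum]
    refine Finset.sum_congr rfl fun j _ => ?_
    rw [map_mul, f.zero.map_base, hz _ _ (c.mem ⟨ε, j⟩), hh]
    simp
  have h₂ (ε) : f.infty.map (ℱ.secInfty ε) = ℱ'.secInfty ε := by
    rw [c.infty_eq, c'.infty_eq, map_sum]
    refine Finset.sum_congr rfl fun j _ => ?_
    rw [map_mul, f.infty.map_base, hi _ _ (c.mem ⟨ε, j⟩), hh]
    simp
  exact ⟨⟨f, fun e => h₁ (Sum.inl e), fun e => h₁ (Sum.inr e), fun e => h₂ (Sum.inl e),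
    fun e => h₂ (Sum.inr e)⟩⟩

theorem exists_restrict (c : Coefficients ℱ N v) (c' : Coefficients ℱ' N' v')
    (f : TwistedQuasimap.Hom φ ℱ ℱ') : ∃ h : TorusTorsor.Hom φ N N', (∀ i, h.map (v i) = v' i) ∧
      (∀ χ, ∀ a ∈ N.gr χ, f.torsor.zero.map (c.frame.zero.map a) = c'.frame.zero.map (h.map a)) ∧
      ∀ χ, ∀ a ∈ N.gr χ, f.torsor.infty.map (c.frame.infty.map a) =
        c'.frame.infty.map (h.map a) := by
  obtain ⟨h, hz, hi⟩ := c.frame.exists_restrict c'.frame f.torsor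
  refine ⟨h, fun ⟨ε, j⟩ => ?_, hz, hi⟩
  have h₁ : f.torsor.zero.map (ℱ.secZero ε) = ℱ'.secZero ε := by
    cases ε with
    | inl e => exact f.map_xZero e
    | inr e => exact f.map_yZero e
  rw [c.zero_eq, c'.zero_eq, map_sum] at h₁
  refine congrFun (c'.frame.sections_injective (χ := D.weight ε)
    (v := fun j => h.map (v ⟨ε, j⟩)) (v' := fun j => v' ⟨ε, j⟩)
    (fun j => h.map_gr _ _ (c.mem ⟨ε, j⟩)) (fun j => c'.mem ⟨ε, j⟩) (h₁ ▸ ?_)) j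
  refine Finset.sum_congr rfl fun j _ => ?_
  rw [map_mul, f.torsor.zero.map_base, hz _ _ (c.mem ⟨ε, j⟩)]
  simp

/-- A morphism of quasimaps is determined by its restriction to the descended torsors, because
frames generate both charts. -/
theorem hom_ext (c : Coefficients ℱ N v) (c' : Coefficients ℱ' N' v')
    (huniq : ∀ h h' : TorusTorsor.Hom φ N N', (∀ i, h.map (v i) = v' i) →
      (∀ i, h'.map (v i) = v' i) → h = h') (f g : TwistedQuasimap.Hom φ ℱ ℱ') : f = g := by
  obtain ⟨h, hh, hz, hi⟩ := c.exists_restrict c' f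
  obtain ⟨h', hh', hz', hi'⟩ := c.exists_restrict c' g
  obtain rfl := huniq h h' hh hh'
  refine TwistedQuasimap.Hom.ext (c.frame.hom_ext (fun χ a ha => ?_) fun χ a ha => ?_)
  · rw [hz χ a ha, hz' χ a ha]
  · rw [hi χ a ha, hi' χ a ha]

end Coefficients

end Coordinates

/-! ### Stability in terms of coefficients -/

namespace Coefficients

variable {E I J : Type} [Fintype E] [Fintype I] [Fintype J] {D : HypertoricDatum E I J} {m : E → ℤ}
  {γ η : I → ℤ} {R : Type} [CommRing R] [Algebra ℂ R] {ℱ : TwistedQuasimap D m R}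
  {N : TorusTorsor I R} {v : Coord D m γ → N.carrier}

omit [Algebra ℂ R] in
theorem aeval_sumElim {κ : Type} [Field κ] [Algebra ℂ κ] (τ : ℱ.torsor.zero.carrier →+* κ)
    (f : MvPolynomial (E ⊕ E) ℂ) :
    MvPolynomial.aeval (Sum.elim (fun e => τ (ℱ.xZero e)) (fun e => τ (ℱ.yZero e))) f =
      MvPolynomial.aeval (fun ε => τ (ℱ.secZero ε)) f := by
  congr 2
  ext ε
  cases ε <;> rfl

/-- The sections of a quasimap over a field in terms of coefficients. -/
noncomputable def fiberSection {K : Type} [CommRing K] (c : Coord D m γ → K) (ε : E ⊕ E) : K[X] :=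
  ∑ j : Fin (sectionCount D m γ ε).toNat, Polynomial.C (c ⟨ε, j⟩) * X ^ (j : ℕ)

theorem coeff_fiberSection {K : Type} [CommRing K] (c : Coord D m γ → K) (ε : E ⊕ E)
    (j : Fin (sectionCount D m γ ε).toNat) : (fiberSection c ε).coeff j = c ⟨ε, j⟩ := by
  rw [fiberSection, Polynomial.finsetSum_coeff, Finset.sum_eq_single j]
  · simp
  · intro i _ hij
    rw [Polynomial.coeff_C_mul_X_pow, if_neg (fun h => hij (Fin.ext h.symm))]
  · simp

omit [Algebra ℂ R] in
theorem exists_fiber (c : Coefficients ℱ N v) {K : Type} [Field K] (φ : R →+* K) :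
    ∃ (g : TorusTorsor.Hom φ N (trivial I K)) (b : Coord D m γ → K),
      ∀ i, g.map (v i) = gen (coordWeight D m γ i) (b i) := by
  obtain ⟨g⟩ := N.exists_hom_trivial φ
  choose b hb using fun i => exists_eq_gen (g.map_gr _ _ (c.mem i))
  exact ⟨g, b, hb⟩

/-- A coefficient monomial of weight `η` that is nonzero on the fibre collapses to a section
monomial of the same weight. The sections occurring in it are nonzero polynomials, so it is nonzero
on a dense open set. -/
theorem isStable_of_stableIdeal (c : Coefficients ℱ N v)
    (h : stableIdeal (coordWeight D m γ) η N v = ⊤) : ℱ.IsStable η := by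
  intro K _ _ φ
  obtain ⟨g, b, hb⟩ := c.exists_fiber (φ : R →+* K)
  obtain ⟨u, hu, hbu⟩ : ∃ u, wt (coordWeight D m γ) u = η ∧ monom b u ≠ 0 := by
    by_contra! h'
    have h₁ : stableIdeal (coordWeight D m γ) η N v ≤ RingHom.ker (φ : R →+* K) := by
      refine Ideal.span_le.mpr ?_
      rintro _ ⟨u, hu, x, hx, rfl⟩
      by_contra h₂
      exact (exists_base_ne_zero_iff c.mem g hb hu).mp ⟨x, hx, h₂⟩ (h' u hu)
    have h₂ : (1 : R) ∈ RingHom.ker (φ : R →+* K) := h₁ (h ▸ Submodule.mem_top)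
    rw [RingHom.mem_ker, map_one] at h₂
    exact one_ne_zero h₂
  let U (ε : E ⊕ E) : ℕ := ∑ j : Fin (sectionCount D m γ ε).toNat, u ⟨ε, j⟩
  have hU (ε) (hε : U ε ≠ 0) : fiberSection b ε ≠ 0 := by
    obtain ⟨j, -, hj⟩ := Finset.exists_ne_zero_of_sum_ne_zero hε
    intro h0
    have h₁ := coeff_fiberSection b ε j
    rw [h0, Polynomial.coeff_zero] at h₁
    exact hbu (Finset.prod_eq_zero (Finset.mem_univ (⟨ε, j⟩ : Coord D m γ))
      (by rw [← h₁, zero_pow hj]))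
  have hpow {S : Type} [Field S] (s : E ⊕ E → S) (hs : ∀ ε, U ε ≠ 0 → s ε ≠ 0) :
      ∏ ε, s ε ^ U ε ≠ 0 := by
    refine Finset.prod_ne_zero_iff.mpr fun ε _ => ?_
    by_cases hε : U ε = 0
    · rw [hε, pow_zero]; exact one_ne_zero
    · exact pow_ne_zero _ (hs ε hε)
  refine ⟨∏ ε, fiberSection b ε ^ U ε, ?_, fun κ _ _ ψ τ hτ hψ => ?_⟩
  · refine Finset.prod_ne_zero_iff.mpr fun ε _ => ?_
    by_cases hε : U ε = 0
    · rw [hε, pow_zero]; exact one_ne_zero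
    · exact pow_ne_zero _ (hU ε hε)
  rw [map_prod, Finset.prod_ne_zero_iff] at hψ
  have hsec (ε) (hε : U ε ≠ 0) : τ (ℱ.secZero ε) ≠ 0 := by
    have h₁ := hψ ε (Finset.mem_univ ε)
    rw [map_pow] at h₁
    have h₂ : ψ (fiberSection b ε) ≠ 0 := fun h0 => h₁ (by rw [h0, zero_pow hε])
    -- The point `τ` of the total space need not respect the trivialization `g`; it changes the
    -- value in each degree by a nonzero scalar.
    obtain ⟨t, ht, hscale⟩ := exists_scale g ((ψ : K[X] →+* κ).comp Polynomial.C)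
      (τ.comp c.frame.zero.map) (fun r => by
        rw [RingHom.comp_apply, c.frame.zero.map_base, hτ]; simp) (D.weight ε)
    have h₃ : τ (ℱ.secZero ε) = ψ (fiberSection b ε) * t := by
      rw [c.zero_eq, fiberSection, map_sum, map_sum, Finset.sum_mul]
      refine Finset.sum_congr rfl fun j _ => ?_
      have h₄ := hscale _ (c.mem ⟨ε, j⟩) _ (hb ⟨ε, j⟩)
      rw [RingHom.comp_apply, RingHom.comp_apply] at h₄
      rw [map_mul, hτ, h₄, map_mul]
      simp only [map_pow, coe_mapRingHom, Polynomial.map_X, RingHom.coe_coe]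
      ring
    rw [h₃]
    exact mul_ne_zero h₂ ht
  refine ⟨1, MvPolynomial.monomial (Finsupp.equivFunOnFinite.symm U) 1, one_pos, ?_, ?_⟩
  · refine MvPolynomial.isWeightedHomogeneous_monomial _ _ _ ?_
    rw [one_smul, ← hu, Finsupp.weight_apply, Finsupp.sum_fintype _ _ (by simp), wt,
      Fintype.sum_sigma]
    refine Finset.sum_congr rfl fun ε _ => ?_
    simp only [Finsupp.equivFunOnFinite_symm_apply_apply, U, Finset.sum_smul]
  · rw [aeval_sumElim, MvPolynomial.aeval_monomial, map_one, one_mul,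
      Finsupp.prod_fintype _ _ (by simp)]
    exact hpow _ hsec

/-- If the ideal lay in a maximal `p`, stability at the generic point of the line over `R ⧸ p` would
give a nonzero section monomial, hence a nonzero coefficient monomial of weight `n • η`. A chart
contained in its support has weight `η`, a contradiction. -/
theorem stableIdeal_eq_top (c : Coefficients ℱ N v) (hI : IsCharted (coordWeight D m γ) η)
    (h : ℱ.IsStable η) : stableIdeal (coordWeight D m γ) η N v = ⊤ := by
  classical
  by_contra hne
  obtain ⟨p, hp, hle⟩ := Ideal.exists_le_maximal _ hne
  let : Field (R ⧸ p) := Ideal.Quotient.field p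
  let φ : R →ₐ[ℂ] R ⧸ p := Ideal.Quotient.mkₐ ℂ p
  obtain ⟨g, b, hb⟩ := c.exists_fiber (φ : R →+* R ⧸ p)
  obtain ⟨q, hq, hstable⟩ := h (R ⧸ p) φ
  let κ := FractionRing (R ⧸ p)[X]
  let ψ : (R ⧸ p)[X] →ₐ[ℂ] κ := IsScalarTower.toAlgHom ℂ (R ⧸ p)[X] κ
  have hinj : Function.Injective ψ := IsFractionRing.injective (R ⧸ p)[X] κ
  obtain ⟨f, hf, -⟩ := c.frame.exists_hom (Frame.standard I (R ⧸ p) γ) g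
  let τ₀ : ℱ.torsor.zero.carrier →+* (R ⧸ p)[X] := (augmentation I (R ⧸ p)[X]).comp f.zero.map
  have hτ₀ (r : R[X]) : τ₀ (algebraMap R[X] ℱ.torsor.zero.carrier r) =
      Polynomial.mapRingHom (φ : R →+* R ⧸ p) r := by
    refine (congrArg (augmentation I (R ⧸ p)[X]) (f.zero.map_base r)).trans ?_
    exact augmentation_gen 0 _
  have hsec (ε) : τ₀ (ℱ.secZero ε) = fiberSection b ε := by
    rw [c.zero_eq, fiberSection, map_sum]
    refine Finset.sum_congr rfl fun j _ => ?_
    rw [map_mul, hτ₀, mul_comm]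
    congr 1
    · refine (congrArg (augmentation I (R ⧸ p)[X]) ((hf _ _ (c.mem ⟨ε, j⟩)).trans
        ((congrArg _ (hb ⟨ε, j⟩)).trans (trivialHom_gen _ _ _ _)))).trans ?_
      rw [augmentation_gen, MonoidHom.one_apply, mul_one]
    · simp
  obtain ⟨n, F, hn, hF, hne0⟩ := hstable κ ψ ((ψ : (R ⧸ p)[X] →+* κ).comp τ₀)
    (fun r => by rw [RingHom.comp_apply, hτ₀]; rfl)
    (by rw [← map_zero ψ]; exact hinj.ne hq)
  rw [aeval_sumElim, MvPolynomial.aeval_def, MvPolynomial.eval₂_eq'] at hne0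
  obtain ⟨d, hd, hd0⟩ := Finset.exists_ne_zero_of_sum_ne_zero hne0
  have hwd := hF (MvPolynomial.mem_support_iff.mp hd)
  have hprod := right_ne_zero_of_mul hd0
  rw [Finset.prod_ne_zero_iff] at hprod
  have hj (ε) (hε : d ε ≠ 0) : ∃ j, b ⟨ε, j⟩ ≠ 0 := by
    by_contra! hb0
    refine hprod ε (Finset.mem_univ ε) ?_
    have : fiberSection b ε = 0 := Finset.sum_eq_zero fun j _ => by rw [hb0 j, map_zero, zero_mul]
    rw [RingHom.comp_apply, hsec, this, map_zero, zero_pow hε]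
  -- The whole exponent of a section is placed on one chosen nonzero coefficient of it, which
  -- preserves the weight.
  let u : Coord D m γ → ℕ := fun i =>
    if h : d i.1 ≠ 0 then if i.2 = (hj i.1 h).choose then d i.1 else 0 else 0
  have hu0 (i) (hi : u i ≠ 0) : b i ≠ 0 := by
    by_cases h₁ : d i.1 ≠ 0
    · by_cases h₂ : i.2 = (hj i.1 h₁).choose
      · have := (hj i.1 h₁).choose_spec
        rw [← h₂] at this
        exact this
      · simp [u, h₂] at hi
    · simp [u, h₁] at hi
  have huw : wt (coordWeight D m γ) u = n • η := by
    rw [← hwd, Finsupp.weight_apply, Finsupp.sum_fintype _ _ (by simp), wt, Fintype.sum_sigma]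
    refine Finset.sum_congr rfl fun ε _ => ?_
    change ∑ j, u ⟨ε, j⟩ • D.weight ε = _
    rw [← Finset.sum_smul]
    congr 1
    by_cases h₁ : d ε ≠ 0
    · simp only [u, dif_pos h₁]
      rw [Fintype.sum_eq_single (hj ε h₁).choose fun x hx => if_neg hx, if_pos rfl]
    · push Not at h₁
      simp [u, h₁]
  obtain ⟨s, hs, hsu⟩ := hI n u hn huw
  have hbs : monom b s ≠ 0 := by
    refine Finset.prod_ne_zero_iff.mpr fun i _ => ?_
    by_cases hi : s i = 0
    · rw [hi, pow_zero]; exact one_ne_zero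
    · exact pow_ne_zero _ (hu0 i fun h0 => hi (hsu i h0))
  obtain ⟨x, hx, hx0⟩ := (exists_base_ne_zero_iff c.mem g hb hs.1).mpr hbs
  exact hx0 (Ideal.Quotient.eq_zero_iff_mem.mpr (hle (Ideal.subset_span ⟨s, hs.1, x, hx, rfl⟩)))

end Coefficients

/-! ### Representability of the moduli problem. -/

open ToricQuotient in
theorem nonempty_moduliEquiv {E I J : Type} [Fintype E] [Fintype I] [Fintype J]
    (D : HypertoricDatum E I J) {m : E → ℤ} {η γ : I → ℤ}
    (hI : IsCharted (coordWeight D m γ) η) :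
    Nonempty (ModuliEquiv D m η γ (quotient (coordWeight D m γ) η)
      (structureMap (coordWeight D m γ) η)) := by
  have exist (R : Type) [CommRing R] [Algebra ℂ R] (ℱ : StableQuasimap D m η γ R) :=
    Coefficients.exists_of_hasDegree ℱ.quasimap ℱ.hasDegree
  choose N v c using exist
  have c (R : Type) [CommRing R] [Algebra ℂ R] (ℱ : StableQuasimap D m η γ R) :
      Coefficients ℱ.quasimap (N R ℱ) (v R ℱ) := (c R ℱ).some
  have hN (R : Type) [CommRing R] [Algebra ℂ R] (ℱ : StableQuasimap D m η γ R) :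
      stableIdeal (coordWeight D m γ) η (N R ℱ) (v R ℱ) = ⊤ :=
    (c R ℱ).stableIdeal_eq_top hI ℱ.isStable
  refine ⟨{ classify := fun R _ _ ℱ => classify (c R ℱ).mem (hN R ℱ)
            classify_comp := fun R _ _ ℱ => classify_structureMap _ _
            exists_classify_eq := fun R _ _ f hf => ?_
            classify_of_hom := fun R R' _ _ _ _ φ ℱ ℱ' ⟨f⟩ => ?_
            existsUnique_hom := fun R R' _ _ _ _ φ ℱ ℱ' h => ?_ }⟩
  · obtain ⟨M, b, hb, hM, hf'⟩ := exists_classify_eq hI f hf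
    obtain ⟨ℱ, ⟨d⟩⟩ := Coefficients.exists_of_point hb
    let 𝒢 : StableQuasimap D m η γ R := ⟨ℱ, d.frame.hasDegree, d.isStable_of_stableIdeal hM⟩
    refine ⟨𝒢, hf' ▸ ?_⟩
    -- The coefficients chosen for `𝒢` need not be the original `b`; restricting the identity to the
    -- two frames compares them. Each component is a composite of two identities, so that the
    -- argument of `comp` can absorb the equation saying that the coefficientwise extension of
    -- `RingHom.id R` is the identity.
    let idHom : TwistedQuasimap.Hom (RingHom.id R) ℱ ℱ :=
      { torsor :=
          { zero := (TorusTorsor.Hom.id _).comp (TorusTorsor.Hom.id _) (by simp)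
            infty := (TorusTorsor.Hom.id _).comp (TorusTorsor.Hom.id _) (by simp)
            overlap := (TorusTorsor.Hom.id _).comp (TorusTorsor.Hom.id _) (AddMonoidAlgebra.mapRingHom_id ..)
            comm_zero := fun _ => rfl
            comm_infty := fun _ => rfl }
        map_xZero := fun _ => rfl
        map_yZero := fun _ => rfl
        map_xInfty := fun _ => rfl
        map_yInfty := fun _ => rfl }
    obtain ⟨h, hh, -⟩ := d.exists_restrict (c R 𝒢) idHom
    have := classify_of_hom hb hM (c R 𝒢).mem (hN R 𝒢) (AlgHom.id ℂ R) h hh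
    refine this.trans ?_
    refine Eq.trans ?_ (Category.id_comp _)
    congr 1
    exact Spec.map_id _
  · obtain ⟨h, hh, -⟩ := (c R ℱ).exists_restrict (c R' ℱ') f
    exact classify_of_hom _ _ _ _ φ h hh
  · obtain ⟨h, hh, huniq⟩ := existsUnique_hom_of_classify hI.spansLattice (c R ℱ).mem (hN R ℱ)
      (c R' ℱ').mem (hN R' ℱ') φ h
    obtain ⟨f⟩ := (c R ℱ).exists_hom (c R' ℱ') h hh
    exact ⟨⟨⟨f⟩, fun g => (c R ℱ).hom_ext (c R' ℱ')
      (fun h₁ h₂ e₁ e₂ => (huniq h₁ e₁).trans (huniq h₂ e₂).symm) g f⟩⟩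

theorem mainTheorem5 {E I J : Type} [Fintype E] [Fintype I] [Fintype J]
    (D : HypertoricDatum E I J) (η : I → ℤ) (hη : D.IsGeneric η) (m : E → ℤ) (γ : I → ℤ) :
    ∃ (Q : Scheme.{0}) (π : Q ⟶ Spec (CommRingCat.of ℂ)),
      IsSmoothVariety π ∧ Nonempty (ModuliEquiv D m η γ Q π) :=
  -- The coordinates are now coefficients: each repeats the weight of its section, which `isCharted`
  -- allows through the map `ε`.
  have h : IsCharted (coordWeight D m γ) η := D.isCharted hη Sigma.fst
  ⟨ToricQuotient.quotient (coordWeight D m γ) η, ToricQuotient.structureMap (coordWeight D m γ) η,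
    ToricQuotient.isSmoothVariety h, nonempty_moduliEquiv D h⟩
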